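/- **Definitions.** A ranked alphabet $\Sigma$ is a finite set of symbols, each with a rank in $\mathbb N$; $m_\Sigma$ is the maximal rank and $T_\Sigma$ is the set of ranked trees over $\Sigma$. The $i$-th child of a node ($i\ge 1$) has child number $i$, and the root has child number $0$. Let $k\ge 0$. A *pebble tree transducer with at most $k$ visible pebbles (and unboundedly many invisible pebbles)* $M$ consists of an input alphabet $\Sigma$, an output alphabet $\Delta$ (both ranked), a finite set $Q$ of states, a set $Q_0\subseteq Q$ of initial states, disjoint finite sets $C_{\mathrm v}$ and $C_{\mathrm i}$ of visible and invisible pebble colours, with $C=C_{\mathrm v}\cup C_{\mathrm i}$, and a finite set of rules. Each rule has a left-hand side $\langle q,\sigma,j,b\rangle$ with $q\in Q$, $\sigma\in\Sigma$, $0\le j\le m_\Sigma$, and $b\subseteq C$ with $\#(b\cap C_{\mathrm v})\le k$ and $\#(b\cap C_{\mathrm i})\le 1$. Its right-hand side is either $\langle q',\alpha\rangle$, where $q'\in Q$ and $\alpha$ is one of the instructions $\mathrm{stay}$, $\mathrm{up}$ (if $j\ne 0$), $\mathrm{down}_i$ (with $1\le i\le \mathrm{rank}(\sigma)$), $\mathrm{drop}_c$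 (with $c\in C$), $\mathrm{lift}_c$ (with $c\in b$), or $\delta(\langle q_1,\mathrm{stay}\rangle,\dots,\langle q_m,\mathrm{stay}\rangle)$, where $\delta\in\Delta$ has rank $m$ and $q_1,\dots,q_m\in Q$ (an output rule). A configuration $\langle q,u,\pi\rangle$ on $t\in T_\Sigma$ consists of a state $q$, a node $u$ of $t$, and a stack $\pi$ of pairs (node, colour). A rule is relevant to it if $q$ is its state, $\sigma$ and $j$ are the label and child number of $u$, and $b$ is the set of colours of the observable pebbles at $u$, that is, of all $c\in C_{\mathrm v}$ such that $(u,c)$ occurs in $\pi$ and of $c\in C_{\mathrm i}$ if $(u,c)$ is the topmost element of $\pi$. The instructions $\mathrm{stay},\mathrm{up},\mathrm{down}_i$ move to $u$ itself, its parent, or its $i$-th child; $\mathrm{drop}_c$ pushes $(u,c)$ on $\pi$, and is not applicable if $c\in C_{\mathrm v}$ and $\pi$ already contains a pebble of colour $c$ or already contains $k$ visible pebbles; $\mathrm{lift}_c$ pops the topmost element of $\pi$, and is applicable only if that element is $(u,c)$. Output forms are trees over $\Delta$ some of whose leaves are labelled by configurations. A computation step rewrites one such leaf $\langle q,u,\pi\rangle$,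 by a relevant rule, into the resulting configuration or, for an output rule, into $\delta(\langle q_1,u,\pi\rangle,\dots,\langle q_m,u,\pi\rangle)$. The transduction $\tau_M$ is the set of all $(t,s)\in T_\Sigma\times T_\Delta$ such that for some $q_0\in Q_0$ the tree $s$ can be reached by computation steps on $t$ from $\langle q_0,\mathrm{root}_t,\varepsilon\rangle$. Let $\mathrm{VIPTT}_k$ be the class of all transductions $\tau_M$ of such transducers, and let $\mathrm{TT}$ be the class of transductions of *tree-walking tree transducers without pebbles*, i.e., those with $k=0$ and $C=\emptyset$. Composition of relations is $R\circ S=\{(a,c)\mid \exists b:(a,b)\in R,\ (b,c)\in S\}$; for classes of relations, $\mathcal R\circ\mathcal S=\{R\circ S\mid R\in\mathcal R,\,S\in\mathcal S\}$, $\mathcal R^1=\mathcal R$, and $\mathcal R^{n+1}=\mathcal R\circ\mathcal R^n$ for $n\ge1$. **Theorem.** For every $k\ge 0$, $$\mathrm{VIPTT}_k\subseteq \mathrm{TT}^{k+2}.$$ For every fixed $k$ the decomposition can be constructed in polynomial time: there is a polynomial-time algorithm (on a Turing machine) which, given a pebble tree transducer $M$ with at most $k$ visible pebbles, outputs $k+2$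 tree-walking tree transducers $N_1,\dots,N_{k+2}$ without pebbles such that $\tau_{N_1}\circ\cdots\circ\tau_{N_{k+2}}=\tau_M$. Here a transducer is presented by a listing of its components, with the ranks of the symbols (and all other numbers) written in unary. -/

import Mathlib

namespace PebbleTree

/-! ### Ranked alphabets and ranked trees -/

/-- A ranked alphabet: a finite set of symbols, each with a rank. -/
structure RankedAlphabet where
  Sym : Type
  [fintype : Fintype Sym]
  rank : Sym → ℕ

attribute [instance] RankedAlphabet.fintype

/-- The maximal rank of the symbols of an alphabet. -/
def RankedAlphabet.maxRank (A : RankedAlphabet) : ℕ := Finset.univ.sup A.rank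

/-- The ranked trees over `A`. -/
inductive RankedAlphabet.Tree (A : RankedAlphabet) : Type where
  | node (a : A.Sym) (children : Fin (A.rank a) → A.Tree) : A.Tree

/-- Nodes of a tree are given by their address, the sequence of child numbers on the path that
leads to them, written with the last step first: the root is `[]` and the `i`-th child
(`i = 1, 2, …`) of the node `u` is `i :: u`. -/
abbrev Address : Type := List ℕ

/-- The child number of a node; the root has child number `0`. -/
def Address.childNo (u : Address) : ℕ := u.headD 0

/-- The `i`-th subtree (`i = 1, 2, …`) of a tree, if there is one. -/
def RankedAlphabet.Tree.child? {A : RankedAlphabet} : A.Tree → ℕ → Option A.Tree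
  | .node a ch, i => if h : 1 ≤ i ∧ i ≤ A.rank a then some (ch ⟨i - 1, by omega⟩) else none

/-- The subtree at a node `u` of `t`; it is `none` if `u` is not a node of `t`. -/
def RankedAlphabet.Tree.subtree? {A : RankedAlphabet} (t : A.Tree) : Address → Option A.Tree
  | [] => some t
  | i :: u => (t.subtree? u).bind fun s => s.child? i

/-- The label of the root. -/
def RankedAlphabet.Tree.rootLabel {A : RankedAlphabet} : A.Tree → A.Sym
  | .node a _ => a

/-- The label of the node `u` of `t`; it is `none` if `u` is not a node of `t`. -/
def RankedAlphabet.Tree.label? {A : RankedAlphabet} (t : A.Tree) (u : Address) : Option A.Sym :=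
  (t.subtree? u).map RankedAlphabet.Tree.rootLabel

/-! ### Pebble tree transducers: syntax

Throughout, `V` and `I` are the sets of visible and invisible pebble colours, and `V ⊕ I` is the
set of all colours. -/

/-- The instructions. -/
inductive Instr (V I : Type) : Type where
  | stay : Instr V I
  | up : Instr V I
  | down (i : ℕ) : Instr V I
  | drop (c : V ⊕ I) : Instr V I
  | lift (c : V ⊕ I) : Instr V I

/-- The right-hand sides of rules: `⟨q, α⟩` with an instruction `α`, or
`d(⟨q₁, stay⟩, …, ⟨qₘ, stay⟩)` with an output symbol `d` of rank `m`. -/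
inductive Rhs (D : RankedAlphabet) (Q V I : Type) : Type where
  | act (q : Q) (α : Instr V I) : Rhs D Q V I
  | out (d : D.Sym) (qs : Fin (D.rank d) → Q) : Rhs D Q V I

/-- A rule `⟨q, a, j, b⟩ → rhs`: state `q`, input symbol `a`, child number `j`, and set `b` of
colours of observable pebbles. -/
structure Rule (S D : RankedAlphabet) (Q V I : Type) where
  q : Q
  a : S.Sym
  j : ℕ
  b : Finset (V ⊕ I)
  rhs : Rhs D Q V I

/-- The syntactic requirements on the right-hand side of a rule. -/
def Rhs.Allowed {D : RankedAlphabet} {Q V I : Type} (S : RankedAlphabet) (a : S.Sym) (j : ℕ)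
    (b : Finset (V ⊕ I)) : Rhs D Q V I → Prop
  | .act _ .stay => True
  | .act _ .up => j ≠ 0
  | .act _ (.down i) => 1 ≤ i ∧ i ≤ S.rank a
  | .act _ (.drop _) => True
  | .act _ (.lift c) => c ∈ b
  | .out _ _ => True

/-- The syntactic requirements on a rule of a transducer with at most `k` visible pebbles. -/
def Rule.WellFormed {S D : RankedAlphabet} {Q V I : Type} (k : ℕ) (r : Rule S D Q V I) : Prop :=
  r.j ≤ S.maxRank ∧ r.b.toLeft.card ≤ k ∧ r.b.toRight.card ≤ 1 ∧ r.rhs.Allowed S r.a r.j r.b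

/-- A (nondeterministic) pebble tree transducer with input alphabet `S`, output alphabet `D`, set
of states `Q`, visible colours `V` and invisible colours `I`, that uses at most `k` visible
pebbles. Its finite set of rules is given by a list of its elements. -/
structure PTT (S D : RankedAlphabet) (Q V I : Type) (k : ℕ) where
  init : Finset Q
  rules : List (Rule S D Q V I)
  wellFormed : ∀ r ∈ rules, r.WellFormed k

/-- A tree-walking tree transducer without pebbles. -/
abbrev TT (S D : RankedAlphabet) (Q : Type) : Type := PTT S D Q (Fin 0) (Fin 0) 0

/-! ### Pebble tree transducers: semantics -/

/-- A pebble stack: the positions and colours of the pebbles on the tree. The head of the list is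
the top of the stack, i.e., the pebble that was dropped last. -/
abbrev Stack (V I : Type) : Type := List (Address × (V ⊕ I))

/-- A configuration: state, position of the head, pebble stack. -/
structure Config (Q V I : Type) where
  state : Q
  pos : Address
  stack : Stack V I

/-- A pebble of colour `c` is observable at node `u`: all visible pebbles at `u` are, and an
invisible pebble at `u` is if it is the topmost pebble. -/
def Observable {V I : Type} (u : Address) (π : Stack V I) : V ⊕ I → Prop
  | .inl v => (u, .inl v) ∈ π
  | .inr i => π.head? = some (u, .inr i)

/-- A rule is relevant to a configuration on `t`. -/
def Rule.Relevant {S D : RankedAlphabet} {Q V I : Type} (t : S.Tree) (r : Rule S D Q V I)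
    (c : Config Q V I) : Prop :=
  r.q = c.state ∧ t.label? c.pos = some r.a ∧ c.pos.childNo = r.j ∧
    ∀ x : V ⊕ I, x ∈ r.b ↔ Observable c.pos c.stack x

/-- The effect of an instruction on head position and pebble stack. Instructions that cannot be
applied are not related to anything. -/
inductive Instr.Effect {V I : Type} (k : ℕ) :
    Instr V I → Address → Stack V I → Address → Stack V I → Prop where
  | stay (u : Address) (π : Stack V I) : Effect k .stay u π u π
  | up (i : ℕ) (u : Address) (π : Stack V I) : Effect k .up (i :: u) π u π
  | down (i : ℕ) (u : Address) (π : Stack V I) : Effect k (.down i) u π (i :: u) π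
  | dropVisible (v : V) (u : Address) (π : Stack V I)
      (fresh : ∀ p ∈ π, p.2 ≠ .inl v) (few : π.countP (fun p => p.2.isLeft) < k) :
      Effect k (.drop (.inl v)) u π u ((u, .inl v) :: π)
  | dropInvisible (i : I) (u : Address) (π : Stack V I) :
      Effect k (.drop (.inr i)) u π u ((u, .inr i) :: π)
  | lift (c : V ⊕ I) (u : Address) (π : Stack V I) :
      Effect k (.lift c) u ((u, c) :: π) u π

/-- Output forms: trees over `D` in which some leaves are labelled by elements of `X`. -/
inductive Form (D : RankedAlphabet) (X : Type) : Type where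
  | leaf (x : X) : Form D X
  | node (d : D.Sym) (children : Fin (D.rank d) → Form D X) : Form D X

/-- A tree over `D`, viewed as an output form. -/
def RankedAlphabet.Tree.toForm {D : RankedAlphabet} {X : Type} : D.Tree → Form D X
  | .node d ch => .node d fun i => (ch i).toForm

/-- The computation steps of `M` on `t` that start in a single configuration. -/
inductive PTT.ConfigStep {S D : RankedAlphabet} {Q V I : Type} {k : ℕ} (M : PTT S D Q V I k)
    (t : S.Tree) : Config Q V I → Form D (Config Q V I) → Prop where
  | act (r : Rule S D Q V I) (c : Config Q V I) (q : Q) (α : Instr V I) (u : Address)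
      (π : Stack V I) (mem : r ∈ M.rules) (relevant : r.Relevant t c) (rhs : r.rhs = .act q α)
      (effect : α.Effect k c.pos c.stack u π) : ConfigStep M t c (.leaf ⟨q, u, π⟩)
  | out (r : Rule S D Q V I) (c : Config Q V I) (d : D.Sym) (qs : Fin (D.rank d) → Q)
      (mem : r ∈ M.rules) (relevant : r.Relevant t c) (rhs : r.rhs = .out d qs) :
      ConfigStep M t c (.node d fun i => .leaf ⟨qs i, c.pos, c.stack⟩)

/-- The computation steps of `M` on `t`: one leaf of the output form is rewritten. -/
inductive PTT.Step {S D : RankedAlphabet} {Q V I : Type} {k : ℕ} (M : PTT S D Q V I k)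
    (t : S.Tree) : Form D (Config Q V I) → Form D (Config Q V I) → Prop where
  | here (c : Config Q V I) (s : Form D (Config Q V I)) (step : M.ConfigStep t c s) :
      Step M t (.leaf c) s
  | inside (d : D.Sym) (ch : Fin (D.rank d) → Form D (Config Q V I)) (i : Fin (D.rank d))
      (s : Form D (Config Q V I)) (step : Step M t (ch i) s) :
      Step M t (.node d ch) (.node d (Function.update ch i s))

/-- The transduction realized by `M`. -/
def PTT.transduction {S D : RankedAlphabet} {Q V I : Type} {k : ℕ} (M : PTT S D Q V I k) :
    SetRel S.Tree D.Tree :=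
  {p | ∃ q ∈ M.init, Relation.ReflTransGen (M.Step p.1) (.leaf ⟨q, [], []⟩) p.2.toForm}

/-! ### Classes of transductions -/

/-- Classes of tree transductions. -/
abbrev TransductionClass : Type 1 := ∀ S D : RankedAlphabet, Set (SetRel S.Tree D.Tree)

/-- The transductions of pebble tree transducers with at most `k` visible pebbles and an unbounded
number of invisible pebbles. -/
def VIPTT (k : ℕ) : TransductionClass := fun S D =>
  {R | ∃ (Q V I : Type) (_ : Finite Q) (_ : Finite V) (_ : Finite I) (M : PTT S D Q V I k),
    M.transduction = R}

/-- The transductions of tree-walking tree transducers without pebbles. -/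
def TTClass : TransductionClass := fun S D =>
  {R | ∃ (Q : Type) (_ : Finite Q) (M : TT S D Q), M.transduction = R}

/-- Composition of classes: all compositions of a transduction in `F` followed by one in `G`. -/
def TransductionClass.comp (F G : TransductionClass) : TransductionClass := fun S D =>
  {R | ∃ (T : RankedAlphabet) (R₁ : SetRel S.Tree T.Tree) (R₂ : SetRel T.Tree D.Tree),
    R₁ ∈ F S T ∧ R₂ ∈ G T D ∧ R = R₁.comp R₂}

/-- Powers of a class for exponents `n ≥ 1`: `F¹ = F` and `Fⁿ⁺¹ = F ∘ Fⁿ`. (The exponent `0` is not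
used; its value is the empty class.) -/
def TransductionClass.pow (F : TransductionClass) : ℕ → TransductionClass
  | 0 => fun _ _ => ∅
  | 1 => F
  | n + 2 => F.comp (F.pow (n + 1))

/-! ### Transducers as inputs and outputs of algorithms

Transducers are presented with numbers as names of symbols, states and colours. -/

/-- The ranked alphabet with symbols `0, …, l.length - 1` whose ranks are listed by `l`. -/
abbrev RankedAlphabet.ofRanks (l : List ℕ) : RankedAlphabet where
  Sym := Fin l.length
  rank := l.get

/-- A presentation of a pebble tree transducer with at most `k` visible pebbles. -/
structure PTTCode (k : ℕ) where
  /-- the ranks of the input symbols -/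
  input : List ℕ
  /-- the ranks of the output symbols -/
  output : List ℕ
  /-- the number of states -/
  states : ℕ
  /-- the number of visible colours -/
  visible : ℕ
  /-- the number of invisible colours -/
  invisible : ℕ
  ptt : PTT (.ofRanks input) (.ofRanks output) (Fin states) (Fin visible) (Fin invisible) k

/-- A chain of `n ≥ 1` tree-walking tree transducers without pebbles, from trees over `input` to
trees over `output`, where the output alphabet of each is the input alphabet of the next. -/
inductive TTChain : ℕ → List ℕ → List ℕ → Type where
  | single {input output : List ℕ} (states : ℕ)
      (tt : TT (.ofRanks input) (.ofRanks output) (Fin states)) : TTChain 1 input output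
  | cons {n : ℕ} {input middle output : List ℕ} (states : ℕ)
      (tt : TT (.ofRanks input) (.ofRanks middle) (Fin states))
      (rest : TTChain n middle output) : TTChain (n + 1) input output

/-- The composition of the transductions realized by the members of a chain. -/
def TTChain.transduction : {n : ℕ} → {input output : List ℕ} → TTChain n input output →
    SetRel (RankedAlphabet.ofRanks input).Tree (RankedAlphabet.ofRanks output).Tree
  | _, _, _, .single _ tt => tt.transduction
  | _, _, _, .cons _ tt rest => tt.transduction.comp rest.transduction

/-- Sequences of numbers as bit strings, with the numbers written in unary. -/
def unary (l : List ℕ) : List Bool := l.flatMap fun n => List.replicate n true ++ [false]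

/-- A list of numbers, preceded by its length. -/
def lengthPrefixed (l : List ℕ) : List ℕ := l.length :: l

/-- The characteristic sequence of a subset of `Fin n`. -/
def bits {n : ℕ} (s : Finset (Fin n)) : List ℕ :=
  (List.finRange n).map fun i => if i ∈ s then 1 else 0

/-- An instruction as a sequence of numbers. -/
def Instr.serialize {v i : ℕ} : Instr (Fin v) (Fin i) → List ℕ
  | .stay => [0, 0]
  | .up => [1, 0]
  | .down m => [2, m]
  | .drop (.inl c) => [3, c]
  | .drop (.inr c) => [4, c]
  | .lift (.inl c) => [5, c]
  | .lift (.inr c) => [6, c]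

/-- A right-hand side as a sequence of numbers. -/
def Rhs.serialize {output : List ℕ} {n v i : ℕ} :
    Rhs (.ofRanks output) (Fin n) (Fin v) (Fin i) → List ℕ
  | .act q α => 0 :: (q : ℕ) :: α.serialize
  | .out d qs => 1 :: Fin.val (n := output.length) d :: List.ofFn fun m => (qs m : ℕ)

/-- A rule as a sequence of numbers. -/
def Rule.serialize {input output : List ℕ} {n v i : ℕ}
    (r : Rule (.ofRanks input) (.ofRanks output) (Fin n) (Fin v) (Fin i)) : List ℕ :=
  [(r.q : ℕ), Fin.val (n := input.length) r.a, r.j] ++ bits r.b.toLeft ++ bits r.b.toRight ++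
    r.rhs.serialize

/-- A transducer (with its alphabets) as a sequence of numbers. -/
def PTT.serialize {input output : List ℕ} {n v i k : ℕ}
    (M : PTT (.ofRanks input) (.ofRanks output) (Fin n) (Fin v) (Fin i) k) : List ℕ :=
  lengthPrefixed input ++ lengthPrefixed output ++ [n, v, i] ++ bits M.init ++
    M.rules.length :: M.rules.flatMap Rule.serialize

/-- The bit string that presents a pebble tree transducer to an algorithm. -/
def PTTCode.encode {k : ℕ} (p : PTTCode k) : List Bool := unary p.ptt.serialize

/-- A chain of transducers as a sequence of numbers. -/
def TTChain.serialize : {n : ℕ} → {input output : List ℕ} → TTChain n input output → List ℕ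
  | _, _, _, .single _ tt => tt.serialize
  | _, _, _, .cons _ tt rest => tt.serialize ++ rest.serialize

/-- The bit string by which an algorithm presents a chain of transducers. -/
def TTChain.encode {n : ℕ} {input output : List ℕ} (c : TTChain n input output) : List Bool :=
  unary c.serialize

end PebbleTree

/-! An invisible pebble can be observed only while it is topmost, so the stack can be unfolded into
the input tree. Re-root `t` at the node that carries the topmost pebble, and label each node with
its original label and child number, the direction in which that pebble lies, and the colour of the
pebble. To each node attach, for every colour, a further copy of `t` that is re-rooted at this node
and stands for the situation after a pebble of that colour has been dropped there; continue in the
same way inside the copies. A node of the resulting tree amounts to a node of `t` together with a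
whole stack (`Pos.unique`, `Pos.node_unique`). A move in `t` is a step inside one copy, dropping a
pebble is descending to the root of a new copy, and lifting it is ascending from that root. A
tree-walking transducer `encTT` without pebbles can produce this tree, except that its output has to
be finite; it therefore cuts off nested copies nondeterministically.

Visible pebbles are removed one at a time. Only invisible pebbles lie beneath the first visible one,
so it too can be represented by a descent. While it is on the stack the head stays in its copy,
whose labels tell at every node whether this pebble is there, so it never has to be dropped. The
pebbles above it are really dropped on the copy, and at most `k - 1` of them are visible. To lift
it, one must know that it is topmost; an additional invisible pebble at the root of the copy,
beneath all the real ones, is observable at the head exactly when the first visible pebble is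
topmost and at the head. Hence a transducer with at most `k` visible pebbles is `encTT` followed by
one with at most `k - 1` (`encTT_comp_simPTT`). For `k = 0` the simulating transducer never drops a
pebble (`simPTT_rhs_ne_drop`), so its pebbles can be erased (`PTT.transduction_erase`). This gives
two factors for `k = 0` and one more for each visible pebble.

The simulation is sound on every encoded tree, because no rule is relevant at a cut
(`simPTT_sound`). Conversely, a successful computation is a finite derivation, so its stacks have
bounded height (`PTT.Gen.exists_bound`), and some encoded tree is deep enough for it (`Enc.exists`,
`simPTT_complete`). Both directions are inductions on a big-step semantics (`PTT.steps_iff_gen`)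
along the relation `SimRel`.

For the algorithm, the rules of both transducers are listed by nested loops over the given rules and
over numbers of polynomial size. Such loops are expressed in a small language of stack programs that
is compiled to Turing machines (`Cmd.computableInPolyTime`). The expressions `encTTList` and
`simList` are shown to agree with the serializations of the transducers, and since `k` is fixed,
`chainList` composes a constant number of polynomial stages. -/

/-! ### A structured programming language for stack machines -/

namespace StackProgram

/-- The registers; each holds a stack of bits. -/
inductive Reg : Type where
  | inp : Reg
  | acc : Reg
  | rev : Reg
  | fin : Reg
  | var (n : ℕ) : Reg
  | tmp (n : ℕ) : Reg
  deriving DecidableEq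

/-- The contents of the registers; the head of a list is the top of the stack. -/
abbrev State : Type := Reg → List Bool

/-- Structured programs: `case` pops a register and branches on the result, `loop` pops a register
until it is empty and executes one of its bodies for every bit that is popped. -/
inductive Cmd : Type where
  | skip : Cmd
  | push (r : Reg) (b : Bool) : Cmd
  | seq (c d : Cmd) : Cmd
  | case (r : Reg) (cn ct cf : Cmd) : Cmd
  | loop (r : Reg) (ct cf : Cmd) : Cmd

/-- Big-step semantics with the number of machine steps. -/
inductive Exec : Cmd → State → State → ℕ → Prop where
  | skip (s : State) : Exec .skip s s 0
  | push (r : Reg) (b : Bool) (s : State) : Exec (.push r b) s (Function.update s r (b :: s r)) 1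
  | seq {c d : Cmd} {s s' s'' : State} {m n : ℕ} (hc : Exec c s s' m) (hd : Exec d s' s'' n) :
      Exec (.seq c d) s s'' (m + n)
  | caseNil {r : Reg} {cn ct cf : Cmd} {s s' : State} {n : ℕ} (h : s r = [])
      (hc : Exec cn s s' n) : Exec (.case r cn ct cf) s s' (n + 2)
  | caseTrue {r : Reg} {cn ct cf : Cmd} {s s' : State} {l : List Bool} {n : ℕ}
      (h : s r = true :: l) (hc : Exec ct (Function.update s r l) s' n) :
      Exec (.case r cn ct cf) s s' (n + 2)
  | caseFalse {r : Reg} {cn ct cf : Cmd} {s s' : State} {l : List Bool} {n : ℕ}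
      (h : s r = false :: l) (hc : Exec cf (Function.update s r l) s' n) :
      Exec (.case r cn ct cf) s s' (n + 2)
  | loopNil {r : Reg} {ct cf : Cmd} {s : State} (h : s r = []) : Exec (.loop r ct cf) s s 1
  | loopTrue {r : Reg} {ct cf : Cmd} {s s' s'' : State} {l : List Bool} {m n : ℕ}
      (h : s r = true :: l) (hc : Exec ct (Function.update s r l) s' m)
      (hl : Exec (.loop r ct cf) s' s'' n) : Exec (.loop r ct cf) s s'' (m + 2 + n)
  | loopFalse {r : Reg} {ct cf : Cmd} {s s' s'' : State} {l : List Bool} {m n : ℕ}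
      (h : s r = false :: l) (hc : Exec cf (Function.update s r l) s' m)
      (hl : Exec (.loop r ct cf) s' s'' n) : Exec (.loop r ct cf) s s'' (m + 2 + n)

/-! ### Compilation to jump code -/

/-- Jump code. -/
inductive Instr : Type where
  | push (r : Reg) (b : Bool) : Instr
  | pop (r : Reg) (ln lt lf : ℕ) : Instr
  | jump (l : ℕ) : Instr

/-- The length of the code of a program. -/
def Cmd.size : Cmd → ℕ
  | .skip => 0
  | .push _ _ => 1
  | .seq c d => c.size + d.size
  | .case _ cn ct cf => cn.size + ct.size + cf.size + 4
  | .loop _ ct cf => ct.size + cf.size + 3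

/-- The code of a program that is placed at address `p`. -/
def Cmd.compile : Cmd → ℕ → List Instr
  | .skip, _ => []
  | .push r b, _ => [.push r b]
  | .seq c d, p => c.compile p ++ d.compile (p + c.size)
  | .case r cn ct cf, p =>
      [.pop r (p + 1) (p + cn.size + 2) (p + cn.size + ct.size + 3)] ++ cn.compile (p + 1) ++
      [.jump (p + (cn.size + ct.size + cf.size + 4))] ++ ct.compile (p + cn.size + 2) ++
      [.jump (p + (cn.size + ct.size + cf.size + 4))] ++ cf.compile (p + cn.size + ct.size + 3) ++
      [.jump (p + (cn.size + ct.size + cf.size + 4))]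
  | .loop r ct cf, p =>
      [.pop r (p + (ct.size + cf.size + 3)) (p + 1) (p + ct.size + 2)] ++ ct.compile (p + 1) ++
      [.jump p] ++ cf.compile (p + ct.size + 2) ++ [.jump p]

theorem Cmd.length_compile (c : Cmd) (p : ℕ) : (c.compile p).length = c.size := by
  induction c generalizing p <;> simp [compile, size, *] <;> omega

/-- One step of jump code. -/
def flatStep (P : List Instr) (c : ℕ × State) : Option (ℕ × State) :=
  match P[c.1]? with
  | none => none
  | some (.push r b) => some (c.1 + 1, Function.update c.2 r (b :: c.2 r))
  | some (.jump l) => some (l, c.2)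
  | some (.pop r ln lt lf) =>
    match c.2 r with
    | [] => some (ln, c.2)
    | true :: l => some (lt, Function.update c.2 r l)
    | false :: l => some (lf, Function.update c.2 r l)

/-- Runs of jump code of a given length. -/
inductive FlatRun (P : List Instr) : ℕ × State → ℕ × State → ℕ → Prop where
  | refl (c : ℕ × State) : FlatRun P c c 0
  | head {a b c : ℕ × State} {n : ℕ} (h : flatStep P a = some b) (t : FlatRun P b c n) :
      FlatRun P a c (n + 1)

theorem FlatRun.trans {P : List Instr} {a b c : ℕ × State} {m n : ℕ} (h : FlatRun P a b m)
    (h' : FlatRun P b c n) : FlatRun P a c (m + n) := by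
  induction h with
  | refl => simpa
  | head h _ ih => rw [Nat.add_right_comm]; exact .head h (ih h')

theorem FlatRun.tail {P : List Instr} {a b c : ℕ × State} {m : ℕ} (h : FlatRun P a b m)
    (h' : flatStep P b = some c) : FlatRun P a c (m + 1) :=
  h.trans (.head h' (.refl _))

/-- The list `L` occurs in `P` at position `p`. -/
def OccursAt (P : List Instr) (p : ℕ) (L : List Instr) : Prop :=
  ∃ A B, P = A ++ L ++ B ∧ A.length = p

theorem OccursAt.left {P L L' : List Instr} {p : ℕ} (h : OccursAt P p (L ++ L')) :
    OccursAt P p L := by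
  obtain ⟨A, B, h, h'⟩ := h
  exact ⟨A, L' ++ B, by simp [h], h'⟩

theorem OccursAt.right {P L L' : List Instr} {p : ℕ} (h : OccursAt P p (L ++ L')) {q : ℕ}
    (hq : q = p + L.length) : OccursAt P q L' := by
  obtain ⟨A, B, h, h'⟩ := h
  exact ⟨A ++ L, B, by simp [h], by simp [h', hq]⟩

theorem OccursAt.get {P : List Instr} {p : ℕ} {i : Instr} (h : OccursAt P p [i]) :
    P[p]? = some i := by
  obtain ⟨A, B, h, rfl⟩ := h
  simp [h]

/-- Induction on the execution, not on the program, since a loop is re-entered at the same address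
`p`. The costs of `Exec` are exact: the two extra steps of a branch or a loop round are the `pop`
and the closing `jump`. -/
theorem Exec.flatRun {c : Cmd} {s s' : State} {n : ℕ} (h : Exec c s s' n) (P : List Instr) (p : ℕ)
    (hP : OccursAt P p (c.compile p)) : FlatRun P (p, s) (p + c.size, s') n := by
  induction h generalizing p with
  | skip s => exact .refl _
  | push r b s =>
    refine .head (b := (p + 1, _)) ?_ (.refl _)
    simp [flatStep, OccursAt.get hP]
  | @seq c d s s' s'' m n _ _ ihc ihd =>
    have h₂ := ihd (p + c.size) (hP.right (by rw [Cmd.length_compile]))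
    rw [Nat.add_assoc] at h₂
    exact (ihc p hP.left).trans h₂
  | @caseNil r cn ct cf s s' n h _ ih =>
    have h1 := hP.left.left.left.left.left
    have h0 := h1.left.get
    have h2 := (ih _ (h1.right (by simp)))
    have h3 := (hP.left.left.left.left.right (q := p + 1 + cn.size)
      (by simp [Cmd.length_compile]; omega)).get
    refine (FlatRun.head (b := (p + 1, s)) (by simp [flatStep, h0, h]) h2).tail ?_
    simp [flatStep, h3, Cmd.size]
  | @caseTrue r cn ct cf s s' l n h _ ih =>
    have h0 := hP.left.left.left.left.left.left.get
    have h2 := (ih (p + cn.size + 2) (hP.left.left.left.right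
      (by simp [Cmd.length_compile]; omega)))
    have h3 := (hP.left.left.right (q := p + cn.size + 2 + ct.size)
      (by simp [Cmd.length_compile]; omega)).get
    refine (FlatRun.head (b := (p + cn.size + 2, _)) (by simp [flatStep, h0, h]) h2).tail ?_
    simp [flatStep, h3, Cmd.size]
  | @caseFalse r cn ct cf s s' l n h _ ih =>
    have h0 := hP.left.left.left.left.left.left.get
    have h2 := (ih (p + cn.size + ct.size + 3) (hP.left.right
      (by simp [Cmd.length_compile]; omega)))
    have h3 := (hP.right (q := p + cn.size + ct.size + 3 + cf.size)
      (by simp [Cmd.length_compile]; omega)).get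
    refine (FlatRun.head (b := (p + cn.size + ct.size + 3, _))
      (by simp [flatStep, h0, h]) h2).tail ?_
    simp [flatStep, h3, Cmd.size]
  | @loopNil r ct cf s h =>
    refine .head (b := (p + (ct.size + cf.size + 3), _)) ?_ (.refl _)
    simp [flatStep, hP.left.left.left.left.get, h]
  | @loopTrue r ct cf s s' s'' l m n h _ _ ih ih' =>
    have h0 := hP.left.left.left.left.get
    have h2 := ih (p + 1) (hP.left.left.left.right (by simp))
    have h3 := (hP.left.left.right (q := p + 1 + ct.size)
      (by simp [Cmd.length_compile]; omega)).get
    refine FlatRun.trans ((FlatRun.head (b := (p + 1, _)) (by simp [flatStep, h0, h]) h2).tail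
      (c := (p, s')) ?_) (ih' p hP)
    simp [flatStep, h3]
  | @loopFalse r ct cf s s' s'' l m n h _ _ ih ih' =>
    have h0 := hP.left.left.left.left.get
    have h2 := ih (p + ct.size + 2) (hP.left.right (by simp [Cmd.length_compile]; omega))
    have h3 := (hP.right (q := p + ct.size + 2 + cf.size)
      (by simp [Cmd.length_compile]; omega)).get
    refine FlatRun.trans ((FlatRun.head (b := (p + ct.size + 2, _))
      (by simp [flatStep, h0, h]) h2).tail (c := (p, s')) ?_) (ih' p hP)
    simp [flatStep, h3]

/-! ### Jump code on Turing machines -/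

/-- The registers that occur in an instruction. -/
def Instr.regs : Instr → Finset Reg
  | .push r _ => {r}
  | .pop r _ _ _ => {r}
  | .jump _ => ∅

/-- The registers that occur in jump code, with the registers for input and output. -/
def regs (P : List Instr) : Finset Reg :=
  P.foldr (fun i F => i.regs ∪ F) {.inp, .fin}

theorem regs_subset {P : List Instr} {i : Instr} (h : i ∈ P) : i.regs ⊆ regs P := by
  induction P with
  | nil => simp at h
  | cons a P ih =>
    rw [regs, List.foldr_cons, ← regs]
    rcases List.mem_cons.1 h with rfl | h
    · exact Finset.subset_union_left
    · exact (ih h).trans Finset.subset_union_right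

theorem inp_mem_regs (P : List Instr) : Reg.inp ∈ regs P := by
  induction P with
  | nil => simp [regs]
  | cons a P ih => rw [regs, List.foldr_cons, ← regs]; exact Finset.mem_union_right _ ih

theorem fin_mem_regs (P : List Instr) : Reg.fin ∈ regs P := by
  induction P with
  | nil => simp [regs]
  | cons a P ih => rw [regs, List.foldr_cons, ← regs]; exact Finset.mem_union_right _ ih

/-- The Turing machine statement for an instruction at address `p`. -/
def Instr.stmt (F : Finset Reg) (N p : ℕ) :
    Instr → Turing.TM2.Stmt (fun _ : {r // r ∈ F} => Bool) (Fin (N + 1)) (Option Bool)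
  | .push r b =>
    if h : r ∈ F then .push ⟨r, h⟩ (fun _ => b) (.goto fun _ => Fin.ofNat (N + 1) (p + 1))
    else .halt
  | .jump l => .goto fun _ => Fin.ofNat (N + 1) l
  | .pop r ln lt lf =>
    if h : r ∈ F then
      .pop ⟨r, h⟩ (fun _ o => o) (.branch (fun o => o == none)
        (.load (fun _ => none) (.goto fun _ => Fin.ofNat (N + 1) ln))
        (.branch (fun o => o == some true)
          (.load (fun _ => none) (.goto fun _ => Fin.ofNat (N + 1) lt))
          (.load (fun _ => none) (.goto fun _ => Fin.ofNat (N + 1) lf))))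
    else .halt

/-- The Turing machine that executes jump code. -/
def machine (P : List Instr) : Turing.FinTM2 where
  K := {r // r ∈ regs P}
  k₀ := ⟨.inp, inp_mem_regs P⟩
  k₁ := ⟨.fin, fin_mem_regs P⟩
  Γ _ := Bool
  Λ := Fin (P.length + 1)
  main := 0
  σ := Option Bool
  initialState := none
  Γk₀Fin := inferInstanceAs (Fintype Bool)
  m l := match P[l.val]? with
    | none => .halt
    | some i => i.stmt (regs P) P.length l.val

/-- The configuration of the Turing machine for a configuration of the jump code. -/
def toCfg (P : List Instr) (c : ℕ × State) : (machine P).Cfg :=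
  ⟨some (Fin.ofNat (P.length + 1) c.1), none, fun r => c.2 r.val⟩

/-- A machine step runs a whole statement up to its `goto`, and a `pop` clears the internal memory
before jumping. So one instruction is exactly one step, and the memory is `none` between
instructions. -/
theorem step_toCfg {P : List Instr} {c c' : ℕ × State} (h : flatStep P c = some c') :
    (machine P).step (toCfg P c) = some (toCfg P c') := by
  obtain ⟨p, s⟩ := c
  have hp : p < P.length := by
    by_contra hp
    simp [flatStep, List.getElem?_eq_none (not_lt.1 hp)] at h
  have hp' : (Fin.ofNat (P.length + 1) p).val = p := Nat.mod_eq_of_lt (by omega)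
  have hm := regs_subset (List.getElem_mem hp)
  have hget : P[p]? = some P[p] := List.getElem?_eq_getElem hp
  simp only [flatStep, hget] at h
  simp only [Turing.FinTM2.step, toCfg, Turing.TM2.step, machine, hp', hget]
  generalize P[p] = i at h hm
  have hu : ∀ (r : Reg) (hr : r ∈ regs P) (l : List Bool),
      Function.update (fun k : {r // r ∈ regs P} => s k.val) ⟨r, hr⟩ l =
      fun k : {r // r ∈ regs P} => Function.update s r l k.val := by
    intro r hr l
    funext k
    by_cases hk : k = ⟨r, hr⟩
    · subst hk; simp
    · have : k.val ≠ r := fun h => hk (Subtype.ext h)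
      simp [hk, this]
  cases i with
  | push r b =>
    have hr : r ∈ regs P := hm (by simp [Instr.regs])
    simp only [Option.some.injEq] at h
    subst h
    simp only [Instr.stmt, hr, dite_true, Turing.TM2.stepAux]
    exact congrArg (fun S => some (Turing.TM2.Cfg.mk _ none S)) (hu r hr _)
  | jump l =>
    simp only [Option.some.injEq] at h
    subst h
    rfl
  | pop r ln lt lf =>
    have hr : r ∈ regs P := hm (by simp [Instr.regs])
    simp only [Instr.stmt, hr, dite_true, Turing.TM2.stepAux]
    rcases hs : s r with _ | ⟨_ | _, l⟩ <;> simp only [hs, Option.some.injEq] at h <;> subst h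
    · refine congrArg (fun S => some (Turing.TM2.Cfg.mk _ none S)) ((hu r hr _).trans ?_)
      funext k
      simp only [List.tail_nil, Function.update_apply]
      split_ifs with hk
      · rw [hk, hs]
      · rfl
    · exact congrArg (fun S => some (Turing.TM2.Cfg.mk _ none S)) (hu r hr _)
    · exact congrArg (fun S => some (Turing.TM2.Cfg.mk _ none S)) (hu r hr _)

theorem FlatRun.iterate {P : List Instr} {c c' : ℕ × State} {n : ℕ} (h : FlatRun P c c' n) :
    (flip bind (machine P).step)^[n] (some (toCfg P c)) = some (toCfg P c') := by
  induction h with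
  | refl => rfl
  | @head a b c n h _ ih =>
    rw [Function.iterate_succ_apply, ← ih]
    exact congrArg _ (step_toCfg h)

/-- Programs that compute a function in polynomial time yield Turing machines. -/
theorem Cmd.computableInPolyTime {α : Type} (enc : α → List Bool) (f : α → List Bool) (c : Cmd)
    (T : Polynomial ℕ)
    (h : ∀ a, ∃ t ≤ T.eval (enc a).length, Exec c
      (Function.update (fun _ => []) Reg.inp (enc a))
      (Function.update (fun _ => []) Reg.fin (f a)) t) :
    Nonempty (Turing.TM2ComputableInPolyTime enc (id : List Bool → List Bool) f) := by
  refine ⟨{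
    tm := machine (c.compile 0)
    inputAlphabet := Equiv.refl Bool
    outputAlphabet := Equiv.refl Bool
    -- The additional step executes `halt` at the address just behind the code.
    time := T + 1
    outputsFun := fun a => ?_ }⟩
  -- The run to be exhibited is data, so the step count is extracted by choice.
  have h' := h a
  have ht := h'.choose_spec.1
  have he := h'.choose_spec.2
  generalize h'.choose = t at ht he
  have hr := (he.flatRun (c.compile 0) 0 ⟨[], [], by simp, rfl⟩).iterate
  refine ⟨⟨t + 1, ?_⟩, by simpa using ht⟩
  rw [Function.iterate_succ_apply']
  have hi : Turing.initList (machine (c.compile 0))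
      (List.map (Equiv.refl Bool).invFun (enc a)) = toCfg (c.compile 0)
        (0, Function.update (fun _ => []) Reg.inp (enc a)) := by
    simp only [Turing.initList, toCfg, machine]
    congr 1
    funext k
    by_cases hk : k = ⟨.inp, inp_mem_regs _⟩
    · subst hk; simp [Equiv.refl]; rfl
    · have : k.val ≠ Reg.inp := fun h => hk (Subtype.ext h)
      simp [hk, this]
  have hi' : (some (Turing.initList (machine (c.compile 0))
      (List.map (Equiv.refl Bool).invFun (enc a)))) = some (toCfg (c.compile 0)
        (0, Function.update (fun _ => []) Reg.inp (enc a))) := congrArg some hi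
  refine (congrArg (fun z => flip bind (machine (c.compile 0)).step
    ((flip bind (machine (c.compile 0)).step)^[t] z)) hi').trans ?_
  rw [hr]
  have hl : (c.compile 0)[(0 + c.size) % ((c.compile 0).length + 1)]? = none := by
    rw [Cmd.length_compile, zero_add, Nat.mod_eq_of_lt (by omega),
      List.getElem?_eq_none (by rw [Cmd.length_compile])]
  change some (Turing.TM2.stepAux (match (c.compile 0)[(0 + c.size) % ((c.compile 0).length + 1)]?
    with | none => _ | some i => _) _ _) = _
  rw [hl]
  simp only [Turing.TM2.stepAux, Option.map_some, Turing.haltList, machine]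
  refine congrArg some (congrArg (Turing.TM2.Cfg.mk _ _) ?_)
  funext k
  by_cases hk : k = ⟨.fin, fin_mem_regs _⟩
  · subst hk; simp [Equiv.refl]
  · have : k.val ≠ Reg.fin := fun h => hk (Subtype.ext h)
    simp [hk, this]

end StackProgram

/-! ### Running times of programs, and arithmetic in polynomial time -/

namespace StackProgram

open PebbleTree (unary)

/-- The program `c` leads from `s` to `s'` in at most `T` steps. -/
def Runs (c : Cmd) (s s' : State) (T : ℕ) : Prop := ∃ t ≤ T, Exec c s s' t

/-- A number in unary. -/
abbrev tally (n : ℕ) : List Bool := List.replicate n true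

theorem Runs.congr {c : Cmd} {s s' s'' : State} {T T' : ℕ} (h : Runs c s s' T) (hs : s' = s'')
    (hT : T ≤ T') : Runs c s s'' T' := by
  obtain ⟨t, ht, h⟩ := h
  exact ⟨t, ht.trans hT, hs ▸ h⟩

theorem Runs.skip (s : State) : Runs .skip s s 0 := ⟨0, le_rfl, .skip s⟩

theorem Runs.push (r : Reg) (b : Bool) (s : State) :
    Runs (.push r b) s (Function.update s r (b :: s r)) 1 := ⟨1, le_rfl, .push r b s⟩

theorem Runs.seq {c d : Cmd} {s s' s'' : State} {T T' : ℕ} (h : Runs c s s' T)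
    (h' : Runs d s' s'' T') : Runs (.seq c d) s s'' (T + T') := by
  obtain ⟨t, ht, h⟩ := h
  obtain ⟨t', ht', h'⟩ := h'
  exact ⟨t + t', add_le_add ht ht', .seq h h'⟩

theorem Runs.caseNil {r : Reg} {cn ct cf : Cmd} {s s' : State} {T : ℕ} (h : s r = [])
    (hc : Runs cn s s' T) : Runs (.case r cn ct cf) s s' (T + 2) := by
  obtain ⟨t, ht, hc⟩ := hc
  exact ⟨t + 2, by omega, .caseNil h hc⟩

theorem Runs.caseTrue {r : Reg} {cn ct cf : Cmd} {s s' : State} {T : ℕ} {l : List Bool}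
    (h : s r = true :: l) (hc : Runs ct (Function.update s r l) s' T) :
    Runs (.case r cn ct cf) s s' (T + 2) := by
  obtain ⟨t, ht, hc⟩ := hc
  exact ⟨t + 2, by omega, .caseTrue h hc⟩

theorem Runs.caseFalse {r : Reg} {cn ct cf : Cmd} {s s' : State} {T : ℕ} {l : List Bool}
    (h : s r = false :: l) (hc : Runs cf (Function.update s r l) s' T) :
    Runs (.case r cn ct cf) s s' (T + 2) := by
  obtain ⟨t, ht, hc⟩ := hc
  exact ⟨t + 2, by omega, .caseFalse h hc⟩

theorem Runs.seq' {c d : Cmd} {s s₁ s₂ s' : State} {T T' : ℕ} (h : Runs c s s₁ T)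
    (h' : Runs d s₂ s' T') (hs : s₁ = s₂) : Runs (.seq c d) s s' (T + T') := by
  subst hs
  exact h.seq h'

/-- The invariant rule for loops that fold a function `δ` over the bits of a register. -/
theorem Runs.loopFold {σ : Type} {r : Reg} {ct cf : Cmd} {T : ℕ} (S : List Bool → σ → State)
    (δ : σ → Bool → σ) (hS : ∀ l a, S l a r = l)
    (hb : ∀ b l a, Runs (if b then ct else cf) (Function.update (S (b :: l) a) r l)
      (S l (δ a b)) T) (l : List Bool) (a : σ) :
    Runs (.loop r ct cf) (S l a) (S [] (l.foldl δ a)) (l.length * (T + 2) + 1) := by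
  induction l generalizing a with
  | nil => exact ⟨1, by simp, .loopNil (hS _ _)⟩
  | cons b l ih =>
    obtain ⟨t, ht, h⟩ := ih (δ a b)
    obtain ⟨t', ht', h'⟩ := hb b l a
    refine ⟨t' + 2 + t, ?_, ?_⟩
    · simp only [List.length_cons]; nlinarith
    · cases b
      · exact .loopFalse (hS _ _) h' h
      · exact .loopTrue (hS _ _) h' h

/-- The invariant rule for loops over a number in unary. -/
theorem Runs.loopTally {r : Reg} {ct cf : Cmd} {T : ℕ} (S : ℕ → State) (k : ℕ)
    (hS : ∀ i ≤ k, S i r = tally (k - i))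
    (hb : ∀ i < k, Runs ct (Function.update (S i) r (tally (k - (i + 1)))) (S (i + 1)) T) :
    Runs (.loop r ct cf) (S 0) (S k) (k * (T + 2) + 1) := by
  induction k generalizing S with
  | zero => exact ⟨1, by simp, .loopNil (by simpa using hS 0 le_rfl)⟩
  | succ k ih =>
    obtain ⟨t, ht, h⟩ := ih (fun i => S (i + 1)) (fun i hi => by simpa using hS (i + 1) (by omega))
      (fun i hi => by simpa using hb (i + 1) (by omega))
    obtain ⟨t', ht', h'⟩ := hb 0 (by omega)
    refine ⟨t' + 2 + t, by nlinarith, .loopTrue (l := tally k) ?_ (by simpa using h') h⟩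
    simpa [List.replicate_succ] using hS 0 (by omega)

/-- Moves the contents of a register, in reverse order. -/
def moveReg (r r' : Reg) : Cmd := .loop r (.push r' true) (.push r' false)

theorem Runs.moveReg {r r' : Reg} (hr : r ≠ r') (s : State) (l : List Bool) (hl : s r = l) :
    Runs (moveReg r r') s
      (Function.update (Function.update s r []) r' (l.reverse ++ s r')) (l.length * 3 + 1) := by
  have := Runs.loopFold (r := r) (ct := .push r' true) (cf := .push r' false) (T := 1)
    (fun l a => Function.update (Function.update s r l) r' a) (fun a b => b :: a)
    (by simp [hr]) (fun b l a => by
      have : (if b then Cmd.push r' true else Cmd.push r' false) = .push r' b := by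
        cases b <;> rfl
      rw [this]
      refine (Runs.push _ _ _).congr ?_ le_rfl
      funext k
      simp only [Function.update_apply]
      split_ifs <;> simp_all) l (s r')
  rw [List.foldl_flip_cons_eq_append'] at this
  refine (Eq.mp ?_ this : Runs (.loop _ _ _) _ _ _)
  congr 1
  funext k
  simp only [Function.update_apply]
  split_ifs <;> simp_all

/-- Empties a register. -/
def clearReg (r : Reg) : Cmd := .loop r .skip .skip

theorem Runs.clearReg (r : Reg) (s : State) (l : List Bool) (hl : s r = l) :
    Runs (clearReg r) s (Function.update s r []) (l.length * 2 + 1) := by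
  have := Runs.loopFold (r := r) (ct := .skip) (cf := .skip) (T := 0)
    (fun l (_ : Unit) => Function.update s r l) (fun a _ => a) (by simp)
    (fun b l' _ => by simpa using Runs.skip _) l ()
  simp only [← hl, Function.update_eq_self] at this
  exact hl ▸ this

/-- In the state `s`, the input is `x`, the variables have the values `ρ`, and the scratch registers
from `n` on are empty. -/
structure Ready (x : List ℕ) (ρ : ℕ → ℕ) (n : ℕ) (s : State) : Prop where
  inp : s .inp = unary x
  var : ∀ v, s (.var v) = tally (ρ v)
  tmp : ∀ m, n ≤ m → s (.tmp m) = []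

theorem Ready.update_tmp {x : List ℕ} {ρ : ℕ → ℕ} {n : ℕ} {s : State} (h : Ready x ρ n s) {m n' : ℕ}
    (hm : n ≤ n') (hn : m < n') (l : List Bool) :
    Ready x ρ n' (Function.update s (.tmp m) l) :=
  ⟨by simp [h.inp], fun v => by simp [h.var], fun k hk => by
    rw [Function.update_of_ne (by simp; omega)]; exact h.tmp k (by omega)⟩

theorem Ready.update_var {x : List ℕ} {ρ : ℕ → ℕ} {n : ℕ} {s : State} (h : Ready x ρ n s) (v i : ℕ) :
    Ready x (Function.update ρ v i) n (Function.update s (.var v) (tally i)) :=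
  ⟨by simp [h.inp], fun u => by
    by_cases hu : u = v
    · subst hu; simp
    · simp [hu, h.var], fun k hk => by simp [h.tmp k hk]⟩

/-- Functions of the input and the variables that are computed in polynomial time by programs that
put the result into the first scratch register. -/
def Comp (f : List ℕ → (ℕ → ℕ) → ℕ) : Prop :=
  ∃ (c : ℕ → Cmd) (P : Polynomial ℕ), ∀ x ρ N, (unary x).length ≤ N → (∀ v, ρ v ≤ N) →
    f x ρ ≤ P.eval N ∧ ∀ n s, Ready x ρ n s →
      Runs (c n) s (Function.update s (.tmp n) (tally (f x ρ))) (P.eval N)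

theorem Comp.const (k : ℕ) : Comp fun _ _ => k := by
  refine ⟨fun n => (List.range k).foldr (fun _ c => .seq (.push (.tmp n) true) c) .skip,
    Polynomial.C k, fun x ρ N _ _ => ⟨by simp, fun n s hs => ?_⟩⟩
  have key : ∀ (L : List ℕ) (s : State), Runs
      (L.foldr (fun _ c => Cmd.seq (.push (.tmp n) true) c) .skip) s
      (Function.update s (.tmp n) (tally L.length ++ s (.tmp n))) L.length := by
    intro L
    induction L with
    | nil => intro s; simpa using Runs.skip s
    | cons a L ih =>
      intro s
      refine ((Runs.push _ _ _).seq (ih _)).congr ?_ (by simp; omega)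
      funext k
      simp only [Function.update_apply]
      split_ifs <;> simp [List.replicate_succ']
  refine (key _ s).congr ?_ (by simp)
  simp [hs.tmp n le_rfl]

/-- Reading a register destroys it. The contents are moved to scratch space first and then poured
into the variable and the result at once. -/
theorem Comp.var (v : ℕ) : Comp fun _ ρ => ρ v := by
  refine ⟨fun n => .seq (moveReg (.var v) (.tmp (n + 1)))
    (.loop (.tmp (n + 1)) (.seq (.push (.var v) true) (.push (.tmp n) true)) .skip),
    7 * .X + 2, fun x ρ N _ hρ => ⟨by simp; linarith [hρ v], fun n s hs => ?_⟩⟩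
  have h1 := Runs.moveReg (r := .var v) (r' := .tmp (n + 1)) (by simp) s _ (hs.var v)
  have h2 := Runs.loopTally (r := .tmp (n + 1)) (ct := (.seq (.push (.var v) true)
    (.push (.tmp n) true))) (cf := .skip) (T := 2) (fun i => Function.update (Function.update
      (Function.update s (.var v) (tally i)) (.tmp n) (tally i)) (.tmp (n + 1)) (tally (ρ v - i)))
    (ρ v) (by simp) (fun i hi => by
      refine ((Runs.push _ _ _).seq (Runs.push _ _ _)).congr ?_ le_rfl
      clear * - hs
      funext r
      simp only [Function.update_apply]
      split_ifs <;> simp_all [List.replicate_succ])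
  refine (h1.seq' h2 ?_).congr ?_ ?_
  · clear * - hs
    funext r
    simp only [Function.update_apply]
    split_ifs <;> simp_all [hs.tmp]
  · clear * - hs
    funext r
    simp only [Function.update_apply]
    split_ifs <;> simp_all [hs.tmp, hs.var]
  · simp; linarith [hρ v]

/-- The second operand is poured onto the first, which takes time proportional to its value. This is
why `Comp` bounds values as well as running times. -/
theorem Comp.add {f g : List ℕ → (ℕ → ℕ) → ℕ} (hf : Comp f) (hg : Comp g) :
    Comp fun x ρ => f x ρ + g x ρ := by
  obtain ⟨c, P, hc⟩ := hf
  obtain ⟨d, Q, hd⟩ := hg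
  refine ⟨fun n => .seq (.seq (c n) (d (n + 1)))
    (.loop (.tmp (n + 1)) (.push (.tmp n) true) .skip), P + 4 * Q + 1, fun x ρ N hx hρ => ?_⟩
  obtain ⟨hP, hc⟩ := hc x ρ N hx hρ
  obtain ⟨hQ, hd⟩ := hd x ρ N hx hρ
  refine ⟨by simp; omega, fun n s hs => ?_⟩
  have h1 := hc n s hs
  have h2 := hd (n + 1) _ (hs.update_tmp (m := n) (by omega) (by omega) (tally (f x ρ)))
  have h3 := Runs.loopTally (r := .tmp (n + 1)) (ct := .push (.tmp n) true) (cf := .skip) (T := 1)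
    (fun i => Function.update (Function.update s (.tmp n) (tally (f x ρ + i))) (.tmp (n + 1))
      (tally (g x ρ - i))) (g x ρ) (by simp) (fun i hi => by
      refine (Runs.push _ _ _).congr ?_ le_rfl
      clear * - hs
      funext r
      simp only [Function.update_apply]
      split_ifs <;> simp_all [← List.replicate_succ, add_assoc])
  refine ((h1.seq h2).seq' h3 ?_).congr ?_ ?_
  · simp
  · clear * - hs
    funext r
    simp only [Function.update_apply]
    split_ifs <;> simp_all [hs.tmp]
  · simp; linarith

/-- Popping an empty register has no effect, which is what truncated subtraction requires. -/
theorem Comp.sub {f g : List ℕ → (ℕ → ℕ) → ℕ} (hf : Comp f) (hg : Comp g) :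
    Comp fun x ρ => f x ρ - g x ρ := by
  obtain ⟨c, P, hc⟩ := hf
  obtain ⟨d, Q, hd⟩ := hg
  refine ⟨fun n => .seq (.seq (c n) (d (n + 1)))
    (.loop (.tmp (n + 1)) (.case (.tmp n) .skip .skip .skip) .skip), P + 5 * Q + 1,
    fun x ρ N hx hρ => ?_⟩
  obtain ⟨hP, hc⟩ := hc x ρ N hx hρ
  obtain ⟨hQ, hd⟩ := hd x ρ N hx hρ
  refine ⟨by simp; omega, fun n s hs => ?_⟩
  have h1 := hc n s hs
  have h2 := hd (n + 1) _ (hs.update_tmp (m := n) (by omega) (by omega) (tally (f x ρ)))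
  have h3 := Runs.loopTally (r := .tmp (n + 1)) (ct := .case (.tmp n) .skip .skip .skip)
    (cf := .skip) (T := 2)
    (fun i => Function.update (Function.update s (.tmp n) (tally (f x ρ - i))) (.tmp (n + 1))
      (tally (g x ρ - i))) (g x ρ) (by simp) (fun i hi => by
      rcases hk : f x ρ - i with _ | k
      · refine (Runs.caseNil (by simp) (Runs.skip _)).congr ?_ le_rfl
        clear * - hs hk
        funext r
        simp only [Function.update_apply]
        have : f x ρ - (i + 1) = 0 := by omega
        split_ifs <;> simp_all
      · refine (Runs.caseTrue (l := tally k) (by simp [List.replicate_succ])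
          (Runs.skip _)).congr ?_ le_rfl
        clear * - hs hk
        funext r
        simp only [Function.update_apply]
        have : f x ρ - (i + 1) = k := by omega
        split_ifs <;> simp_all)
  refine ((h1.seq h2).seq' h3 ?_).congr ?_ ?_
  · simp
  · clear * - hs
    funext r
    simp only [Function.update_apply]
    split_ifs <;> simp_all [hs.tmp]
  · simp; linarith

/-- Loops consume their counters, so the second factor is computed anew in every round. -/
theorem Comp.mul {f g : List ℕ → (ℕ → ℕ) → ℕ} (hf : Comp f) (hg : Comp g) :
    Comp fun x ρ => f x ρ * g x ρ := by
  obtain ⟨c, P, hc⟩ := hf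
  obtain ⟨d, Q, hd⟩ := hg
  refine ⟨fun n => .seq (c (n + 1)) (.loop (.tmp (n + 1)) (.seq (d (n + 2))
    (.loop (.tmp (n + 2)) (.push (.tmp n) true) .skip)) .skip), P + P * (4 * Q + 3) + 1,
    fun x ρ N hx hρ => ?_⟩
  obtain ⟨hP, hc⟩ := hc x ρ N hx hρ
  obtain ⟨hQ, hd⟩ := hd x ρ N hx hρ
  have hPQ := Nat.mul_le_mul hP hQ
  refine ⟨by simp; nlinarith, fun n s hs => ?_⟩
  have h1 := hc (n + 1) s ⟨hs.inp, hs.var, fun m hm => hs.tmp m (by omega)⟩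
  have h2 := Runs.loopTally (r := .tmp (n + 1)) (ct := .seq (d (n + 2))
    (.loop (.tmp (n + 2)) (.push (.tmp n) true) .skip)) (cf := .skip) (T := 4 * Q.eval N + 1)
    (fun i => Function.update (Function.update s (.tmp n) (tally (i * g x ρ))) (.tmp (n + 1))
      (tally (f x ρ - i))) (f x ρ) (by simp) (fun i hi => by
      have h3 := hd (n + 2) (Function.update (Function.update s (.tmp n) (tally (i * g x ρ)))
        (.tmp (n + 1)) (tally (f x ρ - (i + 1))))
        ((hs.update_tmp (n' := n + 1) (by omega) (by omega) _).update_tmp (by omega) (by omega) _)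
      have h4 := Runs.loopTally (r := .tmp (n + 2)) (ct := .push (.tmp n) true) (cf := .skip)
        (T := 1) (fun j => Function.update (Function.update (Function.update s (.tmp n)
          (tally (i * g x ρ + j))) (.tmp (n + 1)) (tally (f x ρ - (i + 1)))) (.tmp (n + 2))
          (tally (g x ρ - j))) (g x ρ) (by simp) (fun j hj => by
          refine (Runs.push _ _ _).congr ?_ le_rfl
          clear * - hs
          funext r
          simp only [Function.update_apply]
          split_ifs <;> simp_all [← List.replicate_succ, add_assoc])
      rw [Function.update_idem]
      refine (h3.seq' h4 ?_).congr ?_ ?_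
      · simp
      · clear * - hs
        funext r
        simp only [Function.update_apply]
        split_ifs <;> simp_all [hs.tmp, add_mul]
      · linarith)
  refine (h1.seq' h2 ?_).congr ?_ ?_
  · clear * - hs
    funext r
    simp only [Function.update_apply]
    split_ifs <;> simp_all [hs.tmp]
  · clear * - hs
    funext r
    simp only [Function.update_apply]
    split_ifs <;> simp_all [hs.tmp]
  · have := Nat.mul_le_mul_right (4 * Q.eval N + 3) hP
    simp; linarith

end StackProgram

/-! ### Conditionals, bounded sums and bounded iteration -/

namespace StackProgram

open PebbleTree (unary)

theorem Ready.mono {x : List ℕ} {ρ : ℕ → ℕ} {n n' : ℕ} {s : State} (h : Ready x ρ n s)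
    (hn : n ≤ n') : Ready x ρ n' s :=
  ⟨h.inp, h.var, fun m hm => h.tmp m (hn.trans hm)⟩

theorem Comp.ite {f g h : List ℕ → (ℕ → ℕ) → ℕ} (hf : Comp f) (hg : Comp g) (hh : Comp h) :
    Comp fun x ρ => if f x ρ = 0 then h x ρ else g x ρ := by
  obtain ⟨c, P, hc⟩ := hf
  obtain ⟨d, Q, hd⟩ := hg
  obtain ⟨e, R, he⟩ := hh
  refine ⟨fun n => .seq (c n) (.case (.tmp n) (e n) (.seq (clearReg (.tmp n)) (d n)) .skip),
    3 * P + Q + R + 3, fun x ρ N hx hρ => ?_⟩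
  obtain ⟨hP, hc⟩ := hc x ρ N hx hρ
  obtain ⟨hQ, hd⟩ := hd x ρ N hx hρ
  obtain ⟨hR, he⟩ := he x ρ N hx hρ
  refine ⟨by simp; split_ifs <;> omega, fun n s hs => ?_⟩
  have h1 := hc n s hs
  rcases hk : f x ρ with _ | k
  · rw [hk] at h1
    refine (h1.seq (Runs.caseNil (by simp) ((he n s hs).congr rfl le_rfl |> fun h => ?_))).congr
      (T := P.eval N + (R.eval N + 2)) (s' := Function.update s (.tmp n) (tally (h x ρ))) ?_ ?_
    · convert h using 1
      simp [hs.tmp]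
    · simp [hk]
    · simp; omega
  · rw [hk] at h1
    have h2 := Runs.clearReg (.tmp n) (Function.update s (.tmp n) (tally k)) _ (by simp; rfl)
    refine (h1.seq (Runs.caseTrue (l := tally k) (by simp [List.replicate_succ])
      ((Runs.seq' (by simpa using h2) (hd n s hs) ?_)))).congr ?_ ?_
    · simp [hs.tmp]
    · simp [hk]
    · simp; omega

/-- The variable `v` serves as loop index while its old value is parked in scratch space. The index
may exceed `N` but stays below the bound for `f`, so the summand is evaluated with the bound `N +
P.eval N`; this accounts for the composed polynomial. -/
theorem Comp.sum {f g : List ℕ → (ℕ → ℕ) → ℕ} (v : ℕ) (hf : Comp f) (hg : Comp g) :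
    Comp fun x ρ => ∑ i ∈ Finset.range (f x ρ), g x (Function.update ρ v i) := by
  obtain ⟨c, P, hc⟩ := hf
  obtain ⟨d, Q, hd⟩ := hg
  refine ⟨fun n => .seq (.seq (c (n + 1)) (moveReg (.var v) (.tmp (n + 2))))
    (.seq (.loop (.tmp (n + 1)) (.seq (.seq (d (n + 3))
    (.loop (.tmp (n + 3)) (.push (.tmp n) true) .skip)) (.push (.var v) true)) .skip)
    (.seq (clearReg (.var v)) (moveReg (.tmp (n + 2)) (.var v)))),
    P + P * (4 * Q.comp (.X + P) + 4) + 2 * P + 6 * .X + 6,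
    fun x ρ N hx hρ => ?_⟩
  obtain ⟨hP, hc⟩ := hc x ρ N hx hρ
  have hg' : ∀ i < f x ρ, _ := fun i hi => hd x (Function.update ρ v i) (N + P.eval N) (by omega)
    (fun w => by
      by_cases hw : w = v
      · subst hw; simp; omega
      · simp [hw]; linarith [hρ w])
  constructor
  · have h1 : ∑ i ∈ Finset.range (f x ρ), g x (Function.update ρ v i) ≤
        ∑ i ∈ Finset.range (f x ρ), Q.eval (N + P.eval N) :=
      Finset.sum_le_sum fun i hi => (hg' i (Finset.mem_range.1 hi)).1
    simp at h1 ⊢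
    have := Nat.mul_le_mul_right (Q.eval (N + P.eval N)) hP
    nlinarith
  intro n s hs
  have h1 := hc (n + 1) s (hs.mono (by omega))
  have h2 := Runs.moveReg (r := .var v) (r' := .tmp (n + 2)) (by simp)
    (Function.update s (.tmp (n + 1)) (tally (f x ρ))) _ (by simp [hs.var v]; rfl)
  have h3 := Runs.loopTally (r := .tmp (n + 1)) (ct := .seq (.seq (d (n + 3))
    (.loop (.tmp (n + 3)) (.push (.tmp n) true) .skip)) (.push (.var v) true)) (cf := .skip)
    (T := 4 * Q.eval (N + P.eval N) + 2)
    (fun i => Function.update (Function.update (Function.update (Function.update s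
      (.tmp (n + 2)) (tally (ρ v))) (.var v) (tally i))
      (.tmp n) (tally (∑ j ∈ Finset.range i, g x (Function.update ρ v j)))) (.tmp (n + 1))
      (tally (f x ρ - i))) (f x ρ) (by simp) (fun i hi => by
      obtain ⟨hgi, hdi⟩ := hg' i hi
      have h3 := hdi (n + 3) (Function.update (Function.update (Function.update (Function.update s
        (.tmp (n + 2)) (tally (ρ v))) (.var v) (tally i))
        (.tmp n) (tally (∑ j ∈ Finset.range i, g x (Function.update ρ v j)))) (.tmp (n + 1))
        (tally (f x ρ - (i + 1))))
        (((((hs.update_tmp (n' := n + 3) (by omega) (by omega) _).update_var v i).update_tmp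
          (by omega) (by omega) _).update_tmp le_rfl (by omega) _))
      have h4 := Runs.loopTally (r := .tmp (n + 3)) (ct := .push (.tmp n) true) (cf := .skip)
        (T := 1) (fun j => Function.update (Function.update (Function.update (Function.update
          (Function.update s (.tmp (n + 2)) (tally (ρ v))) (.var v) (tally i))
          (.tmp n) (tally ((∑ j ∈ Finset.range i, g x (Function.update ρ v j)) + j)))
          (.tmp (n + 1)) (tally (f x ρ - (i + 1)))) (.tmp (n + 3))
          (tally (g x (Function.update ρ v i) - j))) (g x (Function.update ρ v i)) (by simp)
          (fun j hj => by
          refine (Runs.push _ _ _).congr ?_ le_rfl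
          clear * - hs
          funext r
          simp only [Function.update_apply]
          split_ifs <;> simp_all [← List.replicate_succ, add_assoc])
      rw [Function.update_idem]
      refine ((h3.seq' h4 ?_).seq (Runs.push _ _ _)).congr ?_ ?_
      · simp
      · clear * - hs
        funext r
        simp only [Function.update_apply]
        split_ifs <;> simp_all [hs.tmp, Finset.sum_range_succ, List.replicate_succ]
      · linarith)
  have h4 := Runs.clearReg (.var v) (Function.update (Function.update (Function.update s
      (.tmp (n + 2)) (tally (ρ v))) (.var v) (tally (f x ρ)))
      (.tmp n) (tally (∑ j ∈ Finset.range (f x ρ), g x (Function.update ρ v j)))) _ (by simp; rfl)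
  have h5 := Runs.moveReg (r := .tmp (n + 2)) (r' := .var v) (by simp) (Function.update
      (Function.update (Function.update s
      (.tmp (n + 2)) (tally (ρ v))) (.var v) [])
      (.tmp n) (tally (∑ j ∈ Finset.range (f x ρ), g x (Function.update ρ v j)))) _ (by simp; rfl)
  refine ((h1.seq h2).seq' (h3.seq' (h4.seq' h5 ?_) ?_) ?_).congr ?_ ?_
  · clear * - hs
    funext r
    simp only [Function.update_apply]
    split_ifs <;> simp_all
  · clear * - hs
    funext r
    simp only [Function.update_apply]
    split_ifs <;> simp_all [hs.tmp]
  · clear * - hs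
    funext r
    simp only [Function.update_apply]
    split_ifs <;> simp_all [hs.tmp]
  · clear * - hs
    funext r
    simp only [Function.update_apply]
    split_ifs <;> simp_all [hs.tmp, hs.var]
  · have := Nat.mul_le_mul_right (4 * Q.eval (N + P.eval N) + 4) hP
    simp; linarith [hρ v]

/-- Iteration; the values are bounded by the length of the input. -/
theorem Comp.iter {f g h : List ℕ → (ℕ → ℕ) → ℕ} (w : ℕ) (hf : Comp f) (hg : Comp g) (hh : Comp h)
    (hle : ∀ x ρ, h x ρ ≤ x.length) :
    Comp fun x ρ => (fun a => h x (Function.update ρ w a))^[f x ρ] (g x ρ) := by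
  obtain ⟨c, P, hc⟩ := hf
  obtain ⟨d, Q, hd⟩ := hg
  obtain ⟨e, R, he⟩ := hh
  refine ⟨fun n => .seq (.seq (c n) (d (n + 1))) (.seq (.seq (moveReg (.var w) (.tmp (n + 2)))
    (moveReg (.tmp (n + 1)) (.var w)))
    (.seq (.loop (.tmp n) (.seq (e (n + 3)) (.seq (clearReg (.var w))
      (moveReg (.tmp (n + 3)) (.var w)))) .skip)
    (.seq (moveReg (.var w) (.tmp n)) (moveReg (.tmp (n + 2)) (.var w))))),
    P + 7 * Q + 10 * .X + 5 + P * (R.comp (.X + Q) + 2 * (.X + Q) + 3 * .X + 4),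
    fun x ρ N hx hρ => ?_⟩
  obtain ⟨hP, hc⟩ := hc x ρ N hx hρ
  obtain ⟨hQ, hd⟩ := hd x ρ N hx hρ
  have hxl : x.length ≤ N := by
    refine le_trans ?_ hx
    clear hx hc hd hP hQ
    induction x with
    | nil => simp
    | cons a x ih => simp [unary, List.flatMap_cons] at ih ⊢; omega
  set F := fun a => h x (Function.update ρ w a) with hF
  -- Only the start value can exceed `N`; all later iterates are values of `h` and hence at most the
  -- length of the input. Without such a uniform bound, iterating a polynomial could lead to
  -- exponential growth.
  have hval : ∀ i, F^[i] (g x ρ) ≤ N + Q.eval N := by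
    intro i
    cases i with
    | zero => simp; omega
    | succ i =>
      rw [Function.iterate_succ_apply']
      exact (hle _ _).trans (by omega)
  have hval' : ∀ i, F^[i + 1] (g x ρ) ≤ N := by
    intro i
    rw [Function.iterate_succ_apply']
    exact (hle _ _).trans hxl
  have he' : ∀ i, _ := fun i => he x (Function.update ρ w (F^[i] (g x ρ))) (N + Q.eval N) (by omega)
    (fun u => by
      by_cases hu : u = w
      · subst hu; simpa using hval i
      · simp [hu]; linarith [hρ u])
  refine ⟨(hval _).trans (by simp; nlinarith), fun n s hs => ?_⟩
  have h1 := hc n s hs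
  have h2 := hd (n + 1) _ (hs.update_tmp (m := n) (by omega) (by omega) (tally (f x ρ)))
  have h3 := Runs.moveReg (r := .var w) (r' := .tmp (n + 2)) (by simp)
    (Function.update (Function.update s (.tmp n) (tally (f x ρ))) (.tmp (n + 1)) (tally (g x ρ)))
    _ (by simp [hs.var w]; rfl)
  have h4 := Runs.moveReg (r := .tmp (n + 1)) (r' := .var w) (by simp)
    (Function.update (Function.update (Function.update (Function.update s (.tmp n) (tally (f x ρ)))
      (.tmp (n + 1)) (tally (g x ρ))) (.var w) []) (.tmp (n + 2)) (tally (ρ w)))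
    _ (by simp; rfl)
  have h5 := Runs.loopTally (r := .tmp n) (ct := .seq (e (n + 3)) (.seq (clearReg (.var w))
      (moveReg (.tmp (n + 3)) (.var w)))) (cf := .skip)
    (T := R.eval (N + Q.eval N) + 2 * (N + Q.eval N) + 3 * N + 2)
    (fun i => Function.update (Function.update (Function.update s (.tmp (n + 2)) (tally (ρ w)))
      (.var w) (tally (F^[i] (g x ρ)))) (.tmp n) (tally (f x ρ - i))) (f x ρ) (by simp)
      (fun i hi => by
      have h6 := (he' i).2 (n + 3) (Function.update (Function.update (Function.update s
        (.tmp (n + 2)) (tally (ρ w)))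
        (.var w) (tally (F^[i] (g x ρ)))) (.tmp n) (tally (f x ρ - (i + 1))))
        (((hs.update_tmp (n' := n + 3) (by omega) (by omega) _).update_var w _).update_tmp
          le_rfl (by omega) _)
      have h7 := Runs.clearReg (.var w) (Function.update (Function.update (Function.update
        (Function.update s (.tmp (n + 2)) (tally (ρ w)))
        (.var w) (tally (F^[i] (g x ρ)))) (.tmp n) (tally (f x ρ - (i + 1)))) (.tmp (n + 3))
        (tally (F^[i + 1] (g x ρ)))) _ (by simp; rfl)
      have h8 := Runs.moveReg (r := .tmp (n + 3)) (r' := .var w) (by simp)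
        (Function.update (Function.update (Function.update
        (Function.update s (.tmp (n + 2)) (tally (ρ w)))
        (.var w) []) (.tmp n) (tally (f x ρ - (i + 1)))) (.tmp (n + 3))
        (tally (F^[i + 1] (g x ρ)))) _ (by simp; rfl)
      rw [Function.update_idem]
      refine (h6.seq' (h7.seq' h8 ?_) ?_).congr ?_ ?_
      · clear * - hs
        funext r
        simp only [Function.update_apply]
        split_ifs <;> simp_all
      · rw [Function.iterate_succ_apply']
      · clear * - hs
        funext r
        simp only [Function.update_apply]
        split_ifs <;> simp_all [hs.tmp]
      · have := hval i
        have : F^[i] (F (g x ρ)) ≤ N := hval' i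
        simp only [List.length_replicate]; linarith)
  have h6 := Runs.moveReg (r := .var w) (r' := .tmp n) (by simp)
    (Function.update (Function.update s (.tmp (n + 2)) (tally (ρ w)))
      (.var w) (tally (F^[f x ρ] (g x ρ)))) _ (by simp; rfl)
  have h7 := Runs.moveReg (r := .tmp (n + 2)) (r' := .var w) (by simp)
    (Function.update (Function.update (Function.update s (.tmp (n + 2)) (tally (ρ w)))
      (.var w) []) (.tmp n) (tally (F^[f x ρ] (g x ρ)))) _ (by simp; rfl)
  refine ((h1.seq h2).seq' ((h3.seq' h4 ?_).seq' (h5.seq' (h6.seq' h7 ?_) ?_) ?_) ?_).congr ?_ ?_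
  · clear * - hs
    funext r
    simp only [Function.update_apply]
    split_ifs <;> simp_all [hs.tmp]
  · clear * - hs
    funext r
    simp only [Function.update_apply]
    split_ifs <;> simp_all [hs.tmp]
  · clear * - hs
    funext r
    simp only [Function.update_apply]
    split_ifs <;> simp_all [hs.tmp]
  · clear * - hs
    funext r
    simp only [Function.update_apply]
    split_ifs <;> simp_all [hs.tmp]
  · clear * - hs
    funext r
    simp only [Function.update_apply]
  · clear * - hs
    funext r
    simp only [Function.update_apply]
    split_ifs <;> simp_all [hs.tmp, hs.var, F]
  · have := Nat.mul_le_mul_right (R.eval (N + Q.eval N) + 2 * (N + Q.eval N) + 3 * N + 4) hP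
    have := hval (f x ρ)
    simp; linarith [hρ w]

end StackProgram

/-! ### Reading the input, and polynomial-time functions on lists -/

namespace StackProgram

open PebbleTree (unary)

theorem unary_nil : unary [] = [] := rfl

theorem unary_cons (a : ℕ) (x : List ℕ) : unary (a :: x) = tally a ++ false :: unary x := by
  simp [unary]

theorem unary_append (x y : List ℕ) : unary (x ++ y) = unary x ++ unary y := by
  simp [unary]

theorem length_le_length_unary (x : List ℕ) : x.length ≤ (unary x).length := by
  induction x with
  | nil => simp
  | cons a x ih => rw [unary_cons]; simp; omega

theorem getD_le_length_unary (x : List ℕ) (i : ℕ) : x.getD i 0 ≤ (unary x).length := by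
  induction x generalizing i with
  | nil => simp
  | cons a x ih =>
    rw [unary_cons]
    cases i with
    | zero => simp
    | succ i => have := ih i; simp at this ⊢; omega

theorem tally_append_cons (m : ℕ) (A : List Bool) :
    tally m ++ true :: A = true :: (tally m ++ A) := by
  rw [← List.singleton_append, ← List.append_assoc]
  exact congrArg (· ++ A) List.replicate_succ'.symm

/-- The entries are counted by their terminating `false` bits. The bits that have been read are kept
in reverse order in a scratch register, and moving them back restores the input. -/
theorem Comp.length : Comp fun x _ => x.length := by
  refine ⟨fun n => .seq (.loop .inp (.push (.tmp (n + 1)) true)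
    (.seq (.push (.tmp (n + 1)) false) (.push (.tmp n) true))) (moveReg (.tmp (n + 1)) .inp),
    7 * .X + 2, fun x ρ N hx hρ => ⟨?_, fun n s hs => ?_⟩⟩
  · have := length_le_length_unary x
    simp; omega
  have h1 := Runs.loopFold (σ := List Bool × List Bool) (r := .inp)
    (ct := .push (.tmp (n + 1)) true)
    (cf := .seq (.push (.tmp (n + 1)) false) (.push (.tmp n) true)) (T := 2)
    (fun l a => Function.update (Function.update (Function.update s .inp l) (.tmp n) a.1)
      (.tmp (n + 1)) a.2)
    (fun a b => (if b then a.1 else true :: a.1, b :: a.2)) (by simp) (fun b l a => by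
      cases b
      · refine ((Runs.push _ _ _).seq (Runs.push _ _ _)).congr ?_ le_rfl
        clear * -
        funext r
        simp only [Function.update_apply]
        split_ifs <;> simp_all
      · refine (Runs.push _ _ _).congr ?_ (by omega)
        clear * -
        funext r
        simp only [Function.update_apply]
        split_ifs <;> simp_all) (unary x) ([], [])
  have key : ∀ (x : List ℕ) (a : List Bool × List Bool),
      (unary x).foldl (fun a b => (if b then a.1 else true :: a.1, b :: a.2)) a =
        (tally x.length ++ a.1, (unary x).reverse ++ a.2) := by
    intro x
    induction x with
    | nil => simp [unary_nil]
    | cons m x ih =>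
      intro a
      have : ∀ (m : ℕ) (a : List Bool × List Bool),
          (tally m).foldl (fun a b => (if b then a.1 else true :: a.1, b :: a.2)) a =
            (a.1, tally m ++ a.2) := by
        intro m
        induction m with
        | zero => simp
        | succ m ih => intro a; simp [List.replicate_succ, ih, tally_append_cons]
      rw [unary_cons, List.foldl_append, this, List.foldl_cons, ih]
      simp [List.replicate_succ']
  rw [key] at h1
  have h2 := Runs.moveReg (r := .tmp (n + 1)) (r' := .inp) (by simp) (Function.update
    (Function.update (Function.update s .inp []) (.tmp n) (tally x.length))
      (.tmp (n + 1)) (unary x).reverse) _ (by simp; rfl)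
  have h0 : Function.update (Function.update (Function.update s .inp (unary x)) (.tmp n) [])
      (.tmp (n + 1)) [] = s := by
    clear * - hs
    funext r
    simp only [Function.update_apply]
    split_ifs <;> simp_all [hs.tmp, hs.inp]
  rw [h0] at h1
  refine (h1.seq' h2 ?_).congr ?_ ?_
  · simp
  · clear * - hs
    funext r
    simp only [Function.update_apply]
    split_ifs <;> simp_all [hs.tmp, hs.inp]
  · simp; omega

/-- The effect of one bit of the input on the scratch registers in the program for `Comp.get`:
a counter, the part of the input that has been read, and the result. -/
def getStep (a : List Bool × List Bool × List Bool) (b : Bool) :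
    List Bool × List Bool × List Bool :=
  if b then (a.1, true :: a.2.1, if a.1 = [] then true :: a.2.2 else a.2.2)
  else (match a.1 with | [] => [false] | true :: l => l | false :: l => false :: l,
    false :: a.2.1, a.2.2)

theorem foldl_getStep_false (l A R B : List Bool) :
    B.foldl getStep (false :: l, A, R) = (false :: l, B.reverse ++ A, R) := by
  induction B generalizing A with
  | nil => rfl
  | cons b B ih => cases b <;> simp [getStep, ih]

theorem foldl_getStep_true (l A R : List Bool) (m : ℕ) :
    (tally m).foldl getStep (true :: l, A, R) = (true :: l, tally m ++ A, R) := by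
  induction m generalizing A with
  | zero => rfl
  | succ m ih => simp [List.replicate_succ, ih, getStep, tally_append_cons]

theorem foldl_getStep_nil (A R : List Bool) (m : ℕ) :
    (tally m).foldl getStep ([], A, R) = ([], tally m ++ A, tally m ++ R) := by
  induction m generalizing A R with
  | zero => rfl
  | succ m ih => simp [List.replicate_succ, ih, getStep, tally_append_cons]

/-- The counter is the number of entries still to be skipped. When it is empty, the bits of the
current entry are copied; the end of that entry puts a `false` on it, after which it is never empty
again and nothing more is copied. The bound on its final length pays for clearing it. -/
theorem foldl_getStep (x : List ℕ) (i : ℕ) (A : List Bool) :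
    ∃ l, l.length ≤ i + 1 ∧ (unary x).foldl getStep (tally i, A, []) =
      (l, (unary x).reverse ++ A, tally (x.getD i 0)) := by
  induction x generalizing i A with
  | nil => exact ⟨tally i, by simp, by simp [unary_nil]⟩
  | cons m x ih =>
    rw [unary_cons, List.foldl_append, List.foldl_cons]
    cases i with
    | zero =>
      refine ⟨[false], by simp, ?_⟩
      rw [tally, List.replicate_zero, foldl_getStep_nil]
      simp [getStep, foldl_getStep_false]
    | succ i =>
      obtain ⟨l, hl, h⟩ := ih i (false :: (tally m ++ A))
      refine ⟨l, by omega, ?_⟩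
      rw [tally, List.replicate_succ, foldl_getStep_true]
      simp [getStep, h]

theorem Comp.get {f : List ℕ → (ℕ → ℕ) → ℕ} (hf : Comp f) : Comp fun x ρ => x.getD (f x ρ) 0 := by
  obtain ⟨c, P, hc⟩ := hf
  refine ⟨fun n => .seq (c n) (.seq (.loop .inp
    (.seq (.push (.tmp (n + 1)) true)
      (.case (.tmp n) (.push (.tmp (n + 2)) true) (.push (.tmp n) true) (.push (.tmp n) false)))
    (.seq (.push (.tmp (n + 1)) false)
      (.case (.tmp n) (.push (.tmp n) false) .skip (.push (.tmp n) false))))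
    (.seq (moveReg (.tmp (n + 1)) .inp) (.seq (clearReg (.tmp n))
      (moveReg (.tmp (n + 2)) (.tmp n))))),
    3 * P + 12 * .X + 6, fun x ρ N hx hρ => ?_⟩
  obtain ⟨hP, hc⟩ := hc x ρ N hx hρ
  have hget := getD_le_length_unary x (f x ρ)
  refine ⟨by simp at hget ⊢; omega, fun n s hs => ?_⟩
  have h1 := hc n s hs
  have h2 := Runs.loopFold (σ := List Bool × List Bool × List Bool) (r := .inp)
    (ct := .seq (.push (.tmp (n + 1)) true)
      (.case (.tmp n) (.push (.tmp (n + 2)) true) (.push (.tmp n) true) (.push (.tmp n) false)))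
    (cf := .seq (.push (.tmp (n + 1)) false)
      (.case (.tmp n) (.push (.tmp n) false) .skip (.push (.tmp n) false))) (T := 4)
    (fun l a => Function.update (Function.update (Function.update (Function.update s .inp l)
      (.tmp n) a.1) (.tmp (n + 1)) a.2.1) (.tmp (n + 2)) a.2.2) getStep (by simp)
    (fun b l a => by
      clear * -
      obtain ⟨cnt, A, R⟩ := a
      cases b
      · rcases cnt with _ | ⟨_ | _, cnt⟩
        · refine ((Runs.push _ _ _).seq (Runs.caseNil ?_ (Runs.push _ _ _))).congr ?_ le_rfl
          · simp
          · funext r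
            simp only [Function.update_apply, getStep]
            split_ifs <;> first | rfl | simp_all
        · refine ((Runs.push _ _ _).seq (Runs.caseFalse (l := cnt) ?_
            (Runs.push _ _ _))).congr ?_ le_rfl
          · simp
          · funext r
            simp only [Function.update_apply, getStep]
            split_ifs <;> first | rfl | simp_all
        · refine ((Runs.push _ _ _).seq (Runs.caseTrue (l := cnt) ?_
            (Runs.skip _))).congr ?_ (by omega)
          · simp
          · funext r
            simp only [Function.update_apply, getStep]
            split_ifs <;> first | rfl | simp_all
      · rcases cnt with _ | ⟨_ | _, cnt⟩
        · refine ((Runs.push _ _ _).seq (Runs.caseNil ?_ (Runs.push _ _ _))).congr ?_ le_rfl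
          · simp
          · funext r
            simp only [Function.update_apply, getStep, ↓reduceIte, Reg.tmp.injEq, add_right_inj,
              OfNat.one_ne_ofNat]
            split_ifs <;> first | rfl | simp_all
        · refine ((Runs.push _ _ _).seq (Runs.caseFalse (l := cnt) ?_
            (Runs.push _ _ _))).congr ?_ le_rfl
          · simp
          · funext r
            simp only [Function.update_apply, getStep]
            split_ifs <;> first | rfl | simp_all
        · refine ((Runs.push _ _ _).seq (Runs.caseTrue (l := cnt) ?_
            (Runs.push _ _ _))).congr ?_ le_rfl
          · simp
          · funext r
            simp only [Function.update_apply, getStep]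
            split_ifs <;> first | rfl | simp_all) (unary x) (tally (f x ρ), [], [])
  obtain ⟨l, hl, hfold⟩ := foldl_getStep x (f x ρ) []
  rw [hfold] at h2
  have h3 := Runs.moveReg (r := .tmp (n + 1)) (r' := .inp) (by simp)
    (Function.update (Function.update (Function.update (Function.update s .inp [])
      (.tmp n) l) (.tmp (n + 1)) (unary x).reverse) (.tmp (n + 2)) (tally (x.getD (f x ρ) 0)))
      _ (by simp; rfl)
  have h4 := Runs.clearReg (.tmp n)
    (Function.update (Function.update s (.tmp n) l) (.tmp (n + 2)) (tally (x.getD (f x ρ) 0)))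
      _ (by simp; rfl)
  have h5 := Runs.moveReg (r := .tmp (n + 2)) (r' := .tmp n) (by simp)
    (Function.update s (.tmp (n + 2)) (tally (x.getD (f x ρ) 0)))
      _ (by simp; rfl)
  refine (h1.seq' (h2.seq' (h3.seq' (h4.seq' h5 ?_) ?_) ?_) ?_).congr ?_ ?_
  · clear * - hs
    funext r
    simp only [Function.update_apply]
    split_ifs <;> simp_all [hs.tmp]
  · clear * - hs
    funext r
    simp only [Function.update_apply]
    split_ifs <;> simp_all [hs.tmp, hs.inp]
  · simp
  · clear * - hs
    funext r
    simp only [Function.update_apply]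
    split_ifs <;> simp_all [hs.tmp, hs.inp]
  · clear * - hs
    funext r
    simp only [Function.update_apply]
    split_ifs <;> simp_all [hs.tmp]
  · simp at hget ⊢; omega

/-! ### Programs that emit lists of numbers -/

/-- Functions from the input and the variables to lists of numbers that are computed in polynomial
time by programs that write the result to a register. -/
def Emits (f : List ℕ → (ℕ → ℕ) → List ℕ) : Prop :=
  ∃ (c : Reg → ℕ → Cmd) (P : Polynomial ℕ), ∀ x ρ N, (unary x).length ≤ N → (∀ v, ρ v ≤ N) →
    (unary (f x ρ)).length ≤ P.eval N ∧ ∀ o, o = .acc ∨ o = .rev → ∀ n s, Ready x ρ n s →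
      Runs (c o n) s (Function.update s o ((unary (f x ρ)).reverse ++ s o)) (P.eval N)

theorem Ready.update_out {x : List ℕ} {ρ : ℕ → ℕ} {n : ℕ} {s : State} (h : Ready x ρ n s) {o : Reg}
    (ho : o = .acc ∨ o = .rev) (l : List Bool) : Ready x ρ n (Function.update s o l) := by
  rcases ho with rfl | rfl <;>
  exact ⟨by simp [h.inp], fun v => by simp [h.var], fun k hk => by simp [h.tmp k hk]⟩

theorem Emits.nil : Emits fun _ _ => [] :=
  ⟨fun _ _ => .skip, 0, fun x ρ N _ _ => ⟨by simp [unary_nil], fun o _ n s _ => by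
    simpa [unary_nil] using Runs.skip s⟩⟩

theorem Emits.append {f g : List ℕ → (ℕ → ℕ) → List ℕ} (hf : Emits f) (hg : Emits g) :
    Emits fun x ρ => f x ρ ++ g x ρ := by
  obtain ⟨c, P, hc⟩ := hf
  obtain ⟨d, Q, hd⟩ := hg
  refine ⟨fun o n => .seq (c o n) (d o n), P + Q, fun x ρ N hx hρ => ?_⟩
  obtain ⟨hP, hc⟩ := hc x ρ N hx hρ
  obtain ⟨hQ, hd⟩ := hd x ρ N hx hρ
  refine ⟨by simp [unary_append]; omega, fun o ho n s hs => ?_⟩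
  refine ((hc o ho n s hs).seq (hd o ho n _ (hs.update_out ho _))).congr ?_ (by simp)
  simp [unary_append]

theorem Emits.val {f : List ℕ → (ℕ → ℕ) → ℕ} (hf : Comp f) : Emits fun x ρ => [f x ρ] := by
  obtain ⟨c, P, hc⟩ := hf
  refine ⟨fun o n => .seq (c n) (.seq (.loop (.tmp n) (.push o true) .skip) (.push o false)),
    4 * P + 2, fun x ρ N hx hρ => ?_⟩
  obtain ⟨hP, hc⟩ := hc x ρ N hx hρ
  refine ⟨by simp [unary_cons, unary_nil]; omega, fun o ho n s hs => ?_⟩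
  have hne : o ≠ .tmp n := by rcases ho with rfl | rfl <;> simp
  have h2 := Runs.loopTally (r := .tmp n) (ct := .push o true) (cf := .skip) (T := 1)
    (fun i => Function.update (Function.update s (.tmp n) (tally (f x ρ - i))) o
      (tally i ++ s o)) (f x ρ) (by simp [hne.symm]) (fun i hi => by
        refine (Runs.push _ _ _).congr ?_ le_rfl
        clear * - hne
        funext r
        simp only [Function.update_apply]
        split_ifs <;> simp_all [List.replicate_succ])
  refine ((hc n s hs).seq' (h2.seq (Runs.push _ _ _)) ?_).congr ?_ ?_
  · clear * - hne
    funext r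
    simp only [Function.update_apply]
    split_ifs <;> simp_all
  · clear * - hs hne
    funext r
    simp only [Function.update_apply]
    split_ifs <;> simp_all [hs.tmp, unary_cons, unary_nil]
  · simp; omega

theorem Emits.ite {f : List ℕ → (ℕ → ℕ) → ℕ} {g h : List ℕ → (ℕ → ℕ) → List ℕ} (hf : Comp f)
    (hg : Emits g) (hh : Emits h) : Emits fun x ρ => if f x ρ = 0 then h x ρ else g x ρ := by
  obtain ⟨c, P, hc⟩ := hf
  obtain ⟨d, Q, hd⟩ := hg
  obtain ⟨e, R, he⟩ := hh
  refine ⟨fun o n => .seq (c n) (.case (.tmp n) (e o n) (.seq (clearReg (.tmp n)) (d o n)) .skip),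
    3 * P + Q + R + 3, fun x ρ N hx hρ => ?_⟩
  obtain ⟨hP, hc⟩ := hc x ρ N hx hρ
  obtain ⟨hQ, hd⟩ := hd x ρ N hx hρ
  obtain ⟨hR, he⟩ := he x ρ N hx hρ
  refine ⟨by simp; split_ifs <;> omega, fun o ho n s hs => ?_⟩
  have h1 := hc n s hs
  rcases hk : f x ρ with _ | k
  · rw [hk] at h1
    have h2 : Function.update s (.tmp n) (tally 0) = s := by simp [← hs.tmp n le_rfl]
    rw [h2] at h1
    refine (h1.seq (Runs.caseNil (hs.tmp n le_rfl) (he o ho n s hs))).congr ?_ ?_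
    · simp [hk]
    · simp; omega
  · rw [hk] at h1
    have h2 := Runs.clearReg (.tmp n) (Function.update s (.tmp n) (tally k)) _ (by simp; rfl)
    refine (h1.seq (Runs.caseTrue (l := tally k) (by simp [List.replicate_succ])
      ((Runs.seq' (by simpa using h2) (hd o ho n s hs) ?_)))).congr ?_ ?_
    · simp [← hs.tmp n le_rfl]
    · simp [hk]
    · simp; omega

/-- As for sums, `v` is the loop index and is restored afterwards; the output of the rounds
accumulates on the output register without further bookkeeping. -/
theorem Emits.forRange {f : List ℕ → (ℕ → ℕ) → ℕ} {g : List ℕ → (ℕ → ℕ) → List ℕ} (v : ℕ)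
    (hf : Comp f) (hg : Emits g) :
    Emits fun x ρ => (List.range (f x ρ)).flatMap fun i => g x (Function.update ρ v i) := by
  obtain ⟨c, P, hc⟩ := hf
  obtain ⟨d, Q, hd⟩ := hg
  refine ⟨fun o n => .seq (.seq (c n) (moveReg (.var v) (.tmp (n + 1))))
    (.seq (.loop (.tmp n) (.seq (d o (n + 2)) (.push (.var v) true)) .skip)
    (.seq (clearReg (.var v)) (moveReg (.tmp (n + 1)) (.var v)))),
    P + P * (Q.comp (.X + P) + 3) + 2 * P + 6 * .X + 6, fun x ρ N hx hρ => ?_⟩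
  obtain ⟨hP, hc⟩ := hc x ρ N hx hρ
  have hg' : ∀ i < f x ρ, _ := fun i hi => hd x (Function.update ρ v i) (N + P.eval N) (by omega)
    (fun w => by
      by_cases hw : w = v
      · subst hw; simp; omega
      · simp [hw]; linarith [hρ w])
  set L : ℕ → List Bool := fun k =>
    unary ((List.range k).flatMap fun i => g x (Function.update ρ v i)) with hL
  have hLs : ∀ i, L (i + 1) = L i ++ unary (g x (Function.update ρ v i)) := by
    intro i
    simp [hL, List.range_succ, unary_append]
  have hLlen : ∀ k ≤ f x ρ, (L k).length ≤ k * Q.eval (N + P.eval N) := by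
    intro k
    induction k with
    | zero => intro _; simp [hL, unary_nil]
    | succ k ih =>
      intro hk
      have := (hg' k hk).1
      rw [hLs, List.length_append]
      linarith [ih (by omega)]
  constructor
  · have h1 := hLlen _ le_rfl
    have := Nat.mul_le_mul_right (Q.eval (N + P.eval N)) hP
    simp [hL] at h1 ⊢
    nlinarith
  intro o ho n s hs
  have hne : o ≠ .var v ∧ ∀ m, o ≠ .tmp m := by rcases ho with rfl | rfl <;> simp
  have h1 := hc n s hs
  have h2 := Runs.moveReg (r := .var v) (r' := .tmp (n + 1)) (by simp)
    (Function.update s (.tmp n) (tally (f x ρ))) _ (by simp [hs.var v]; rfl)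
  have h3 := Runs.loopTally (r := .tmp n) (ct := .seq (d o (n + 2)) (.push (.var v) true))
    (cf := .skip) (T := Q.eval (N + P.eval N) + 1)
    (fun i => Function.update (Function.update (Function.update (Function.update s
      (.tmp (n + 1)) (tally (ρ v))) (.var v) (tally i))
      o ((L i).reverse ++ s o)) (.tmp n) (tally (f x ρ - i))) (f x ρ) (by simp) (fun i hi => by
      have h3 := (hg' i hi).2 o ho (n + 2) (Function.update (Function.update (Function.update
        (Function.update s (.tmp (n + 1)) (tally (ρ v))) (.var v) (tally i))
        o ((L i).reverse ++ s o)) (.tmp n) (tally (f x ρ - (i + 1))))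
        (((((hs.update_tmp (n' := n + 2) (by omega) (by omega) _).update_var v i).update_out
          ho _).update_tmp le_rfl (by omega) _))
      rw [Function.update_idem]
      refine (h3.seq (Runs.push _ _ _)).congr ?_ le_rfl
      rw [hLs]
      clear * - hs hne
      funext r
      simp only [Function.update_apply]
      split_ifs <;> simp_all [List.replicate_succ])
  have h4 := Runs.clearReg (.var v) (Function.update (Function.update (Function.update s
      (.tmp (n + 1)) (tally (ρ v))) (.var v) (tally (f x ρ)))
      o ((L (f x ρ)).reverse ++ s o)) _ (by simp [hne.1.symm]; rfl)
  have h5 := Runs.moveReg (r := .tmp (n + 1)) (r' := .var v) (by simp) (Function.update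
      (Function.update (Function.update s
      (.tmp (n + 1)) (tally (ρ v))) (.var v) [])
      o ((L (f x ρ)).reverse ++ s o)) _ (by simp [(hne.2 _).symm]; rfl)
  refine ((h1.seq h2).seq' (h3.seq' (h4.seq' h5 ?_) ?_) ?_).congr ?_ ?_
  · clear * - hs hne
    funext r
    simp only [Function.update_apply]
    split_ifs <;> simp_all
  · clear * - hs hne
    funext r
    simp only [Function.update_apply]
    split_ifs <;> simp_all [hs.tmp]
  · have : L 0 = [] := rfl
    rw [this]
    clear * - hs hne
    funext r
    simp only [Function.update_apply]
    split_ifs <;> simp_all [hs.tmp]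
  · clear * - hs hne
    funext r
    simp only [Function.update_apply]
    split_ifs <;> simp_all [hs.tmp, hs.var, L]
  · have := Nat.mul_le_mul_right (Q.eval (N + P.eval N) + 3) hP
    simp; linarith [hρ v]

/-! ### Functions on lists of numbers -/

/-- The state with given input and accumulator in which all other registers are empty. -/
def ioState (i a : List Bool) : State :=
  Function.update (Function.update (fun _ => []) .inp i) .acc a

theorem ready_ioState (x : List ℕ) (a : List Bool) :
    Ready x (fun _ => 0) 0 (ioState (unary x) a) :=
  ⟨by simp [ioState], fun v => by simp [ioState], fun m _ => by simp [ioState]⟩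

/-- Functions on lists of numbers that are computed in polynomial time by programs that read the
input and append the result to the accumulator. -/
def ListComp (F : List ℕ → List ℕ) : Prop :=
  ∃ (c : Cmd) (P : Polynomial ℕ), ∀ x a N, (unary x).length ≤ N →
    (unary (F x)).length ≤ P.eval N ∧
      Runs c (ioState (unary x) a) (ioState [] ((unary (F x)).reverse ++ a)) (P.eval N)

theorem Emits.listComp {f : List ℕ → (ℕ → ℕ) → List ℕ} (hf : Emits f) :
    ListComp fun x => f x fun _ => 0 := by
  obtain ⟨c, P, hc⟩ := hf
  refine ⟨.seq (c .acc 0) (clearReg .inp), P + 2 * .X + 1, fun x a N hx => ?_⟩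
  obtain ⟨hP, hc⟩ := hc x (fun _ => 0) N hx (fun _ => Nat.zero_le _)
  have h1 := hc .acc (.inl rfl) 0 _ (ready_ioState x a)
  have h2 := Runs.clearReg .inp (Function.update (ioState (unary x) a) .acc
    ((unary (f x fun _ => 0)).reverse ++ ioState (unary x) a .acc)) _ (by simp [ioState]; rfl)
  refine ⟨by simp; omega, (h1.seq h2).congr ?_ ?_⟩
  · clear * -
    funext r
    simp only [ioState, Function.update_apply]
    split_ifs <;> simp_all
  · simp; omega

/-- Both lists are computed from the original input. The second one lies reversed in `rev`, so
pouring `rev` into the emptied input register turns it around, and `F` finds a fresh input with all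
scratch registers empty. In the application, `f` writes one transducer of the chain and `g` hands
the remaining problem to `F`. -/
theorem ListComp.stage {f g : List ℕ → (ℕ → ℕ) → List ℕ} {F : List ℕ → List ℕ} (hf : Emits f)
    (hg : Emits g) (hF : ListComp F) :
    ListComp fun x => f x (fun _ => 0) ++ F (g x fun _ => 0) := by
  obtain ⟨c, P, hc⟩ := hf
  obtain ⟨d, Q, hd⟩ := hg
  obtain ⟨e, R, he⟩ := hF
  refine ⟨.seq (.seq (c .acc 0) (d .rev 0)) (.seq (.seq (clearReg .inp) (moveReg .rev .inp)) e),
    P + 4 * Q + 2 * .X + 2 + R.comp Q, fun x a N hx => ?_⟩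
  obtain ⟨hP, hc⟩ := hc x (fun _ => 0) N hx (fun _ => Nat.zero_le _)
  have h1 := hc .acc (.inl rfl) 0 _ (ready_ioState x a)
  obtain ⟨hQ, hd⟩ := hd x (fun _ => 0) N hx (fun _ => Nat.zero_le _)
  have h2 := hd .rev (.inr rfl) 0 _
    ((ready_ioState x a).update_out (.inl rfl) ((unary (f x fun _ => 0)).reverse ++
      ioState (unary x) a .acc))
  have h3 := Runs.clearReg .inp (Function.update (ioState (unary x)
    ((unary (f x fun _ => 0)).reverse ++ a)) .rev (unary (g x fun _ => 0)).reverse) _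
      (by simp [ioState]; rfl)
  have h4 := Runs.moveReg (r := .rev) (r' := .inp) (by simp) (Function.update (ioState []
    ((unary (f x fun _ => 0)).reverse ++ a)) .rev (unary (g x fun _ => 0)).reverse) _
      (by simp; rfl)
  obtain ⟨hR, h5⟩ := he (g x fun _ => 0) ((unary (f x fun _ => 0)).reverse ++ a) _ hQ
  refine ⟨by simp [unary_append]; omega,
    ((h1.seq h2).seq' ((h3.seq' h4 ?_).seq' h5 ?_) ?_).congr ?_ ?_⟩
  · clear * -
    funext r
    simp only [ioState, Function.update_apply]
    split_ifs <;> simp_all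
  · clear * -
    funext r
    simp only [ioState, Function.update_apply]
    split_ifs <;> simp_all
  · clear * -
    funext r
    simp only [ioState, Function.update_apply]
    split_ifs <;> simp_all
  · simp [unary_append]
  · simp; omega

/-- The accumulator is a stack and holds the output backwards; the final move to the output register
reverses it. -/
theorem ListComp.computableInPolyTime {F : List ℕ → List ℕ} (hF : ListComp F) {α : Type}
    (enc f : α → List ℕ) (h : ∀ a, f a = F (enc a)) :
    Nonempty (Turing.TM2ComputableInPolyTime (fun a => unary (enc a)) (id : List Bool → List Bool)
      (fun a => unary (f a))) := by
  obtain ⟨c, P, hc⟩ := hF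
  refine Cmd.computableInPolyTime _ _ (.seq c (moveReg .acc .fin)) (4 * P + 1) fun a => ?_
  obtain ⟨hP, h1⟩ := hc (enc a) [] _ le_rfl
  have h2 := Runs.moveReg (r := .acc) (r' := .fin) (by simp)
    (ioState [] ((unary (F (enc a))).reverse ++ [])) _ (by simp [ioState]; rfl)
  have h3 := (h1.seq h2).congr (s'' := Function.update (fun _ => []) .fin (unary (f a)))
    (T' := (4 * P + 1).eval (unary (enc a)).length) ?_ ?_
  · have h0 : Function.update (fun _ => []) .inp (unary (enc a)) = ioState (unary (enc a)) [] := by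
      clear * -
      funext r
      simp only [ioState, Function.update_apply]
      split_ifs <;> simp_all
    rw [h0]
    exact h3
  · rw [h a]
    clear * -
    funext r
    simp only [ioState, Function.update_apply]
    split_ifs <;> simp_all
  · simp; omega

end StackProgram

namespace PebbleTree

/-! ### Big-step semantics of pebble tree transducers -/

section BigStep

variable {S D : RankedAlphabet} {Q V I : Type} {k : ℕ}

/-- Big-step semantics: the output tree `s` is generated from a configuration, by a computation
all of whose configurations satisfy `P`. -/
inductive PTT.Gen (M : PTT S D Q V I k) (t : S.Tree) (P : Config Q V I → Prop) :
    Config Q V I → D.Tree → Prop where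
  | act (r : Rule S D Q V I) (c : Config Q V I) (q : Q) (α : Instr V I) (u : Address)
      (π : Stack V I) (s : D.Tree) (mem : r ∈ M.rules) (relevant : r.Relevant t c)
      (rhs : r.rhs = .act q α) (effect : α.Effect k c.pos c.stack u π) (hP : P c)
      (gen : Gen M t P ⟨q, u, π⟩ s) : Gen M t P c s
  | out (r : Rule S D Q V I) (c : Config Q V I) (d : D.Sym) (qs : Fin (D.rank d) → Q)
      (ch : Fin (D.rank d) → D.Tree)
      (mem : r ∈ M.rules) (relevant : r.Relevant t c) (rhs : r.rhs = .out d qs) (hP : P c)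
      (gen : ∀ i, Gen M t P ⟨qs i, c.pos, c.stack⟩ (ch i)) : Gen M t P c (.node d ch)

theorem PTT.Gen.mono {M : PTT S D Q V I k} {t : S.Tree} {P P' : Config Q V I → Prop}
    (hP : ∀ c, P c → P' c) {c : Config Q V I} {s : D.Tree} (h : M.Gen t P c s) :
    M.Gen t P' c s := by
  induction h with
  | act r c q α u π s mem rel rhs eff h _ ih => exact .act r c q α u π s mem rel rhs eff (hP _ h) ih
  | out r c d qs ch mem rel rhs h _ ih => exact .out r c d qs ch mem rel rhs (hP _ h) ih

/-- A derivation is a finite tree, so the stacks in it have a maximal height. This height decides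
how deeply copies must be nested in an encoded tree. -/
theorem PTT.Gen.exists_bound {M : PTT S D Q V I k} {t : S.Tree} {c : Config Q V I} {s : D.Tree}
    (h : M.Gen t (fun _ => True) c s) : ∃ n, M.Gen t (fun c => c.stack.length ≤ n) c s := by
  induction h with
  | act r c q α u π s mem rel rhs eff _ _ ih =>
    obtain ⟨n, ih⟩ := ih
    exact ⟨max n c.stack.length, .act r c q α u π s mem rel rhs eff (le_max_right _ _)
      (ih.mono fun _ h => h.trans (le_max_left _ _))⟩
  | out r c d qs ch mem rel rhs _ _ ih =>
    choose n ih using ih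
    exact ⟨max (Finset.univ.sup n) c.stack.length, .out r c d qs ch mem rel rhs (le_max_right _ _)
      fun i => (ih i).mono fun _ h => h.trans ((Finset.le_sup (Finset.mem_univ i)).trans
        (le_max_left _ _))⟩

/-- Generation of a tree from an output form. -/
inductive PTT.FormGen (M : PTT S D Q V I k) (t : S.Tree) :
    Form D (Config Q V I) → D.Tree → Prop where
  | leaf (c : Config Q V I) (s : D.Tree) (h : M.Gen t (fun _ => True) c s) : FormGen M t (.leaf c) s
  | node (d : D.Sym) (ch : Fin (D.rank d) → Form D (Config Q V I)) (ch' : Fin (D.rank d) → D.Tree)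
      (h : ∀ i, FormGen M t (ch i) (ch' i)) : FormGen M t (.node d ch) (.node d ch')

theorem PTT.formGen_toForm (M : PTT S D Q V I k) (t : S.Tree) (s : D.Tree) :
    M.FormGen t s.toForm s := by
  induction s with
  | node d ch ih => exact .node d _ ch ih

theorem PTT.formGen_node {M : PTT S D Q V I k} {t : S.Tree} {d : D.Sym}
    {ch : Fin (D.rank d) → Form D (Config Q V I)} {s : D.Tree} (h : M.FormGen t (.node d ch) s) :
    ∃ ch', s = .node d ch' ∧ ∀ i, M.FormGen t (ch i) (ch' i) := by
  cases h with
  | node _ _ ch' h => exact ⟨ch', rfl, h⟩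

theorem PTT.formGen_leaf {M : PTT S D Q V I k} {t : S.Tree} {c : Config Q V I} {s : D.Tree}
    (h : M.FormGen t (.leaf c) s) : M.Gen t (fun _ => True) c s := by
  cases h with
  | leaf _ _ h => exact h

/-- A step puts one more rule in front of the derivation at the rewritten leaf and leaves the
siblings alone. Read backwards along a computation, this assembles the derivation of its start. -/
theorem PTT.Step.formGen {M : PTT S D Q V I k} {t : S.Tree} {f f' : Form D (Config Q V I)}
    (h : M.Step t f f') {s : D.Tree} (hs : M.FormGen t f' s) : M.FormGen t f s := by
  induction h generalizing s with
  | here c f' h =>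
    refine .leaf _ _ ?_
    cases h with
    | act r _ q α u π mem rel rhs eff =>
      exact .act _ _ _ _ _ _ s mem rel rhs eff trivial (PTT.formGen_leaf hs)
    | out r _ d qs mem rel rhs =>
      obtain ⟨ch, rfl, h⟩ := PTT.formGen_node hs
      exact .out _ _ _ _ ch mem rel rhs trivial fun i => PTT.formGen_leaf (h i)
  | inside d ch i f' h ih =>
    obtain ⟨ch', rfl, h⟩ := PTT.formGen_node hs
    refine .node _ _ _ fun j => ?_
    by_cases hj : j = i
    · subst hj
      exact ih (by simpa using h j)
    · simpa [hj] using h j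

/-- The children are rewritten one after the other; the induction is on the set of those that are
finished. -/
theorem PTT.steps_node {M : PTT S D Q V I k} {t : S.Tree} {d : D.Sym}
    {f g : Fin (D.rank d) → Form D (Config Q V I)}
    (h : ∀ i, Relation.ReflTransGen (M.Step t) (f i) (g i)) :
    Relation.ReflTransGen (M.Step t) (.node d f) (.node d g) := by
  have one : ∀ (f : Fin (D.rank d) → Form D (Config Q V I)) (i : Fin (D.rank d))
      (y : Form D (Config Q V I)), Relation.ReflTransGen (M.Step t) (f i) y →
      Relation.ReflTransGen (M.Step t) (.node d f) (.node d (Function.update f i y)) := by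
    intro f i y h
    induction h with
    | refl => rw [Function.update_eq_self]
    | tail _ h ih =>
      refine ih.tail ?_
      have := PTT.Step.inside (M := M) (t := t) d (Function.update f i _) i _ (by simpa using h)
      simpa using this
  have key : ∀ A : Finset (Fin (D.rank d)), Relation.ReflTransGen (M.Step t) (.node d f)
      (.node d fun i => if i ∈ A then g i else f i) := by
    intro A
    induction A using Finset.induction_on with
    | empty => simpa using Relation.ReflTransGen.refl
    | insert a A ha ih =>
      refine ih.trans ?_
      have := one (fun i => if i ∈ A then g i else f i) a (g a) (by simpa [ha] using h a)
      convert this using 2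
      funext i
      by_cases hi : i = a
      · subst hi; simp
      · simp [hi]
  simpa using key Finset.univ

theorem PTT.steps_iff_gen {M : PTT S D Q V I k} {t : S.Tree} {c : Config Q V I} {s : D.Tree} :
    Relation.ReflTransGen (M.Step t) (.leaf c) s.toForm ↔ M.Gen t (fun _ => True) c s := by
  constructor
  · intro h
    have key : ∀ f, Relation.ReflTransGen (M.Step t) f s.toForm → M.FormGen t f s := by
      intro f h
      induction h using Relation.ReflTransGen.head_induction_on with
      | refl => exact PTT.formGen_toForm M t s
      | head h _ ih => exact h.formGen ih
    exact PTT.formGen_leaf (key _ h)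
  · intro h
    induction h with
    | act r c q α u π s mem rel rhs eff _ _ ih =>
      exact .head (.here _ _ (.act r c q α u π mem rel rhs eff)) ih
    | out r c d qs ch mem rel rhs _ _ ih =>
      exact .head (.here _ _ (.out r c d qs mem rel rhs)) (PTT.steps_node ih)

theorem PTT.mem_transduction {M : PTT S D Q V I k} {t : S.Tree} {s : D.Tree} :
    (t, s) ∈ M.transduction ↔ ∃ q ∈ M.init, M.Gen t (fun _ => True) ⟨q, [], []⟩ s := by
  simp only [PTT.transduction, Set.mem_ofPred_eq, PTT.steps_iff_gen]

end BigStep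

/-! ### Renaming states and colours -/

section Rename

variable {S D : RankedAlphabet} {Q V I Q' V' I' : Type} {k : ℕ}

/-- Renaming of colours in an instruction. -/
def Instr.map (f : V ⊕ I ≃ V' ⊕ I') : Instr V I → Instr V' I'
  | .stay => .stay
  | .up => .up
  | .down i => .down i
  | .drop c => .drop (f c)
  | .lift c => .lift (f c)

/-- Renaming of states and colours in the right-hand side of a rule. -/
def Rhs.map (e : Q ≃ Q') (f : V ⊕ I ≃ V' ⊕ I') : Rhs D Q V I → Rhs D Q' V' I'
  | .act q α => .act (e q) (α.map f)
  | .out d qs => .out d fun i => e (qs i)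

/-- Renaming of states and colours in a rule. -/
def Rule.map (e : Q ≃ Q') (f : V ⊕ I ≃ V' ⊕ I') (r : Rule S D Q V I) : Rule S D Q' V' I' :=
  ⟨e r.q, r.a, r.j, r.b.map f.toEmbedding, r.rhs.map e f⟩

/-- Renaming of states and colours in a configuration. -/
def Config.map (e : Q ≃ Q') (f : V ⊕ I ≃ V' ⊕ I') (c : Config Q V I) : Config Q' V' I' :=
  ⟨e c.state, c.pos, c.stack.map fun p => (p.1, f p.2)⟩

theorem Rule.WellFormed.map {r : Rule S D Q V I} (h : r.WellFormed k) (e : Q ≃ Q') (g : V ≃ V')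
    (h' : I ≃ I') : (r.map e (g.sumCongr h')).WellFormed k := by
  obtain ⟨h1, h2, h3, h4⟩ := h
  have hl : (r.b.map (g.sumCongr h').toEmbedding).toLeft = r.b.toLeft.map g.toEmbedding := by
    ext v; simp [Finset.mem_toLeft]
  have hr : (r.b.map (g.sumCongr h').toEmbedding).toRight = r.b.toRight.map h'.toEmbedding := by
    ext v; simp [Finset.mem_toRight]
  refine ⟨h1, ?_, ?_, ?_⟩
  · simpa [Rule.map, hl] using h2
  · simpa [Rule.map, hr] using h3
  · obtain ⟨q, a, j, b, rhs⟩ := r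
    rcases rhs with ⟨q, _ | _ | _ | _ | _⟩ | _ <;>
      first | trivial | simpa [Rule.map, Rhs.map, Instr.map, Rhs.Allowed] using h4

/-- Renaming of states and colours in a transducer. -/
def PTT.rename (M : PTT S D Q V I k) (e : Q ≃ Q') (g : V ≃ V') (h : I ≃ I') :
    PTT S D Q' V' I' k where
  init := M.init.map e.toEmbedding
  rules := M.rules.map fun r => r.map e (g.sumCongr h)
  wellFormed := by
    intro r hr
    obtain ⟨r, hr', rfl⟩ := List.mem_map.1 hr
    exact (M.wellFormed r hr').map e g h

theorem observable_map (g : V ≃ V') (h : I ≃ I') (u : Address) (π : Stack V I) (x : V ⊕ I) :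
    Observable u (π.map fun p => (p.1, (g.sumCongr h) p.2)) (g.sumCongr h x) ↔
      Observable u π x := by
  cases x with
  | inl v =>
    simp only [Observable, Equiv.sumCongr_apply, Sum.map_inl, List.mem_map, Prod.mk.injEq,
      Prod.exists]
    constructor
    · rintro ⟨a, b, hm, rfl, hb⟩
      rcases b with b | b <;> simp at hb
      subst hb; exact hm
    · intro hm; exact ⟨_, _, hm, rfl, rfl⟩
  | inr i =>
    simp only [Observable, Equiv.sumCongr_apply, Sum.map_inr, List.head?_map, Option.map_eq_some_iff,
      Prod.mk.injEq, Prod.exists]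
    constructor
    · rintro ⟨a, b, hm, rfl, hb⟩
      rcases b with b | b <;> simp at hb
      subst hb; exact hm
    · intro hm; exact ⟨_, _, hm, rfl, rfl⟩

theorem Rule.relevant_map (e : Q ≃ Q') (g : V ≃ V') (h : I ≃ I') (t : S.Tree) (r : Rule S D Q V I)
    (c : Config Q V I) :
    (r.map e (g.sumCongr h)).Relevant t (c.map e (g.sumCongr h)) ↔ r.Relevant t c := by
  simp only [Rule.Relevant, Rule.map, Config.map, EmbeddingLike.apply_eq_iff_eq]
  refine and_congr_right fun _ => and_congr_right fun _ => and_congr_right fun _ => ?_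
  rw [(g.sumCongr h).surjective.forall]
  refine forall_congr' fun x => ?_
  rw [observable_map, Finset.mem_map_equiv, Equiv.symm_apply_apply]

theorem Instr.Effect.map (g : V ≃ V') (h : I ≃ I') {α : Instr V I} {u u' : Address}
    {π π' : Stack V I} (ha : α.Effect k u π u' π') :
    (α.map (g.sumCongr h)).Effect k u (π.map fun p => (p.1, (g.sumCongr h) p.2)) u'
      (π'.map fun p => (p.1, (g.sumCongr h) p.2)) := by
  cases ha with
  | stay => exact .stay _ _
  | up => exact .up _ _ _
  | down => exact .down _ _ _
  | dropVisible v _ _ fresh few =>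
    refine .dropVisible (g v) _ _ ?_ ?_
    · intro p hp
      obtain ⟨p, hp', rfl⟩ := List.mem_map.1 hp
      have := fresh p hp'
      rcases hb : p.2 with b | b <;> simp [hb] at this ⊢
      exact this
    · rw [List.countP_map]
      convert few using 2
      funext p
      rcases hb : p.2 with b | b <;> simp [hb]
  | dropInvisible => exact .dropInvisible _ _ _
  | lift => exact .lift _ _ _

theorem Rhs.map_map_symm (e : Q ≃ Q') (f : V ⊕ I ≃ V' ⊕ I') (r : Rhs D Q V I) :
    (r.map e f).map e.symm f.symm = r := by
  rcases r with ⟨q, _ | _ | _ | _ | _⟩ | _ <;> simp [Rhs.map, Instr.map]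

theorem Rule.map_map_symm (e : Q ≃ Q') (f : V ⊕ I ≃ V' ⊕ I') (r : Rule S D Q V I) :
    (r.map e f).map e.symm f.symm = r := by
  obtain ⟨q, a, j, b, rhs⟩ := r
  simp only [Rule.map, Rhs.map_map_symm, Equiv.symm_apply_apply, Finset.map_map, Rule.mk.injEq,
    true_and, and_true]
  ext x
  simp

theorem PTT.Gen.rename {M : PTT S D Q V I k} {M' : PTT S D Q' V' I' k} (e : Q ≃ Q') (g : V ≃ V')
    (h : I ≃ I') (hM : ∀ r ∈ M.rules, r.map e (g.sumCongr h) ∈ M'.rules) {t : S.Tree}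
    {c : Config Q V I} {s : D.Tree} (hs : M.Gen t (fun _ => True) c s) :
    M'.Gen t (fun _ => True) (c.map e (g.sumCongr h)) s := by
  induction hs with
  | act r c q α u π s mem rel rhs eff _ _ ih =>
    exact .act _ _ _ _ _ _ _ (hM r mem) ((r.relevant_map e g h t c).2 rel)
      (by simp only [Rule.map, rhs, Rhs.map]) (eff.map g h) trivial ih
  | out r c d qs ch mem rel rhs _ _ ih =>
    exact .out _ _ _ _ _ (hM r mem) ((r.relevant_map e g h t c).2 rel)
      (by simp only [Rule.map, rhs, Rhs.map]) trivial ih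

/-- The class `VIPTT` allows arbitrary finite types of states and colours, whereas the construction
does arithmetic with them; renaming passes to types `Fin n`. Both inclusions are instances of
`PTT.Gen.rename`, for the renaming and for its inverse. -/
theorem PTT.transduction_rename (M : PTT S D Q V I k) (e : Q ≃ Q') (g : V ≃ V') (h : I ≃ I') :
    (M.rename e g h).transduction = M.transduction := by
  ext ⟨t, s⟩
  rw [PTT.mem_transduction, PTT.mem_transduction]
  constructor
  · rintro ⟨q, hq, hs⟩
    obtain ⟨q, hq', rfl⟩ := Finset.mem_map.1 hq
    refine ⟨q, hq', ?_⟩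
    have := hs.rename (M' := M) e.symm g.symm h.symm (fun r hr => by
      obtain ⟨r, hr', rfl⟩ := List.mem_map.1 hr
      have := r.map_map_symm e (g.sumCongr h)
      rw [Equiv.sumCongr_symm] at this
      rwa [this])
    simpa [Config.map] using this
  · rintro ⟨q, hq, hs⟩
    exact ⟨e q, Finset.mem_map_of_mem _ hq, hs.rename e g h fun r hr =>
      List.mem_map_of_mem hr⟩

end Rename

/-! ### Removing unused pebbles -/

section Erase

variable {S D : RankedAlphabet} {Q V I : Type} {k : ℕ}

/-- The right-hand side of a rule, if it does not involve pebbles. -/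
def Rhs.erase : Rhs D Q V I → Option (Rhs D Q (Fin 0) (Fin 0))
  | .act q .stay => some (.act q .stay)
  | .act q .up => some (.act q .up)
  | .act q (.down i) => some (.act q (.down i))
  | .act _ (.drop _) => none
  | .act _ (.lift _) => none
  | .out d qs => some (.out d qs)

/-- Turns a rule into one without pebbles; rules that involve pebbles are replaced by rules
without effect. -/
def Rule.erase [DecidableEq V] [DecidableEq I] (r : Rule S D Q V I) :
    Rule S D Q (Fin 0) (Fin 0) :=
  ⟨r.q, r.a, r.j, ∅, if r.b = ∅ then r.rhs.erase.getD (.act r.q .stay) else .act r.q .stay⟩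

/-- Turns a transducer into one without pebbles. -/
def PTT.erase [DecidableEq V] [DecidableEq I] (M : PTT S D Q V I k) : TT S D Q where
  init := M.init
  rules := M.rules.map Rule.erase
  wellFormed := by
    intro r hr
    obtain ⟨r, hr', rfl⟩ := List.mem_map.1 hr
    obtain ⟨h1, -, -, h4⟩ := M.wellFormed r hr'
    refine ⟨h1, (Finset.card_eq_zero.2 (by ext x; simp [Rule.erase])).le,
      (Finset.card_eq_zero.2 (by ext x; simp [Rule.erase])).le.trans zero_le_one, ?_⟩
    obtain ⟨q, a, j, b, rhs⟩ := r
    simp only [Rule.erase]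
    split_ifs
    · rcases rhs with ⟨q, _ | _ | _ | _ | _⟩ | _ <;> trivial
    · trivial

theorem observable_nil {u : Address} {x : V ⊕ I} : ¬ Observable u [] x := by
  cases x <;> simp [Observable]

/-- Without drop instructions the stack remains empty. Then rules with `b ≠ ∅` are never relevant
and lifts never apply, so replacing all these by self-loops changes nothing. -/
theorem PTT.transduction_erase [DecidableEq V] [DecidableEq I] (M : PTT S D Q V I k)
    (hM : ∀ r ∈ M.rules, ∀ q c, r.rhs ≠ .act q (.drop c)) :
    M.erase.transduction = M.transduction := by
  ext ⟨t, s⟩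
  rw [PTT.mem_transduction, PTT.mem_transduction]
  refine exists_congr fun q => and_congr_right fun _ => ?_
  constructor
  · intro h
    have key : ∀ c, M.erase.Gen t (fun _ => True) c s → c.stack = [] →
        M.Gen t (fun _ => True) ⟨c.state, c.pos, []⟩ s := by
      clear h
      intro c h
      induction h with
      | act r c q α u π s mem rel rhs eff _ _ ih =>
        intro hc
        obtain ⟨r, mem', rfl⟩ := List.mem_map.1 mem
        obtain ⟨q₀, a, j, b, rhs₀⟩ := r
        obtain ⟨rel1, rel2, rel3, -⟩ := rel
        simp only [Rule.erase] at rel1 rel2 rel3 rhs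
        obtain ⟨cq, cu, cπ⟩ := c
        simp only at hc rel1 rel2 rel3 eff
        subst hc
        -- A self-loop stays in the same configuration, so it can be removed from the derivation.
        have hstay : (.act q₀ .stay : Rhs D Q (Fin 0) (Fin 0)) = .act q α → M.Gen t (fun _ => True)
            ⟨cq, cu, []⟩ s := by
          intro h
          injection h with h1 h2
          subst h2
          cases eff
          simpa [← h1, rel1] using ih rfl
        split_ifs at rhs with hb
        · have rel' : Rule.Relevant t ⟨q₀, a, j, b, rhs₀⟩ (⟨cq, cu, []⟩ : Config Q V I) :=
            ⟨rel1, rel2, rel3, fun x => by simp [hb, observable_nil]⟩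
          rcases rhs₀ with ⟨q', _ | _ | i | _ | _⟩ | _ <;>
            simp only [Rhs.erase, Option.getD_some, Option.getD_none, Rhs.act.injEq,
              reduceCtorEq] at rhs
          · obtain ⟨rfl, rfl⟩ := rhs
            cases eff
            exact .act _ _ _ _ _ _ _ mem' rel' rfl (.stay _ _) trivial (ih rfl)
          · obtain ⟨rfl, rfl⟩ := rhs
            cases eff
            exact .act _ _ _ _ _ _ _ mem' rel' rfl (.up _ _ _) trivial (ih rfl)
          · obtain ⟨rfl, rfl⟩ := rhs
            cases eff
            exact .act _ _ _ _ _ _ _ mem' rel' rfl (.down _ _ _) trivial (ih rfl)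
          · exact hstay (by simpa using rhs)
          · exact hstay (by simpa using rhs)
        · exact hstay rhs
      | out r c d qs ch mem rel rhs _ _ ih =>
        intro hc
        obtain ⟨r, mem', rfl⟩ := List.mem_map.1 mem
        obtain ⟨q₀, a, j, b, rhs₀⟩ := r
        obtain ⟨rel1, rel2, rel3, -⟩ := rel
        simp only [Rule.erase] at rel1 rel2 rel3 rhs
        split_ifs at rhs with hb
        · have rel' : Rule.Relevant t ⟨q₀, a, j, b, rhs₀⟩ (⟨c.state, c.pos, []⟩ : Config Q V I) :=
            ⟨rel1, rel2, rel3, fun x => by simp [hb, observable_nil]⟩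
          rcases rhs₀ with ⟨q', _ | _ | i | _ | _⟩ | _ <;>
            simp only [Rhs.erase, Option.getD_some, Option.getD_none, Rhs.out.injEq,
              reduceCtorEq] at rhs
          obtain ⟨rfl, rhs⟩ := rhs
          cases rhs
          exact .out _ _ _ _ _ mem' rel' rfl trivial (fun i => ih i hc)
    exact key _ h rfl
  · intro h
    have hmem : ∀ r ∈ M.rules, r.erase ∈ M.erase.rules := fun r hr => List.mem_map_of_mem hr
    have key : ∀ c, M.Gen t (fun _ => True) c s → c.stack = [] →
        M.erase.Gen t (fun _ => True) ⟨c.state, c.pos, []⟩ s := by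
      clear h
      intro c h
      induction h with
      | act r c q α u π s mem rel rhs eff _ _ ih =>
        intro hc
        have hd := hM r mem
        obtain ⟨rel1, rel2, rel3, rel4⟩ := rel
        obtain ⟨cq, cu, cπ⟩ := c
        simp only at hc rel1 rel2 rel3 rel4 eff
        subst hc
        have hb : r.b = ∅ := by
          ext x; simp [rel4, observable_nil]
        have rel' : r.erase.Relevant t (⟨cq, cu, []⟩ : Config Q (Fin 0) (Fin 0)) :=
          ⟨rel1, rel2, rel3, fun x => by simp [Rule.erase, observable_nil]⟩
        cases eff with
        | stay =>
          exact .act _ _ q .stay _ _ _ (hmem r mem) rel'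
            (by simp [Rule.erase, hb, rhs, Rhs.erase]) (.stay _ _) trivial (ih rfl)
        | up =>
          exact .act _ _ q .up _ _ _ (hmem r mem) rel'
            (by simp [Rule.erase, hb, rhs, Rhs.erase]) (.up _ _ _) trivial (ih rfl)
        | down i =>
          exact .act _ _ q (.down i) _ _ _ (hmem r mem) rel'
            (by simp [Rule.erase, hb, rhs, Rhs.erase]) (.down _ _ _) trivial (ih rfl)
        | dropVisible v => exact absurd rhs (hd _ _)
        | dropInvisible v => exact absurd rhs (hd _ _)
      | out r c d qs ch mem rel rhs _ _ ih =>
        intro hc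
        obtain ⟨rel1, rel2, rel3, rel4⟩ := rel
        have hb : r.b = ∅ := by
          ext x; simp [rel4, hc, observable_nil]
        exact .out r.erase _ d qs _ (hmem r mem)
          ⟨rel1, rel2, rel3, fun x => by simp [Rule.erase, observable_nil]⟩
          (by simp [Rule.erase, hb, rhs, Rhs.erase]) trivial (fun i => ih i hc)
    exact key _ h rfl

end Erase

end PebbleTree

namespace PebbleTree

/-! ### Nodes of trees -/

section Nodes

variable {S : RankedAlphabet}

theorem RankedAlphabet.Tree.child?_node (a : S.Sym) (ch : Fin (S.rank a) → S.Tree) (i : ℕ) :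
    (RankedAlphabet.Tree.node a ch).child? i =
      if h : 1 ≤ i ∧ i ≤ S.rank a then some (ch ⟨i - 1, by omega⟩) else none := by
  rw [RankedAlphabet.Tree.child?]

theorem RankedAlphabet.Tree.subtree?_cons (t : S.Tree) (i : ℕ) (u : Address) :
    t.subtree? (i :: u) = (t.subtree? u).bind fun s => s.child? i := rfl

theorem RankedAlphabet.Tree.label?_eq_some {t : S.Tree} {u : Address} {a : S.Sym} :
    t.label? u = some a ↔ ∃ ch, t.subtree? u = some (.node a ch) := by
  rw [RankedAlphabet.Tree.label?, Option.map_eq_some_iff]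
  constructor
  · rintro ⟨⟨a, ch⟩, h, rfl⟩; exact ⟨ch, h⟩
  · rintro ⟨ch, h⟩; exact ⟨_, h, rfl⟩

theorem RankedAlphabet.Tree.label?_nil (t : S.Tree) : t.label? [] = some t.rootLabel := rfl

theorem RankedAlphabet.Tree.label?_cons {t : S.Tree} {i : ℕ} {u : Address} {a : S.Sym}
    (h : t.label? (i :: u) = some a) : ∃ b, t.label? u = some b ∧ 1 ≤ i ∧ i ≤ S.rank b := by
  obtain ⟨ch, h⟩ := RankedAlphabet.Tree.label?_eq_some.1 h
  rw [RankedAlphabet.Tree.subtree?_cons, Option.bind_eq_some_iff] at h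
  obtain ⟨⟨b, ch'⟩, hb, h⟩ := h
  rw [RankedAlphabet.Tree.child?_node] at h
  split_ifs at h with hi
  exact ⟨b, RankedAlphabet.Tree.label?_eq_some.2 ⟨_, hb⟩, hi⟩

theorem RankedAlphabet.Tree.exists_label?_cons {t : S.Tree} {i : ℕ} {u : Address} {b : S.Sym}
    (h : t.label? u = some b) (h1 : 1 ≤ i) (hi : i ≤ S.rank b) : ∃ a, t.label? (i :: u) = some a := by
  obtain ⟨ch, h⟩ := RankedAlphabet.Tree.label?_eq_some.1 h
  have : t.subtree? (i :: u) = some (ch ⟨i - 1, by omega⟩) := by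
    rw [RankedAlphabet.Tree.subtree?_cons, h, Option.bind_some, RankedAlphabet.Tree.child?_node,
      dif_pos ⟨h1, hi⟩]
  exact ⟨_, by rw [RankedAlphabet.Tree.label?, this]; rfl⟩

theorem RankedAlphabet.rank_le_maxRank (a : S.Sym) : S.rank a ≤ S.maxRank :=
  Finset.le_sup (f := S.rank) (Finset.mem_univ a)

theorem RankedAlphabet.Tree.childNo_le {t : S.Tree} {u : Address} {a : S.Sym}
    (h : t.label? u = some a) : u.childNo ≤ S.maxRank := by
  cases u with
  | nil => exact Nat.zero_le _
  | cons i u =>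
    obtain ⟨b, -, -, hi⟩ := RankedAlphabet.Tree.label?_cons h
    exact hi.trans (S.rank_le_maxRank b)

end Nodes

/-! ### The alphabet of encoded trees

An encoded tree represents a tree together with pebble stacks. Its nodes carry the label and the
child number of a node of the tree, a direction and the number of a colour (`0` if there is no
pebble). The node represents a position in a copy of the tree that belongs to a pebble; the
direction is `0` if the way to the node with the pebble leads to the parent, `1` if the pebble is
here, and `i + 1` if the way leads to the `i`-th child. The first child of the node represents the
parent, the next ones represent the children, and the others are copies that belong to new pebbles
at this node. -/

section Encoding

variable {S : RankedAlphabet} {n : ℕ} (e : S.Sym ≃ Fin n) (nc : ℕ)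

/-- The number of encoded symbols for each symbol. -/
def encBlock (m nc : ℕ) : ℕ := (m + 1) * (m + 2) * (nc + 1)

/-- The ranks of the symbols of encoded trees. -/
def encRanks : List ℕ :=
  0 :: (List.range (n * encBlock S.maxRank nc)).map fun x =>
    1 + ((List.finRange n).map fun a => S.rank (e.symm a)).getD (x / encBlock S.maxRank nc) 0 + nc

theorem length_encRanks : (encRanks e nc).length = n * encBlock S.maxRank nc + 1 := by
  simp [encRanks]

/-- The alphabet of encoded trees. -/
abbrev encAlphabet : RankedAlphabet := .ofRanks (encRanks e nc)

/-- The symbol at the leaves where the encoded tree is cut. -/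
def encBot : (encAlphabet e nc).Sym := ⟨0, by rw [length_encRanks]; omega⟩

/-- The number of a symbol of encoded trees. -/
def encIndex (m nc a j d c : ℕ) : ℕ := a * encBlock m nc + ((j * (m + 2) + d) * (nc + 1) + c) + 1

/-- The symbols of encoded trees. -/
def encSym (a : S.Sym) (j d c : ℕ) : (encAlphabet e nc).Sym :=
  if h : encIndex S.maxRank nc (e a) j d c < (encRanks e nc).length then ⟨_, h⟩ else encBot e nc

variable {e nc}

theorem encOffset_lt {m nc j d c : ℕ} (hj : j ≤ m) (hd : d ≤ m + 1) (hc : c ≤ nc) :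
    (j * (m + 2) + d) * (nc + 1) + c < encBlock m nc := by
  have h1 : j * (m + 2) + d + 1 ≤ (m + 1) * (m + 2) := by nlinarith
  have h2 := Nat.mul_le_mul_right (nc + 1) h1
  unfold encBlock
  nlinarith

theorem encIndex_lt {a : S.Sym} {j d c : ℕ} (hj : j ≤ S.maxRank) (hd : d ≤ S.maxRank + 1)
    (hc : c ≤ nc) : encIndex S.maxRank nc (e a) j d c < (encRanks e nc).length := by
  rw [length_encRanks, encIndex]
  have h1 := encOffset_lt hj hd hc
  have h2 : ((e a : ℕ) + 1) * encBlock S.maxRank nc ≤ n * encBlock S.maxRank nc :=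
    Nat.mul_le_mul_right _ (e a).isLt
  nlinarith

theorem val_encSym {a : S.Sym} {j d c : ℕ} (hj : j ≤ S.maxRank) (hd : d ≤ S.maxRank + 1)
    (hc : c ≤ nc) : Fin.val (n := (encRanks e nc).length) (encSym e nc a j d c) =
      encIndex S.maxRank nc (e a) j d c := by
  rw [encSym, dif_pos (encIndex_lt hj hd hc)]

theorem rank_encSym {a : S.Sym} {j d c : ℕ} (hj : j ≤ S.maxRank) (hd : d ≤ S.maxRank + 1)
    (hc : c ≤ nc) : (encAlphabet e nc).rank (encSym e nc a j d c) = 1 + S.rank a + nc := by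
  -- Division by the block size recovers the number of the input symbol.
  have h : ((e a : ℕ) * encBlock S.maxRank nc +
      ((j * (S.maxRank + 2) + d) * (nc + 1) + c)) / encBlock S.maxRank nc = e a := by
    have h1 := encOffset_lt (m := S.maxRank) (nc := nc) hj hd hc
    rw [mul_comm, Nat.mul_add_div (by omega), Nat.div_eq_of_lt h1, add_zero]
  change (encRanks e nc).get _ = _
  rw [List.get_eq_getElem]
  simp only [val_encSym hj hd hc]
  simp [encRanks, encIndex, h]

theorem rank_encBot : (encAlphabet e nc).rank (encBot e nc) = 0 := rfl

theorem encSym_ne_encBot {a : S.Sym} {j d c : ℕ} (hj : j ≤ S.maxRank) (hd : d ≤ S.maxRank + 1)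
    (hc : c ≤ nc) : encSym e nc a j d c ≠ encBot e nc := by
  intro h
  have := congrArg (Fin.val (n := (encRanks e nc).length)) h
  rw [val_encSym hj hd hc] at this
  simp [encBot, encIndex] at this

theorem mul_add_inj {k a b a' b' : ℕ} (hb : b < k) (hb' : b' < k) (h : a * k + b = a' * k + b') :
    a = a' ∧ b = b' := by
  have h1 := congrArg (· / k) h
  have h2 := congrArg (· % k) h
  simp only [mul_comm _ k, Nat.mul_add_div (show 0 < k by omega), Nat.div_eq_of_lt hb,
    Nat.div_eq_of_lt hb', Nat.mul_add_mod, Nat.mod_eq_of_lt hb, Nat.mod_eq_of_lt hb'] at h1 h2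
  exact ⟨by simpa using h1, h2⟩

/-- Apart from the shift by `1` that reserves `0` for the cut, the number of a symbol is a
mixed-radix expansion with digits `a`, `j`, `d`, `c`. -/
theorem encSym_inj {a a' : S.Sym} {j j' d d' c c' : ℕ} (hj : j ≤ S.maxRank)
    (hd : d ≤ S.maxRank + 1) (hc : c ≤ nc) (hj' : j' ≤ S.maxRank) (hd' : d' ≤ S.maxRank + 1)
    (hc' : c' ≤ nc) (h : encSym e nc a j d c = encSym e nc a' j' d' c') :
    a = a' ∧ j = j' ∧ d = d' ∧ c = c' := by
  have := congrArg (Fin.val (n := (encRanks e nc).length)) h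
  rw [val_encSym hj hd hc, val_encSym hj' hd' hc', encIndex, encIndex, Nat.add_right_cancel_iff]
    at this
  obtain ⟨h1, h2⟩ := mul_add_inj (encOffset_lt hj hd hc) (encOffset_lt hj' hd' hc') this
  obtain ⟨h3, h4⟩ := mul_add_inj (by omega) (by omega) h2
  obtain ⟨h5, h6⟩ := mul_add_inj (by omega) (by omega) h3
  exact ⟨e.injective (Fin.ext h1), h5, h6, h4⟩

/-- Needed for well-formed rules, whose child numbers must not exceed the maximal rank. The symbol
`a` only ensures that the maximum over the input alphabet is attained. -/
theorem le_maxRank_encAlphabet {a : S.Sym} : 1 + S.maxRank + nc ≤ (encAlphabet e nc).maxRank := by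
  obtain ⟨b, -, hb⟩ := Finset.exists_mem_eq_sup (Finset.univ : Finset S.Sym) ⟨a, Finset.mem_univ _⟩
    S.rank
  have h := (encAlphabet e nc).rank_le_maxRank (encSym e nc b 0 0 0)
  rw [rank_encSym (by omega) (by omega) (by omega)] at h
  rw [show S.maxRank = S.rank b from hb]
  exact h

/-! ### The transducer that produces the encoded trees -/

/-- The number of states of the encoding transducer. -/
def encStates (m nc : ℕ) : ℕ := (2 * m + 4) * (nc + 1)

theorem encStates_pos (m nc : ℕ) : 0 < encStates m nc := by unfold encStates; positivity

/-- The states of the encoding transducer: kind `x` and colour `c`. The kinds `d ≤ m + 1` produce a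
node with direction `d`, the kind `m + 2` moves up, the kinds `m + 2 + i` move down to the `i`-th
child, and the kind `2 * m + 3` starts a new copy or cuts the tree. -/
def encState (m nc x c : ℕ) : Fin (encStates m nc) :=
  if h : x * (nc + 1) + c < encStates m nc then ⟨_, h⟩ else ⟨0, encStates_pos m nc⟩

theorem val_encState {m nc x c : ℕ} (hx : x ≤ 2 * m + 3) (hc : c ≤ nc) :
    (encState m nc x c : ℕ) = x * (nc + 1) + c := by
  have : x * (nc + 1) + c < encStates m nc := by unfold encStates; nlinarith
  rw [encState, dif_pos this]

theorem encState_inj {m nc x c x' c' : ℕ} (hx : x ≤ 2 * m + 3) (hc : c ≤ nc)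
    (hx' : x' ≤ 2 * m + 3) (hc' : c' ≤ nc) (h : encState m nc x c = encState m nc x' c') :
    x = x' ∧ c = c' := by
  have := congrArg Fin.val h
  rw [val_encState hx hc, val_encState hx' hc'] at this
  exact mul_add_inj (by omega) (by omega) this

/-- Kind and colour of the state that produces the child with index `x` of an encoded node. -/
def encChild (m r j d c x : ℕ) : ℕ × ℕ :=
  if x = 0 then if j = 0 ∨ d = 0 then (2 * m + 3, 0) else (m + 2, c)
  else if x ≤ r then if d = x + 1 then (2 * m + 3, 0) else (m + 2 + x, c)
  else (2 * m + 3, x - r)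

variable (e nc)

/-- The right-hand sides of the rules of the encoding transducer. -/
def encRhs (a : S.Sym) (j x c : ℕ) :
    Rhs (encAlphabet e nc) (Fin (encStates S.maxRank nc)) (Fin 0) (Fin 0) :=
  if x ≤ S.maxRank + 1 then
    .out (encSym e nc a j x c) fun y =>
      let s := encChild S.maxRank (S.rank a) j x c y
      encState S.maxRank nc s.1 s.2
  else if x = S.maxRank + 2 ∧ j ≠ 0 then .act (encState S.maxRank nc (j + 1) c) .up
  else if S.maxRank + 2 < x ∧ x ≤ S.maxRank + 2 + S.rank a then
    .act (encState S.maxRank nc 0 c) (.down (x - (S.maxRank + 2)))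
  else if x = 2 * S.maxRank + 3 then .out (encBot e nc) fun _ => encState S.maxRank nc 0 0
  else if x = 2 * S.maxRank + 4 ∧ c ≠ 0 then .act (encState S.maxRank nc 1 c) .stay
  else .act (encState S.maxRank nc (min x (2 * S.maxRank + 3)) c) .stay

/-- The rules of the encoding transducer. -/
def encRule (a : S.Sym) (j x c : ℕ) :
    Rule S (encAlphabet e nc) (Fin (encStates S.maxRank nc)) (Fin 0) (Fin 0) :=
  ⟨encState S.maxRank nc (min x (2 * S.maxRank + 3)) c, a, j, ∅, encRhs e nc a j x c⟩

/-- The encoding transducer. -/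
def encTT : TT S (encAlphabet e nc) (Fin (encStates S.maxRank nc)) where
  init := {encState S.maxRank nc 1 0}
  rules := (List.finRange n).flatMap fun a => (List.range (S.maxRank + 1)).flatMap fun j =>
    (List.range (2 * S.maxRank + 5)).flatMap fun x => (List.range (nc + 1)).map fun c =>
      encRule e nc (e.symm a) j x c
  wellFormed := by
    intro r hr
    simp only [List.mem_flatMap, List.mem_map, List.mem_range] at hr
    obtain ⟨a, -, j, hj, x, hx, c, hc, rfl⟩ := hr
    refine ⟨by simp only [encRule]; omega, (Finset.card_eq_zero.2 (by ext x; simp [encRule])).le,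
      (Finset.card_eq_zero.2 (by ext x; simp [encRule])).le.trans zero_le_one, ?_⟩
    simp only [encRule, encRhs]
    split_ifs with h1 h2 h3 <;> first | trivial | exact h2.2 | (constructor <;> omega)

variable {e nc}

/-- The index `x` takes one value more than there are kinds of states: the kind `2 * m + 3` has two
rules, cutting and starting a copy, and the `min` in `encRule` sends both to the same state.
Combinations without meaning give self-loops, so that the list of rules is a full product and can be
written by plain nested loops. -/
theorem mem_encTT {r} : r ∈ (encTT e nc).rules ↔ ∃ a j x c, j ≤ S.maxRank ∧
    x ≤ 2 * S.maxRank + 4 ∧ c ≤ nc ∧ r = encRule e nc a j x c := by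
  simp only [encTT, List.mem_flatMap, List.mem_map, List.mem_range, List.mem_finRange, true_and]
  constructor
  · rintro ⟨a, j, hj, x, hx, c, hc, rfl⟩
    exact ⟨e.symm a, j, x, c, by omega, by omega, by omega, rfl⟩
  · rintro ⟨a, j, x, c, hj, hx, hc, rfl⟩
    exact ⟨e a, j, by omega, x, by omega, c, by omega, by simp⟩

variable (e nc)

/-- The trees that are produced by the encoding transducer from a state with kind `x` and colour
`c` at the node `u`, where copies are nested at least up to depth `N`. -/
inductive Enc (t : S.Tree) : ℕ → ℕ → ℕ → Address → (encAlphabet e nc).Tree → Prop where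
  | node (N d c : ℕ) (u : Address) (a : S.Sym)
      (ch : Fin ((encAlphabet e nc).rank (encSym e nc a u.childNo d c)) → (encAlphabet e nc).Tree)
      (hd : d ≤ S.maxRank + 1) (ha : t.label? u = some a)
      (h : ∀ x : Fin _, Enc t N (encChild S.maxRank (S.rank a) u.childNo d c x).1
        (encChild S.maxRank (S.rank a) u.childNo d c x).2 u (ch x)) :
      Enc t N d c u (.node (encSym e nc a u.childNo d c) ch)
  | up (N c i : ℕ) (u : Address) (a : S.Sym) (s : (encAlphabet e nc).Tree)
      (ha : t.label? (i :: u) = some a) (h : Enc t N (i + 1) c u s) :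
      Enc t N (S.maxRank + 2) c (i :: u) s
  | down (N c i : ℕ) (u : Address) (a : S.Sym) (s : (encAlphabet e nc).Tree)
      (ha : t.label? u = some a) (h1 : 1 ≤ i) (hi : i ≤ S.rank a) (h : Enc t N 0 c (i :: u) s) :
      Enc t N (S.maxRank + 2 + i) c u s
  | bot (N c : ℕ) (u : Address) (a : S.Sym) (ha : t.label? u = some a) (h : c = 0 ∨ N = 0) :
      Enc t N (2 * S.maxRank + 3) c u (.node (encBot e nc) Fin.elim0)
  | copy (N c : ℕ) (u : Address) (a : S.Sym) (s : (encAlphabet e nc).Tree)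
      (ha : t.label? u = some a) (hc : c ≠ 0) (h : Enc t (N - 1) 1 c u s) :
      Enc t N (2 * S.maxRank + 3) c u s

variable {e nc} {t : S.Tree}

theorem encChild_le {m r j d c x : ℕ} (hr : r ≤ m) (hc : c ≤ nc) (hx : x < 1 + r + nc) :
    (encChild m r j d c x).1 ≤ 2 * m + 3 ∧ (encChild m r j d c x).2 ≤ nc := by
  unfold encChild
  split_ifs <;> simp only <;> omega

/-- Each constructor of `Enc` is one rule of the transducer; the depth `N` merely restricts when the
cutting rule is used. -/
theorem Enc.gen {N x c : ℕ} {u : Address} {s : (encAlphabet e nc).Tree} (h : Enc e nc t N x c u s)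
    (hc : c ≤ nc) : (encTT e nc).Gen t (fun _ => True) ⟨encState S.maxRank nc x c, u, []⟩ s := by
  have hb : ∀ {u : Address} {x : Fin 0 ⊕ Fin 0}, x ∈ (∅ : Finset (Fin 0 ⊕ Fin 0)) ↔
      Observable u [] x := by simp [observable_nil]
  induction h with
  | node N d c u a ch hd ha h ih =>
    have hj := RankedAlphabet.Tree.childNo_le ha
    refine .out (encRule e nc a u.childNo d c) _ (encSym e nc a u.childNo d c) _ _
      (mem_encTT.2 ⟨a, u.childNo, d, c, hj, by omega, hc, rfl⟩)
      ⟨?_, ha, rfl, fun _ => hb⟩ (by simp only [encRule, encRhs, if_pos hd]) trivial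
      fun y => ih y (encChild_le (S.rank_le_maxRank a) hc ?_).2
    · simp only [encRule, Nat.min_eq_left (show d ≤ 2 * S.maxRank + 3 by omega)]
    · rw [← rank_encSym hj hd hc]; exact y.isLt
  | up N c i u a s ha h ih =>
    have hj : i ≤ S.maxRank := RankedAlphabet.Tree.childNo_le ha
    obtain ⟨b, -, h1, h2⟩ := RankedAlphabet.Tree.label?_cons ha
    refine .act (encRule e nc a i (S.maxRank + 2) c) _ (encState S.maxRank nc (i + 1) c) .up _ _ _
      (mem_encTT.2 ⟨a, i, _, c, hj, by omega, hc, rfl⟩)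
      ⟨?_, ha, rfl, fun _ => hb⟩ ?_ (.up _ _ _) trivial (ih hc)
    · simp only [encRule, Nat.min_eq_left (show S.maxRank + 2 ≤ 2 * S.maxRank + 3 by omega)]
    · simp only [encRule, encRhs]
      rw [if_neg (by omega), if_pos ⟨by trivial, by omega⟩]
  | down N c i u a s ha h1 hi h ih =>
    have hj := RankedAlphabet.Tree.childNo_le ha
    have hm := S.rank_le_maxRank a
    refine .act (encRule e nc a u.childNo (S.maxRank + 2 + i) c) _ (encState S.maxRank nc 0 c)
      (.down i) _ _ _ (mem_encTT.2 ⟨a, u.childNo, _, c, hj, by omega, hc, rfl⟩)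
      ⟨?_, ha, rfl, fun _ => hb⟩ ?_ (.down _ _ _) trivial (ih hc)
    · simp only [encRule, Nat.min_eq_left (show S.maxRank + 2 + i ≤ 2 * S.maxRank + 3 by omega)]
    · simp only [encRule, encRhs]
      rw [if_neg (by omega), if_neg (by omega), if_pos ⟨by omega, by omega⟩]
      simp
  | bot N c u a ha h =>
    have hj := RankedAlphabet.Tree.childNo_le ha
    have hm := S.rank_le_maxRank a
    refine .out (encRule e nc a u.childNo (2 * S.maxRank + 3) c) _ (encBot e nc)
      (fun _ => encState S.maxRank nc 0 0) _ (mem_encTT.2 ⟨a, u.childNo, _, c, hj, by omega, hc, rfl⟩)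
      ⟨?_, ha, rfl, fun _ => hb⟩ ?_ trivial fun y => Fin.elim0 y
    · simp only [encRule, Nat.min_self]
    · simp only [encRule, encRhs]
      rw [if_neg (by omega), if_neg (by omega), if_neg (by omega), if_pos trivial]
  | copy N c u a s ha hc0 h ih =>
    have hj := RankedAlphabet.Tree.childNo_le ha
    have hm := S.rank_le_maxRank a
    refine .act (encRule e nc a u.childNo (2 * S.maxRank + 4) c) _ (encState S.maxRank nc 1 c)
      .stay _ _ _ (mem_encTT.2 ⟨a, u.childNo, _, c, hj, by omega, hc, rfl⟩)
      ⟨?_, ha, rfl, fun _ => hb⟩ ?_ (.stay _ _) trivial (ih hc)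
    · simp only [encRule, Nat.min_eq_right (show 2 * S.maxRank + 3 ≤ 2 * S.maxRank + 4 by omega)]
    · simp only [encRule, encRhs]
      rw [if_neg (by omega), if_neg (by omega), if_neg (by omega), if_neg (by omega),
        if_pos ⟨by trivial, hc0⟩]

theorem encRule_rel {a : S.Sym} {j x c x' c' : ℕ} {u : Address} {π : Stack (Fin 0) (Fin 0)}
    (hc : c ≤ nc) (hx' : x' ≤ 2 * S.maxRank + 3) (hc' : c' ≤ nc)
    (h : (encRule e nc a j x c).Relevant t ⟨encState S.maxRank nc x' c', u, π⟩) :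
    min x (2 * S.maxRank + 3) = x' ∧ c = c' ∧ t.label? u = some a ∧ u.childNo = j := by
  obtain ⟨h1, h2, h3, -⟩ := h
  obtain ⟨h4, h5⟩ := encState_inj (by omega) hc hx' hc' h1
  exact ⟨h4, h5, h2, h3⟩

/-- Every rule that is not a self-loop corresponds to a constructor of `Enc`, and self-loops are
skipped. Depth `0` allows cuts everywhere, so nothing has to be known about the choices of the
transducer. -/
theorem enc_of_gen {c : Config (Fin (encStates S.maxRank nc)) (Fin 0) (Fin 0)}
    {s : (encAlphabet e nc).Tree} (h : (encTT e nc).Gen t (fun _ => True) c s) {x' c' : ℕ}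
    (hx' : x' ≤ 2 * S.maxRank + 3) (hc' : c' ≤ nc) (hs : c.state = encState S.maxRank nc x' c') :
    Enc e nc t 0 x' c' c.pos s := by
  induction h generalizing x' c' with
  | act r cc q α u π s mem rel rhs eff _ _ ih =>
    obtain ⟨cq, cu, cπ⟩ := cc
    simp only at hs eff ⊢
    subst hs
    obtain ⟨a, j, x, c, hj, hx, hc, rfl⟩ := mem_encTT.1 mem
    obtain ⟨rfl, rfl, ha, hju⟩ := encRule_rel hc hx' hc' rel
    have hm := S.rank_le_maxRank a
    simp only [encRule, encRhs] at rhs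
    split_ifs at rhs with h1 h2 h3 h4 h5
    · injection rhs with h h'
      subst h h'
      cases eff with
      | up i u =>
        have : i = j := hju
        subst this
        rw [Nat.min_eq_left (by omega), h2.1]
        exact .up _ _ _ _ _ _ ha (ih (by omega) hc rfl)
    · injection rhs with h h'
      subst h h'
      cases eff with
      | down =>
        rw [Nat.min_eq_left (by omega), show x = S.maxRank + 2 + (x - (S.maxRank + 2)) by omega]
        exact .down _ _ _ _ _ _ ha (by omega) (by omega) (ih (by omega) hc (by simp))
    · injection rhs with h h'
      subst h h'
      cases eff with
      | stay =>
        rw [Nat.min_eq_right (by omega)]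
        exact .copy _ _ _ _ _ ha h5.2 (ih (by omega) hc rfl)
    · injection rhs with h h'
      subst h h'
      cases eff with
      | stay => exact ih (by omega) hc rfl
  | out r cc d qs ch mem rel rhs _ _ ih =>
    obtain ⟨cq, cu, cπ⟩ := cc
    simp only at hs ⊢
    subst hs
    obtain ⟨a, j, x, c, hj, hx, hc, rfl⟩ := mem_encTT.1 mem
    obtain ⟨rfl, rfl, ha, hju⟩ := encRule_rel hc hx' hc' rel
    have hm := S.rank_le_maxRank a
    subst hju
    simp only [encRule, encRhs] at rhs
    split_ifs at rhs with h1 h2 h3 h4 h5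
    · injection rhs with h h'
      subst h
      cases h'
      rw [Nat.min_eq_left (by omega)]
      refine .node _ _ _ _ _ _ h1 ha fun y => ?_
      have hy := encChild_le (nc := nc) (j := cu.childNo) (d := x) (x := y) hm hc
        (by rw [← rank_encSym (e := e) hj h1 hc]; exact y.isLt)
      exact ih y hy.1 hy.2 rfl
    · injection rhs with h h'
      subst h
      rw [Nat.min_eq_right (by omega)]
      have : ch = Fin.elim0 := funext fun y => Fin.elim0 y
      rw [this]
      exact .bot _ _ _ _ ha (.inr rfl)

theorem encTT_transduction {s : (encAlphabet e nc).Tree} :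
    (t, s) ∈ (encTT e nc).transduction ↔ Enc e nc t 0 1 0 [] s := by
  rw [PTT.mem_transduction]
  constructor
  · rintro ⟨q, hq, h⟩
    exact enc_of_gen h (by omega) (by omega) (Finset.mem_singleton.1 hq)
  · intro h
    exact ⟨_, Finset.mem_singleton_self _, h.gen (by omega)⟩

/-- The depth only forbids cuts. Forgetting it turns a tree that is deep enough for a given
computation into an output of the encoding transducer. -/
theorem Enc.zero {N x c : ℕ} {u : Address} {s : (encAlphabet e nc).Tree}
    (h : Enc e nc t N x c u s) : Enc e nc t 0 x c u s := by
  induction h with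
  | node N d c u a ch hd ha h ih => exact .node _ _ _ _ _ _ hd ha ih
  | up N c i u a s ha h ih => exact .up _ _ _ _ _ _ ha ih
  | down N c i u a s ha h1 hi h ih => exact .down _ _ _ _ _ _ ha h1 hi ih
  | bot N c u a ha h => exact .bot _ _ _ _ ha (.inr rfl)
  | copy N c u a s ha hc h ih => exact .copy _ _ _ _ _ ha hc ih

/-- It suffices to supply trees for the neighbours of `u` and for the copies at `u`. For `d = 0` the
parent is where the branch came from, so no tree is needed there and the recursion can terminate. -/
theorem Enc.exists_node {N d c : ℕ} {u : Address} {a : S.Sym} (hd : d ≤ S.maxRank + 1)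
    (ha : t.label? u = some a)
    (h1 : d ≠ 0 → ∀ i u', u = i :: u' → ∃ s, Enc e nc t N (i + 1) c u' s)
    (h2 : ∀ i, 1 ≤ i → i ≤ S.rank a → ∃ s, Enc e nc t N 0 c (i :: u) s)
    (h3 : ∀ c', ∃ s, Enc e nc t N (2 * S.maxRank + 3) c' u s) :
    ∃ s, Enc e nc t N d c u s := by
  have h : ∀ x : ℕ, ∃ s, Enc e nc t N (encChild S.maxRank (S.rank a) u.childNo d c x).1
      (encChild S.maxRank (S.rank a) u.childNo d c x).2 u s := by
    intro x
    unfold encChild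
    split_ifs with hx hj hr hx
    · exact h3 0
    · push Not at hj
      cases u with
      | nil => exact absurd rfl hj.1
      | cons i u =>
        obtain ⟨s, hs⟩ := h1 hj.2 i u rfl
        exact ⟨s, .up _ _ _ _ _ _ ha hs⟩
    · exact h3 0
    · obtain ⟨s, hs⟩ := h2 x (by omega) hr
      exact ⟨s, .down _ _ _ _ _ _ ha (by omega) hr hs⟩
    · exact h3 _
  choose ch hch using h
  exact ⟨_, .node N d c u a (fun x => ch x) hd ha fun x => hch x⟩

/-- A single copy is a re-rooted finite tree. Branches with direction `0` only lead downwards and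
are built by induction on subtrees; a branch that leads upwards shortens the address, and at each of
its nodes further downward branches start. -/
theorem Enc.exists_of_copies {N : ℕ} (h3 : ∀ (u : Address) (a : S.Sym), t.label? u = some a →
    ∀ c, ∃ s, Enc e nc t N (2 * S.maxRank + 3) c u s) {u : Address} {a : S.Sym}
    (ha : t.label? u = some a) {d : ℕ} (hd : d ≤ S.maxRank + 1) (c : ℕ) :
    ∃ s, Enc e nc t N d c u s := by
  have h0 : ∀ (s₀ : S.Tree) (u : Address), t.subtree? u = some s₀ → ∃ s, Enc e nc t N 0 c u s := by
    intro s₀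
    induction s₀ with
    | node a ch ih =>
      intro u hu
      have ha : t.label? u = some a := RankedAlphabet.Tree.label?_eq_some.2 ⟨_, hu⟩
      refine Enc.exists_node (by omega) ha (fun h => absurd rfl h) (fun i h1 hi => ?_) (h3 u a ha)
      refine ih ⟨i - 1, by omega⟩ (i :: u) ?_
      rw [RankedAlphabet.Tree.subtree?_cons, hu, Option.bind_some, RankedAlphabet.Tree.child?_node,
        dif_pos ⟨h1, hi⟩]
  have h2 : ∀ (u : Address) (a : S.Sym), t.label? u = some a → ∀ i, 1 ≤ i → i ≤ S.rank a →
      ∃ s, Enc e nc t N 0 c (i :: u) s := by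
    intro u a ha i h1 hi
    obtain ⟨b, hb⟩ := RankedAlphabet.Tree.exists_label?_cons ha h1 hi
    obtain ⟨ch, hb⟩ := RankedAlphabet.Tree.label?_eq_some.1 hb
    exact h0 _ _ hb
  induction u generalizing a d with
  | nil => exact Enc.exists_node hd ha (fun _ i u' h => by simp at h) (h2 _ _ ha) (h3 _ _ ha)
  | cons i u ih =>
    obtain ⟨b, hb, h1, hi⟩ := RankedAlphabet.Tree.label?_cons ha
    have hm := S.rank_le_maxRank b
    refine Enc.exists_node hd ha (fun _ i' u' h => ?_) (h2 _ _ ha) (h3 _ _ ha)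
    obtain ⟨rfl, rfl⟩ := List.cons.inj h
    exact ih hb (by omega)

theorem Enc.exists (N : ℕ) {u : Address} {a : S.Sym} (ha : t.label? u = some a) {d : ℕ}
    (hd : d ≤ S.maxRank + 1) (c : ℕ) : ∃ s, Enc e nc t N d c u s := by
  induction N generalizing u a d c with
  | zero => exact Enc.exists_of_copies (fun u a ha c => ⟨_, .bot _ _ _ _ ha (.inr rfl)⟩) ha hd c
  | succ N ih =>
    refine Enc.exists_of_copies (fun u a ha c => ?_) ha hd c
    by_cases hc : c = 0
    -- Colour `0` belongs to the branches that would lead back towards the pebble; they are cut at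
    -- every depth.
    · exact ⟨_, .bot _ _ _ _ ha (.inl hc)⟩
    · obtain ⟨s, hs⟩ := ih ha (d := 1) (by omega) c
      exact ⟨s, .copy _ _ _ _ _ ha hc hs⟩

end Encoding

end PebbleTree

namespace PebbleTree

/-! ### Positions in encoded trees -/

section Positions

variable {S : RankedAlphabet} {v i : ℕ}

/-- The number of a colour. -/
def colNo : Fin v ⊕ Fin i → ℕ
  | .inl x => 1 + x
  | .inr x => 1 + v + x

theorem colNo_pos (c : Fin v ⊕ Fin i) : 1 ≤ colNo c := by
  cases c <;> simp only [colNo] <;> omega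

theorem colNo_le (c : Fin v ⊕ Fin i) : colNo c ≤ v + i := by
  cases c <;> simp only [colNo] <;> omega

theorem colNo_inj {c c' : Fin v ⊕ Fin i} (h : colNo c = colNo c') : c = c' := by
  rcases c with c | c <;> rcases c' with c' | c' <;> simp only [colNo] at h
  · rw [Fin.ext (show (c : ℕ) = c' by omega)]
  · omega
  · omega
  · rw [Fin.ext (show (c : ℕ) = c' by omega)]

/-- The number of the colour of the topmost pebble; `0` if there is none. -/
def topColNo : Stack (Fin v) (Fin i) → ℕ
  | [] => 0
  | p :: _ => colNo p.2

theorem topColNo_le (π : Stack (Fin v) (Fin i)) : topColNo π ≤ v + i := by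
  cases π with
  | nil => exact Nat.zero_le _
  | cons p π => exact colNo_le p.2

/-- The position of the topmost pebble; the root if there is none. -/
def topPos : Stack (Fin v) (Fin i) → Address
  | [] => []
  | p :: _ => p.1

/-- The node `w` of the encoded tree represents the node `u` of `t` and the pebble stack `π`, and
its direction is `d`. -/
inductive Pos (t : S.Tree) : Address → Address → ℕ → Stack (Fin v) (Fin i) → Prop where
  | root : Pos t [] [] 1 []
  | up (w : Address) (j : ℕ) (u : Address) (d : ℕ) (π : Stack (Fin v) (Fin i))
      (h : Pos t w (j :: u) d π) (hd : d ≠ 0) : Pos t (1 :: w) u (j + 1) π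
  | down (w u : Address) (d j : ℕ) (a : S.Sym) (π : Stack (Fin v) (Fin i))
      (h : Pos t w u d π) (ha : t.label? u = some a) (h1 : 1 ≤ j) (hj : j ≤ S.rank a)
      (hd : d ≠ j + 1) : Pos t ((1 + j) :: w) (j :: u) 0 π
  | copy (w u : Address) (d : ℕ) (a : S.Sym) (c : Fin v ⊕ Fin i) (π : Stack (Fin v) (Fin i))
      (h : Pos t w u d π) (ha : t.label? u = some a) :
      Pos t ((1 + S.rank a + colNo c) :: w) u 1 ((u, c) :: π)

variable {t : S.Tree} {w w' u u' : Address} {d d' : ℕ} {π π' : Stack (Fin v) (Fin i)}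

theorem Pos.exists_label (h : Pos t w u d π) : ∃ a, t.label? u = some a := by
  induction h with
  | root => exact ⟨_, rfl⟩
  | up w j u d π h hd ih =>
    obtain ⟨a, ha⟩ := ih
    obtain ⟨b, hb, -⟩ := RankedAlphabet.Tree.label?_cons ha
    exact ⟨b, hb⟩
  | down w u d j a π h ha h1 hj hd ih => exact RankedAlphabet.Tree.exists_label?_cons ha h1 hj
  | copy w u d a c π h ha ih => exact ⟨a, ha⟩

/-- The meaning of directions. -/
def IsDirection (d : ℕ) (u p : Address) : Prop :=
  (d = 1 ∧ u = p) ∨ (d = 0 ∧ ¬ u <:+ p) ∨ ∃ j, 1 ≤ j ∧ d = j + 1 ∧ (j :: u) <:+ p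

theorem suffix_of_cons_suffix {j : ℕ} {u p : Address} (h : (j :: u) <:+ p) : u <:+ p :=
  (List.suffix_cons j u).trans h

theorem cons_suffix_inj {j j' : ℕ} {u p : Address} (h : (j :: u) <:+ p) (h' : (j' :: u) <:+ p) :
    j = j' := by
  have := (List.suffix_of_suffix_length_le h h' (by simp)).eq_of_length (by simp)
  simpa using this

theorem not_cons_suffix {j : ℕ} {u : Address} : ¬ (j :: u) <:+ u := fun h => by
  simpa using h.length_le

/-- Addresses have their last step first, so the suffixes of `p` are the ancestors of `p` and `p`
itself. Either `u` is `p`, or it is no such ancestor, or it is a proper ancestor and the step from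
`u` towards `p` is determined. -/
theorem IsDirection.unique {p : Address} (h : IsDirection d u p) (h' : IsDirection d' u p) :
    d = d' := by
  obtain ⟨rfl, rfl⟩ | ⟨rfl, h⟩ | ⟨j, hj, rfl, h⟩ := h <;>
    obtain ⟨rfl, h''⟩ | ⟨rfl, h'⟩ | ⟨j', hj', rfl, h'⟩ := h'
  · rfl
  · exact absurd List.suffix_rfl h'
  · exact absurd h' not_cons_suffix
  · exact absurd (h'' ▸ List.suffix_rfl) h
  · rfl
  · exact absurd (suffix_of_cons_suffix h') h
  · exact absurd (h'' ▸ h) not_cons_suffix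
  · exact absurd (suffix_of_cons_suffix h) h'
  · rw [cons_suffix_inj h h']

/-- The side conditions of `Pos.up` and `Pos.down` say that the walk never turns back towards the
pebble. The recorded direction is therefore the geometric one and depends only on the node and the
topmost pebble. -/
theorem Pos.isDirection (h : Pos t w u d π) : IsDirection d u (topPos π) := by
  induction h with
  | root => exact .inl ⟨rfl, rfl⟩
  | up w j u d π h hd ih =>
    obtain ⟨a, ha⟩ := h.exists_label
    obtain ⟨b, hb, h1, -⟩ := RankedAlphabet.Tree.label?_cons ha
    refine .inr (.inr ⟨j, h1, rfl, ?_⟩)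
    obtain ⟨rfl, h'⟩ | ⟨rfl, -⟩ | ⟨j', -, -, h'⟩ := ih
    · rw [h']
    · exact absurd rfl hd
    · exact suffix_of_cons_suffix h'
  | down w u d j a π h ha h1 hj hd ih =>
    refine .inr (.inl ⟨rfl, fun h' => ?_⟩)
    obtain ⟨rfl, h''⟩ | ⟨rfl, h''⟩ | ⟨j', -, rfl, h''⟩ := ih
    · exact not_cons_suffix (h'' ▸ h')
    · exact h'' (suffix_of_cons_suffix h')
    · exact hd (by rw [cons_suffix_inj h' h''])
  | copy w u d a c π h ha ih => exact .inl ⟨rfl, rfl⟩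

theorem Pos.direction_unique (h : Pos t w u d π) (h' : Pos t w' u d' π) : d = d' :=
  h.isDirection.unique h'.isDirection

theorem Pos.eq_one_iff (h : Pos t w u d π) : d = 1 ↔ u = topPos π := by
  constructor
  · rintro rfl
    obtain ⟨-, h⟩ | ⟨h, -⟩ | ⟨j, hj, h, -⟩ := h.isDirection
    · exact h
    · omega
    · omega
  · intro hu
    exact h.isDirection.unique (.inl ⟨rfl, hu⟩)

theorem Pos.direction_le (h : Pos t w u d π) : d ≤ S.maxRank + 1 := by
  cases h with
  | root => omega
  | up w j u d π h hd =>
    obtain ⟨a, ha⟩ := h.exists_label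
    have := RankedAlphabet.Tree.childNo_le ha
    have hj : Address.childNo (j :: u) = j := rfl
    omega
  | down => omega
  | copy => omega

/-- Inversion for direction `0`. -/
theorem Pos.parent (h : Pos t w u 0 π) :
    ∃ j w' u' d', u = j :: u' ∧ w = (1 + j) :: w' ∧ Pos t w' u' d' π := by
  cases h with
  | down w u d j a π h ha h1 hj hd => exact ⟨j, w, u, d, rfl, rfl, h⟩

/-- Inversion for directions greater than `1`. -/
theorem Pos.child {j : ℕ} (h : Pos t w u (j + 1) π) (hj : 1 ≤ j) :
    ∃ w' d', w = 1 :: w' ∧ Pos t w' (j :: u) d' π := by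
  generalize hd : j + 1 = d at h
  cases h with
  | root => omega
  | up w j' u d π h hd' =>
    obtain rfl : j = j' := by omega
    exact ⟨w, d, rfl, h⟩
  | down => omega
  | copy => omega

/-- Inversion for direction `1`. -/
theorem Pos.beneath {p : Address} {c : Fin v ⊕ Fin i} (h : Pos t w u 1 ((p, c) :: π)) :
    u = p ∧ ∃ x w' d', w = x :: w' ∧ Pos t w' u d' π := by
  generalize hd : 1 = d at h
  cases h with
  | up w j u d π h hd' =>
    -- Child numbers of nodes other than the root start at `1`, so a step to the parent in `t`
    -- yields a direction of at least `2`.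
    obtain ⟨a, ha⟩ := h.exists_label
    obtain ⟨b, -, h1, -⟩ := RankedAlphabet.Tree.label?_cons ha
    omega
  | down => omega
  | copy w u d a c π h ha => exact ⟨rfl, _, w, d, rfl, h⟩

/-- The direction is determined by the node and the stack, and it tells which constructor of `Pos`
came last. Hence the last step of the address is determined, and the rest follows by induction. -/
theorem Pos.unique (h : Pos t w u d π) (h' : Pos t w' u d' π) : w = w' := by
  induction h generalizing w' d' with
  | root =>
    have hd := h'.isDirection.unique (.inl ⟨rfl, rfl⟩)
    cases h' with
    | root => rfl
    | up w j u d π h hd' =>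
      obtain ⟨a, ha⟩ := h.exists_label
      obtain ⟨b, -, h1, -⟩ := RankedAlphabet.Tree.label?_cons ha
      omega
  | up w j u d π h hd ih =>
    have hd' := (Pos.up _ _ _ _ _ h hd).direction_unique h'
    obtain ⟨a, ha⟩ := h.exists_label
    obtain ⟨b, -, h1, -⟩ := RankedAlphabet.Tree.label?_cons ha
    subst hd'
    obtain ⟨w'', d'', rfl, h''⟩ := h'.child h1
    rw [ih h'']
  | down w u d j a π h ha h1 hj hd ih =>
    have hd' := (Pos.down _ _ _ _ _ _ h ha h1 hj hd).direction_unique h'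
    subst hd'
    obtain ⟨j', w'', u'', d'', hu, rfl, h''⟩ := h'.parent
    obtain ⟨rfl, rfl⟩ := List.cons.inj hu
    rw [ih h'']
  | copy w u d a c π h ha ih =>
    have hd' := (Pos.copy _ _ _ _ c _ h ha).direction_unique h'
    subst hd'
    generalize hd : 1 = d at h'
    generalize hπ : (u, c) :: π = π' at h'
    cases h' with
    | root => simp at hπ
    | up w j u d π h hd' =>
      obtain ⟨a, ha⟩ := h.exists_label
      obtain ⟨b, -, h1, -⟩ := RankedAlphabet.Tree.label?_cons ha
      omega
    | down => omega
    | copy w u d a' c π h ha' =>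
      obtain ⟨hc, rfl⟩ := List.cons.inj hπ
      obtain ⟨-, rfl⟩ := Prod.mk.inj hc
      rw [ih h, Option.some.inj (ha.symm.trans ha')]

/-- The child number in the encoded tree reveals the last step: `1` for the parent, the next `S.rank
a` numbers for the children, and the larger ones for copies, from which the colour is recovered by
`colNo_inj`. -/
theorem Pos.node_unique (h : Pos t w u d π) (h' : Pos t w u' d' π') :
    u = u' ∧ d = d' ∧ π = π' := by
  induction h generalizing u' d' π' with
  | root => cases h'; exact ⟨rfl, rfl, rfl⟩
  | up w j u d π h hd ih =>
    generalize hw : 1 :: w = w' at h'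
    cases h' with
    | root => simp at hw
    | up w' j' u' d' π' h' hd' =>
      obtain ⟨-, rfl⟩ := List.cons.inj hw
      obtain ⟨h1, rfl, rfl⟩ := ih h'
      obtain ⟨rfl, rfl⟩ := List.cons.inj h1
      exact ⟨rfl, rfl, rfl⟩
    | down w u d j a π h ha h1 hj hd =>
      have := (List.cons.inj hw).1; omega
    | copy w u d a c π h ha =>
      have := (List.cons.inj hw).1; have := colNo_pos c; omega
  | down w u d j a π h ha h1 hj hd ih =>
    generalize hw : (1 + j) :: w = w' at h'
    cases h' with
    | root => simp at hw
    | up w' j' u' d' π' h' hd' =>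
      have := (List.cons.inj hw).1; omega
    | down w' u' d' j' a' π' h' ha' h1' hj' hd' =>
      obtain ⟨hj'', rfl⟩ := List.cons.inj hw
      obtain ⟨rfl, rfl, rfl⟩ := ih h'
      obtain rfl : j = j' := by omega
      exact ⟨rfl, rfl, rfl⟩
    | copy w' u' d' a' c π' h' ha' =>
      obtain ⟨hj'', rfl⟩ := List.cons.inj hw
      obtain ⟨rfl, rfl, rfl⟩ := ih h'
      rw [ha] at ha'
      obtain rfl := Option.some.inj ha'
      have := colNo_pos c; omega
  | copy w u d a c π h ha ih =>
    generalize hw : (1 + S.rank a + colNo c) :: w = w' at h'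
    have hc := colNo_pos c
    cases h' with
    | root => simp at hw
    | up w' j' u' d' π' h' hd' =>
      have := (List.cons.inj hw).1; omega
    | down w' u' d' j' a' π' h' ha' h1' hj' hd' =>
      obtain ⟨hj'', rfl⟩ := List.cons.inj hw
      obtain ⟨rfl, rfl, rfl⟩ := ih h'
      rw [ha] at ha'
      obtain rfl := Option.some.inj ha'
      omega
    | copy w' u' d' a' c' π' h' ha' =>
      obtain ⟨hj'', rfl⟩ := List.cons.inj hw
      obtain ⟨rfl, rfl, rfl⟩ := ih h'
      rw [ha] at ha'
      obtain rfl := Option.some.inj ha'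
      obtain rfl := colNo_inj (show colNo c = colNo c' by omega)
      exact ⟨rfl, rfl, rfl⟩

/-- The child numbers in encoded trees. -/
def encChildNo (r j d c : ℕ) : ℕ :=
  if d = 0 then 1 + j else if d = 1 then if c = 0 then 0 else 1 + r + c else 1

/-- Rules test child numbers, so those of encoded nodes must be predictable. Here they follow from
the information in the label. -/
theorem Pos.childNo (h : Pos t w u d π) {a : S.Sym} (ha : t.label? u = some a) :
    w.childNo = encChildNo (S.rank a) u.childNo d (topColNo π) := by
  cases h with
  | root => rfl
  | up w j u d π h hd =>
    obtain ⟨a, ha⟩ := h.exists_label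
    obtain ⟨b, -, h1, -⟩ := RankedAlphabet.Tree.label?_cons ha
    rw [encChildNo, if_neg (by omega), if_neg (by omega)]; rfl
  | down => rfl
  | copy w u d a' c π h ha' =>
    have hc := colNo_pos c
    rw [ha'] at ha
    obtain rfl := Option.some.inj ha
    rw [encChildNo, if_neg (by omega), if_pos rfl, topColNo, if_neg (by simp only; omega)]; rfl

end Positions

/-! ### Labels of encoded trees -/

section Labels

variable {S : RankedAlphabet} {n nc : ℕ} {e : S.Sym ≃ Fin n} {t : S.Tree}

theorem Enc.eq_node {N d c : ℕ} {u : Address} {s : (encAlphabet e nc).Tree}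
    (h : Enc e nc t N d c u s) (hd : d ≤ S.maxRank + 1) :
    ∃ a ch, t.label? u = some a ∧ s = .node (encSym e nc a u.childNo d c) ch ∧
      ∀ x : Fin _, Enc e nc t N (encChild S.maxRank (S.rank a) u.childNo d c x).1
        (encChild S.maxRank (S.rank a) u.childNo d c x).2 u (ch x) := by
  cases h with
  | node N d c u a ch hd ha h => exact ⟨a, ch, ha, rfl, h⟩
  | up => omega
  | down => omega
  | bot => omega
  | copy => omega

theorem Enc.of_up {N c j : ℕ} {u : Address} {s : (encAlphabet e nc).Tree}
    (h : Enc e nc t N (S.maxRank + 2) c (j :: u) s) : Enc e nc t N (j + 1) c u s := by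
  generalize hx : S.maxRank + 2 = x at h
  generalize hu : j :: u = u' at h
  cases h with
  | node => omega
  | up N c i u a s ha h => obtain ⟨rfl, rfl⟩ := List.cons.inj hu; exact h
  | down => omega
  | bot => omega
  | copy => omega

theorem Enc.of_down {N c j : ℕ} {u : Address} {s : (encAlphabet e nc).Tree} (h1 : 1 ≤ j)
    (hj : j ≤ S.maxRank) (h : Enc e nc t N (S.maxRank + 2 + j) c u s) :
    Enc e nc t N 0 c (j :: u) s := by
  generalize hx : S.maxRank + 2 + j = x at h
  cases h with
  | node => omega
  | up => omega
  | down N c i u a s ha h1 hi h =>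
    obtain rfl : j = i := by omega
    exact h
  | bot => omega
  | copy => omega

theorem Enc.of_copy {N c : ℕ} {u : Address} {s : (encAlphabet e nc).Tree} (hc : c ≠ 0)
    (h : Enc e nc t N (2 * S.maxRank + 3) c u s) :
    (Enc e nc t (N - 1) 1 c u s) ∨ N = 0 ∧ s.rootLabel = encBot e nc := by
  generalize hx : 2 * S.maxRank + 3 = x at h
  cases h with
  | node => omega
  | up => omega
  | down N c i u a s ha h1 hi h =>
    have := S.rank_le_maxRank a
    omega
  | bot N c u a ha h => exact .inr ⟨by tauto, rfl⟩
  | copy N c u a s ha hc h => exact .inl h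

variable {v i : ℕ} {w u : Address} {d : ℕ} {π : Stack (Fin v) (Fin i)}

/-- Each step of `Pos` follows a branch of the encoded tree that is not cut, unless it enters a copy
beyond the guaranteed depth. In the second alternative, `w` is a cut or is not a node at all. -/
theorem Enc.subtree? {N : ℕ} {t' : (encAlphabet e (v + i)).Tree}
    (h : Enc e (v + i) t N 1 0 [] t') (hw : Pos t w u d π) :
    (∃ s, t'.subtree? w = some s ∧ Enc e (v + i) t (N - π.length) d (topColNo π) u s) ∨
      N < π.length ∧ ∀ s, t'.subtree? w = some s → s.rootLabel = encBot e (v + i) := by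
  -- Nothing lies below a cut, because its symbol has rank `0`.
  have hbot : ∀ (w : Address) (j : ℕ),
      (∀ s, t'.subtree? w = some s → s.rootLabel = encBot e (v + i)) →
      ∀ s, t'.subtree? (j :: w) ≠ some s := by
    intro w j hw s hs
    rw [RankedAlphabet.Tree.subtree?_cons, Option.bind_eq_some_iff] at hs
    obtain ⟨s', hs', h⟩ := hs
    obtain ⟨a, ch⟩ := s'
    obtain rfl : a = encBot e (v + i) := hw _ hs'
    rw [RankedAlphabet.Tree.child?_node, dif_neg (by rw [rank_encBot]; omega)] at h
    simp at h
  have hchild : ∀ {w u : Address} {d : ℕ} {π : Stack (Fin v) (Fin i)} {s} (j : ℕ),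
      Pos t w u d π → t'.subtree? w = some s →
      Enc e (v + i) t (N - π.length) d (topColNo π) u s → 1 ≤ j → ∀ a, t.label? u = some a →
      j ≤ 1 + S.rank a + (v + i) → ∃ s', t'.subtree? (j :: w) = some s' ∧
      Enc e (v + i) t (N - π.length)
        (encChild S.maxRank (S.rank a) u.childNo d (topColNo π) (j - 1)).1
        (encChild S.maxRank (S.rank a) u.childNo d (topColNo π) (j - 1)).2 u s' := by
    intro w u d π s j hw hs henc h1 a ha hj
    obtain ⟨a', ch, ha', rfl, hch⟩ := henc.eq_node hw.direction_le
    rw [ha] at ha'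
    obtain rfl := Option.some.inj ha'
    have hj' : j - 1 < (encAlphabet e (v + i)).rank
        (encSym e (v + i) a u.childNo d (topColNo π)) := by
      rw [rank_encSym (RankedAlphabet.Tree.childNo_le ha) hw.direction_le (topColNo_le π)]
      omega
    refine ⟨_, ?_, hch ⟨j - 1, hj'⟩⟩
    · rw [RankedAlphabet.Tree.subtree?_cons, hs, Option.bind_some, RankedAlphabet.Tree.child?_node,
        dif_pos]
      rw [rank_encSym (RankedAlphabet.Tree.childNo_le ha) hw.direction_le (topColNo_le π)]
      omega
  induction hw with
  | root => exact .inl ⟨t', rfl, h⟩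
  | up w j u d π hw hd ih =>
    obtain ⟨a, ha⟩ := hw.exists_label
    obtain ⟨b, -, h1, -⟩ := RankedAlphabet.Tree.label?_cons ha
    obtain ⟨s, hs, henc⟩ | ⟨hN, hs⟩ := ih
    · obtain ⟨s', hs', h'⟩ := hchild 1 hw hs henc le_rfl a ha (by omega)
      have hj : Address.childNo (j :: u) = j := rfl
      rw [encChild, if_pos rfl, hj, if_neg (by omega)] at h'
      exact .inl ⟨s', hs', h'.of_up⟩
    · exact .inr ⟨hN, fun s h => absurd h (hbot _ _ hs s)⟩
  | down w u d j a π hw ha h1 hj hd ih =>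
    have hm := S.rank_le_maxRank a
    obtain ⟨s, hs, henc⟩ | ⟨hN, hs⟩ := ih
    · obtain ⟨s', hs', h'⟩ := hchild (1 + j) hw hs henc (by omega) a ha (by omega)
      rw [Nat.add_sub_cancel_left, encChild, if_neg (by omega), if_pos hj, if_neg hd] at h'
      exact .inl ⟨s', hs', h'.of_down h1 (by omega)⟩
    · exact .inr ⟨hN, fun s h => absurd h (hbot _ _ hs s)⟩
  | copy w u d a c π hw ha ih =>
    have hc := colNo_pos c
    have hc' := colNo_le c
    obtain ⟨s, hs, henc⟩ | ⟨hN, hs⟩ := ih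
    · obtain ⟨s', hs', h'⟩ := hchild (1 + S.rank a + colNo c) hw hs henc (by omega) a ha (by omega)
      rw [show 1 + S.rank a + colNo c - 1 = S.rank a + colNo c by omega, encChild,
        if_neg (by omega), if_neg (by omega), Nat.add_sub_cancel_left] at h'
      obtain h' | ⟨hN, hs''⟩ := h'.of_copy (by simp only; omega)
      · rw [Nat.sub_sub] at h'
        exact .inl ⟨s', hs', h'⟩
      · refine .inr ⟨by simp only [List.length_cons]; omega, fun s h => ?_⟩
        rwa [Option.some.inj (h.symm.trans hs')]
    · exact .inr ⟨by simp only [List.length_cons]; omega, fun s h => absurd h (hbot _ _ hs s)⟩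

/-- Used for soundness: a proper label excludes a cut, so no assumption on the depth is needed. -/
theorem Enc.label_eq {N : ℕ} {t' : (encAlphabet e (v + i)).Tree}
    (h : Enc e (v + i) t N 1 0 [] t') (hw : Pos t w u d π) {a : S.Sym} {j d' c' : ℕ}
    (hj : j ≤ S.maxRank) (hd' : d' ≤ S.maxRank + 1) (hc' : c' ≤ v + i)
    (hl : t'.label? w = some (encSym e (v + i) a j d' c')) :
    t.label? u = some a ∧ u.childNo = j ∧ d = d' ∧ topColNo π = c' := by
  obtain ⟨ch, hs'⟩ := RankedAlphabet.Tree.label?_eq_some.1 hl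
  obtain ⟨s, hs, henc⟩ | ⟨-, hs⟩ := h.subtree? hw
  · obtain ⟨a', ch', ha', rfl, -⟩ := henc.eq_node hw.direction_le
    rw [hs] at hs'
    have := (RankedAlphabet.Tree.node.inj (Option.some.inj hs')).1
    obtain ⟨rfl, rfl, rfl, rfl⟩ := encSym_inj (RankedAlphabet.Tree.childNo_le ha') hw.direction_le
      (topColNo_le π) hj hd' hc' this
    exact ⟨ha', rfl, rfl, rfl⟩
  · exact absurd (hs _ hs') (encSym_ne_encBot hj hd' hc')

/-- Used for completeness, where the depth rules out that the simulation runs into a cut. -/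
theorem Enc.label {N : ℕ} {t' : (encAlphabet e (v + i)).Tree}
    (h : Enc e (v + i) t N 1 0 [] t') (hw : Pos t w u d π) (hN : π.length ≤ N) {a : S.Sym}
    (ha : t.label? u = some a) :
    t'.label? w = some (encSym e (v + i) a u.childNo d (topColNo π)) := by
  obtain ⟨s, hs, henc⟩ | ⟨hN', -⟩ := h.subtree? hw
  · obtain ⟨a', ch, ha', rfl, -⟩ := henc.eq_node hw.direction_le
    rw [ha] at ha'
    obtain rfl := Option.some.inj ha'
    exact RankedAlphabet.Tree.label?_eq_some.2 ⟨_, hs⟩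
  · omega

end Labels

end PebbleTree

namespace PebbleTree

/-! ### The simulating transducer

It walks on an encoded tree. Pebbles are represented by the position in the encoded tree, as long as
there are no visible pebbles (colour number `0` or the number of an invisible colour). The first
visible pebble is also represented by the position; from then on the pebbles are dropped on the
encoded tree, above an additional invisible pebble. -/

section Simulation

variable {S D : RankedAlphabet} {ns n v i k : ℕ}

/-- The main states of the simulating transducer. -/
def mainState (q : Fin n) : Fin (3 * n) := ⟨q, by omega⟩

/-- The states in which the first visible pebble has been dropped. -/
def enterState (q : Fin n) : Fin (3 * n) := ⟨n + q, by omega⟩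

/-- The states in which the first visible pebble is about to be lifted. -/
def exitState (q : Fin n) : Fin (3 * n) := ⟨2 * n + q, by omega⟩

theorem mainState_inj {q q' : Fin n} : mainState q = mainState q' ↔ q = q' := by
  simp [mainState, Fin.ext_iff]

theorem enterState_inj {q q' : Fin n} : enterState q = enterState q' ↔ q = q' := by
  simp [enterState, Fin.ext_iff]

theorem exitState_inj {q q' : Fin n} : exitState q = exitState q' ↔ q = q' := by
  simp [exitState, Fin.ext_iff]

theorem mainState_ne_enterState {q q' : Fin n} : mainState q ≠ enterState q' := by
  simp only [mainState, enterState, ne_eq, Fin.mk.injEq]; omega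

theorem mainState_ne_exitState {q q' : Fin n} : mainState q ≠ exitState q' := by
  simp only [mainState, exitState, ne_eq, Fin.mk.injEq]; omega

theorem enterState_ne_exitState {q q' : Fin n} : enterState q ≠ exitState q' := by
  simp only [enterState, exitState, ne_eq, Fin.mk.injEq]; omega

/-- The colours of the simulating transducer. -/
def liftColour : Fin v ⊕ Fin i → Fin v ⊕ Fin (i + 1)
  | .inl y => .inl y
  | .inr y => .inr y.castSucc

theorem liftColour_inj {c c' : Fin v ⊕ Fin i} : liftColour c = liftColour c' ↔ c = c' := by
  rcases c with c | c <;> rcases c' with c' | c' <;> simp [liftColour]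

theorem liftColour_ne_last {c : Fin v ⊕ Fin i} : liftColour c ≠ .inr (Fin.last i) := by
  rcases c with c | c <;> simp [liftColour, (Fin.castSucc_lt_last _).ne]

/-- The colour number `c` belongs to a visible colour. -/
def IsVisibleNo (v c : ℕ) : Prop := 1 ≤ c ∧ c ≤ v

instance : Decidable (IsVisibleNo v c) := inferInstanceAs (Decidable (_ ∧ _))

/-- The sets of observable pebbles of the simulating transducer. Here `β = 1` if the additional
pebble is observable. -/
def simColours (b : Finset (Fin v ⊕ Fin i)) (c β : ℕ) : Finset (Fin v ⊕ Fin (i + 1)) :=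
  (Finset.univ.filter fun y : Fin v => IsVisibleNo v c ∧ .inl y ∈ b ∧ 1 + (y : ℕ) ≠ c).disjSum
    (Finset.univ.filter fun y : Fin (i + 1) =>
      IsVisibleNo v c ∧ if h : (y : ℕ) < i then .inr ⟨y, h⟩ ∈ b else β = 1)

/-- The set `b` of observable pebbles is compatible with direction, colour and observability of the
additional pebble. -/
def SimOK (k : ℕ) (b : Finset (Fin v ⊕ Fin i)) (d c β : ℕ) : Prop :=
  if IsVisibleNo v c then
    k ≠ 0 ∧ (∀ y : Fin v, 1 + (y : ℕ) = c → (.inl y ∈ b ↔ d = 1)) ∧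
      (β = 1 → d = 1 ∧ ∀ y, .inr y ∉ b) ∧ (simColours b c β).toLeft.card ≤ k - 1
  else β = 0 ∧ (∀ y, .inl y ∉ b) ∧ ∀ y : Fin i, .inr y ∈ b ↔ d = 1 ∧ c = 1 + v + y

instance {b : Finset (Fin v ⊕ Fin i)} {d c β : ℕ} : Decidable (SimOK k b d c β) := by
  unfold SimOK; infer_instance

/-- The simulation of an instruction; it is `none` if the instruction cannot be applied. The rank of
the input symbol is `r`. -/
def simAct (k r d c β : ℕ) (q : Fin n) :
    Instr (Fin v) (Fin i) → Option (Fin (3 * n) × Instr (Fin v) (Fin (i + 1)))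
  | .stay => some (mainState q, .stay)
  | .up => some (mainState q, if d = 0 then .up else .down 1)
  | .down j => some (mainState q, if d = j + 1 then .up else .down (1 + j))
  | .drop (.inl y) =>
    if IsVisibleNo v c then
      if 1 + (y : ℕ) = c then none else some (mainState q, .drop (.inl y))
    else if k = 0 then none else some (enterState q, .down (1 + r + (1 + y)))
  | .drop (.inr y) =>
    if IsVisibleNo v c then some (mainState q, .drop (.inr y.castSucc))
    else some (mainState q, .down (1 + r + (1 + v + y)))
  | .lift (.inl y) =>
    if IsVisibleNo v c then
      if 1 + (y : ℕ) = c then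
        if β = 1 then some (exitState q, .lift (.inr (Fin.last i))) else none
      else some (mainState q, .lift (.inl y))
    else none
  | .lift (.inr y) =>
    if IsVisibleNo v c then some (mainState q, .lift (.inr y.castSucc))
    else some (mainState q, .up)

/-- The simulation of the right-hand side of a rule. -/
def simRhs (k r d c β : ℕ) (q₀ : Fin n) :
    Rhs D (Fin n) (Fin v) (Fin i) → Rhs D (Fin (3 * n)) (Fin v) (Fin (i + 1))
  | .act q α =>
    match simAct k r d c β q α with
    | some (q', α') => .act q' α'
    | none => .act (mainState q₀) .stay
  | .out x qs => .out x fun y => mainState (qs y)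

variable (e : S.Sym ≃ Fin ns)

/-- The simulation of a rule. -/
def simRule (k : ℕ) (r : Rule S D (Fin n) (Fin v) (Fin i)) (d c β : ℕ) :
    Rule (encAlphabet e (v + i)) D (Fin (3 * n)) (Fin v) (Fin (i + 1)) where
  q := mainState r.q
  a := encSym e (v + i) r.a r.j d c
  j := encChildNo (S.rank r.a) r.j d c
  b := if SimOK k r.b d c β then simColours r.b c β else ∅
  rhs := if SimOK k r.b d c β then simRhs k (S.rank r.a) d c β r.q r.rhs
    else .act (mainState r.q) .stay

/-- The rule that drops the additional pebble. -/
def enterRule (a : S.Sym) (j : ℕ) (q : Fin n) (y : Fin v) :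
    Rule (encAlphabet e (v + i)) D (Fin (3 * n)) (Fin v) (Fin (i + 1)) where
  q := enterState q
  a := encSym e (v + i) a j 1 (1 + y)
  j := encChildNo (S.rank a) j 1 (1 + y)
  b := ∅
  rhs := .act (mainState q) (.drop (.inr (Fin.last i)))

/-- The rule that leaves the copy of the tree after the additional pebble has been lifted. -/
def exitRule (a : S.Sym) (j : ℕ) (q : Fin n) (y : Fin v) :
    Rule (encAlphabet e (v + i)) D (Fin (3 * n)) (Fin v) (Fin (i + 1)) where
  q := exitState q
  a := encSym e (v + i) a j 1 (1 + y)
  j := encChildNo (S.rank a) j 1 (1 + y)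
  b := ∅
  rhs := .act (mainState q) .up

variable {e}

theorem encChildNo_le {a : S.Sym} {j d c : ℕ} (hj : j ≤ S.maxRank) (hc : c ≤ v + i) :
    encChildNo (S.rank a) j d c ≤ (encAlphabet e (v + i)).maxRank := by
  have h := le_maxRank_encAlphabet (e := e) (nc := v + i) (a := a)
  have h' := S.rank_le_maxRank a
  unfold encChildNo
  split_ifs <;> omega

theorem mem_simColours_inl {b : Finset (Fin v ⊕ Fin i)} {c β : ℕ} {y : Fin v} :
    .inl y ∈ simColours b c β ↔ IsVisibleNo v c ∧ .inl y ∈ b ∧ 1 + (y : ℕ) ≠ c := by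
  simp [simColours]

theorem mem_simColours_inr {b : Finset (Fin v ⊕ Fin i)} {c β : ℕ} {y : Fin i} :
    .inr y.castSucc ∈ simColours b c β ↔ IsVisibleNo v c ∧ .inr y ∈ b := by
  simp [simColours]

theorem mem_simColours_last {b : Finset (Fin v ⊕ Fin i)} {c β : ℕ} :
    .inr (Fin.last i) ∈ simColours b c β ↔ IsVisibleNo v c ∧ β = 1 := by
  simp [simColours]

/-- `SimOK` excludes that the additional pebble is observable together with another invisible one:
only the topmost pebble can be observed if it is invisible. -/
theorem card_toRight_simColours {b : Finset (Fin v ⊕ Fin i)} {d c β : ℕ}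
    (h : SimOK k b d c β) (hb : b.toRight.card ≤ 1) : (simColours b c β).toRight.card ≤ 1 := by
  rw [Finset.card_le_one] at hb ⊢
  simp only [Finset.mem_toRight] at hb ⊢
  intro y hy y' hy'
  have key : ∀ y, .inr y ∈ simColours b c β → .inr (Fin.last i) ∈ simColours b c β →
      y = Fin.last i := by
    intro y hy hl
    induction y using Fin.lastCases with
    | last => rfl
    | cast y =>
      rw [mem_simColours_inr] at hy
      rw [mem_simColours_last] at hl
      rw [SimOK, if_pos hl.1] at h
      exact absurd hy.2 ((h.2.2.1 hl.2).2 y)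
  induction y using Fin.lastCases with
  | last => rw [key _ hy' hy]
  | cast y =>
    induction y' using Fin.lastCases with
    | last => rw [key _ hy hy']
    | cast y' =>
      rw [mem_simColours_inr] at hy hy'
      rw [hb y hy.2 y' hy'.2]

theorem allowed_simRhs {a : S.Sym} {j d c β : ℕ} (hj : j ≤ S.maxRank) (hd : d ≤ S.maxRank + 1)
    (hc : c ≤ v + i) {q : Fin n} {b : Finset (Fin v ⊕ Fin i)}
    {rhs : Rhs D (Fin n) (Fin v) (Fin i)} (h : rhs.Allowed S a j b) (hok : SimOK k b d c β) :
    (simRhs k (S.rank a) d c β q rhs).Allowed (encAlphabet e (v + i)) (encSym e (v + i) a j d c)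
      (encChildNo (S.rank a) j d c) (simColours b c β) := by
  have hr : (encRanks e (v + i)).get (encSym e (v + i) a j d c) = 1 + S.rank a + (v + i) :=
    rank_encSym hj hd hc
  rcases rhs with ⟨q, _ | _ | t | (y | y) | (y | y)⟩ | ⟨x, qs⟩
  · trivial
  · rw [simRhs, simAct]
    split_ifs with h0
    · simp only [Rhs.Allowed, encChildNo, if_pos h0]; omega
    · simp only [Rhs.Allowed, hr]; omega
  · simp only [Rhs.Allowed] at h
    rw [simRhs, simAct]
    split_ifs with h0
    · simp only [Rhs.Allowed]
      rw [encChildNo, if_neg (by omega), if_neg (by omega)]; omega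
    · simp only [Rhs.Allowed, hr]; omega
  · rw [simRhs, simAct]
    have := y.isLt
    split_ifs <;> simp only [Rhs.Allowed, hr] <;> omega
  · rw [simRhs, simAct]
    have := y.isLt
    split_ifs <;> simp only [Rhs.Allowed, hr] <;> omega
  · simp only [Rhs.Allowed] at h
    rw [simRhs, simAct]
    split_ifs with h1 h2 h3
    · exact mem_simColours_last.2 ⟨h1, h3⟩
    · trivial
    · exact mem_simColours_inl.2 ⟨h1, h, h2⟩
    · trivial
  · simp only [Rhs.Allowed] at h
    rw [simRhs, simAct]
    split_ifs with h1
    · exact mem_simColours_inr.2 ⟨h1, h⟩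
    -- In the nested mode a lift is a move up. Compatibility forces direction `1` and a nonzero
    -- colour number, so the encoded child number is not `0`.
    · rw [SimOK, if_neg h1] at hok
      obtain ⟨rfl, hc⟩ := (hok.2.2 y).1 h
      simp only [Rhs.Allowed]
      rw [encChildNo, if_neg (by omega), if_pos rfl, if_neg (by omega)]; omega
  · trivial

/-- The bound `k - 1` is a clause of `SimOK`. Incompatible combinations become self-loops without
pebbles, so a rule exists for every combination. -/
theorem simRule_wellFormed {r : Rule S D (Fin n) (Fin v) (Fin i)} (h : r.WellFormed k) {d c β : ℕ}
    (hd : d ≤ S.maxRank + 1) (hc : c ≤ v + i) : (simRule e k r d c β).WellFormed (k - 1) := by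
  obtain ⟨h1, h2, h3, h4⟩ := h
  refine ⟨encChildNo_le h1 hc, ?_⟩
  simp only [simRule]
  split_ifs with hok
  · refine ⟨?_, card_toRight_simColours hok h3, allowed_simRhs h1 hd hc h4 hok⟩
    by_cases hv : IsVisibleNo v c
    · rw [SimOK, if_pos hv] at hok
      exact hok.2.2.2
    · rw [Finset.card_eq_zero.2]
      · exact Nat.zero_le _
      · ext y; simp [Finset.mem_toLeft, mem_simColours_inl, hv]
  · refine ⟨?_, ?_, trivial⟩
    · rw [Finset.card_eq_zero.2 (by ext x; simp)]; exact Nat.zero_le _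
    · rw [Finset.card_eq_zero.2 (by ext x; simp)]; exact zero_le_one

theorem enterRule_wellFormed {a : S.Sym} {j k' : ℕ} (hj : j ≤ S.maxRank) (q : Fin n) (y : Fin v) :
    (enterRule e (D := D) (i := i) a j q y).WellFormed k' := by
  refine ⟨encChildNo_le (e := e) (a := a) (d := 1) (v := v) (i := i) (c := 1 + y) hj (by omega), ?_, ?_, trivial⟩
  · rw [Finset.card_eq_zero.2 (by ext x; simp [enterRule])]; exact Nat.zero_le _
  · rw [Finset.card_eq_zero.2 (by ext x; simp [enterRule])]; exact zero_le_one

theorem exitRule_wellFormed {a : S.Sym} {j k' : ℕ} (hj : j ≤ S.maxRank) (q : Fin n) (y : Fin v) :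
    (exitRule e (D := D) (i := i) a j q y).WellFormed k' := by
  refine ⟨encChildNo_le (e := e) (a := a) (d := 1) (v := v) (i := i) (c := 1 + y) hj (by omega), ?_, ?_, ?_⟩
  · rw [Finset.card_eq_zero.2 (by ext x; simp [exitRule])]; exact Nat.zero_le _
  · rw [Finset.card_eq_zero.2 (by ext x; simp [exitRule])]; exact zero_le_one
  · simp only [exitRule, Rhs.Allowed, encChildNo]
    rw [if_neg (by omega), if_pos trivial, if_neg (by omega)]; omega

variable (e)

/-- The simulating transducer. -/
def simPTT (M : PTT S D (Fin n) (Fin v) (Fin i) k) :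
    PTT (encAlphabet e (v + i)) D (Fin (3 * n)) (Fin v) (Fin (i + 1)) (k - 1) where
  init := M.init.map ⟨mainState, fun _ _ h => mainState_inj.1 h⟩
  rules := (M.rules.flatMap fun r => (List.range (S.maxRank + 2)).flatMap fun d =>
      (List.range (v + i + 1)).flatMap fun c => (List.range 2).map fun β => simRule e k r d c β) ++
    if k = 0 then [] else (List.finRange ns).flatMap fun a =>
      (List.range (S.maxRank + 1)).flatMap fun j => (List.finRange n).flatMap fun q =>
        (List.finRange v).flatMap fun y =>
          [enterRule e (e.symm a) j q y, exitRule e (e.symm a) j q y]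
  wellFormed := by
    intro r hr
    rw [List.mem_append] at hr
    obtain hr | hr := hr
    · simp only [List.mem_flatMap, List.mem_map, List.mem_range] at hr
      obtain ⟨r, hr', d, hd, c, hc, β, -, rfl⟩ := hr
      exact simRule_wellFormed (M.wellFormed r hr') (by omega) (by omega)
    · split_ifs at hr
      · simp at hr
      · simp only [List.mem_flatMap, List.mem_range, List.mem_cons, List.not_mem_nil, or_false] at hr
        obtain ⟨a, -, j, hj, q, -, y, -, rfl | rfl⟩ := hr
        · exact enterRule_wellFormed (by omega) _ _
        · exact exitRule_wellFormed (by omega) _ _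

variable {e}

theorem mem_simPTT {M : PTT S D (Fin n) (Fin v) (Fin i) k} {r'} :
    r' ∈ (simPTT e M).rules ↔
      (∃ r ∈ M.rules, ∃ d c β, d ≤ S.maxRank + 1 ∧ c ≤ v + i ∧ β ≤ 1 ∧ r' = simRule e k r d c β) ∨
      k ≠ 0 ∧ ∃ a j q y, j ≤ S.maxRank ∧ (r' = enterRule e a j q y ∨ r' = exitRule e a j q y) := by
  simp only [simPTT, List.mem_append]
  refine or_congr ?_ ?_
  · simp only [List.mem_flatMap, List.mem_map, List.mem_range]
    constructor
    · rintro ⟨r, hr', d, hd, c, hc, β, hβ, rfl⟩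
      exact ⟨r, hr', d, c, β, by omega, by omega, by omega, rfl⟩
    · rintro ⟨r, hr', d, c, β, hd, hc, hβ, rfl⟩
      exact ⟨r, hr', d, by omega, c, by omega, β, by omega, rfl⟩
  · split_ifs with hk
    · simp [hk]
    · simp only [List.mem_flatMap, List.mem_range, List.mem_cons, List.not_mem_nil, or_false,
        List.mem_finRange, true_and]
      constructor
      · rintro ⟨a, j, hj, q, y, h⟩
        exact ⟨hk, e.symm a, j, q, y, by omega, h⟩
      · rintro ⟨-, a, j, q, y, hj, h⟩
        exact ⟨e a, j, by omega, q, y, by simpa using h⟩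

/-- For `k = 0`, `SimOK` fails at every visible colour number. In the remaining nested mode an
invisible pebble is dropped by descending, and a visible one cannot be dropped. -/
theorem simPTT_rhs_ne_drop (M : PTT S D (Fin n) (Fin v) (Fin i) k) (hk : k = 0) :
    ∀ r ∈ (simPTT e M).rules, ∀ q c, r.rhs ≠ .act q (.drop c) := by
  intro r' hr' q' c'
  obtain ⟨r, hr, d, c, β, -, -, -, rfl⟩ | ⟨h, -⟩ := mem_simPTT.1 hr'
  · simp only [simRule]
    split_ifs with hok
    · have hv : ¬ IsVisibleNo v c := by
        intro hv
        rw [SimOK, if_pos hv] at hok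
        exact hok.1 hk
      rcases r.rhs with ⟨q, _ | _ | t | (y | y) | (y | y)⟩ | ⟨x, qs⟩ <;>
        simp only [simRhs, simAct, if_neg hv, if_pos hk] <;> (try split_ifs) <;> simp
    · simp
  · exact absurd hk h

end Simulation

end PebbleTree

/-! ### The simulation relation and observable pebbles -/

namespace PebbleTree

section SimulationRelation

variable {S : RankedAlphabet} {n v i k : ℕ}

/-- The simulating transducer at node `w` with stack `π'` represents the node `u` and the stack `π`;
direction and colour number at `w` are `d` and `c`, and `β = 1` if the additional pebble is
observable. -/
inductive SimPos (t : S.Tree) (k : ℕ) (w u : Address) (d : ℕ) : ℕ → ℕ →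
    Stack (Fin v) (Fin i) → Stack (Fin v) (Fin (i + 1)) → Prop where
  | nested (π : Stack (Fin v) (Fin i)) (h : Pos t w u d π)
      (hπ : ∀ p ∈ π, ∀ y, p.2 ≠ .inl y) : SimPos t k w u d (topColNo π) 0 π []
  | real (β : ℕ) (p wp : Address) (x : Fin v) (lo : Stack (Fin v) (Fin i))
      (ps : List (Address × Address × (Fin v ⊕ Fin i))) (h : Pos t w u d ((p, .inl x) :: lo))
      (hb : Pos t wp p 1 ((p, .inl x) :: lo)) (hlo : ∀ p ∈ lo, ∀ y, p.2 ≠ .inl y)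
      (hps : ∀ y ∈ ps, ∃ d, Pos t y.1 y.2.1 d ((p, .inl x) :: lo))
      (fresh : ∀ y ∈ ps, y.2.2 ≠ .inl x) (few : ps.countP (fun y => y.2.2.isLeft) ≤ k - 1)
      (hk : k ≠ 0) (hβ : β ≤ 1) (hβ' : β = 1 ↔ ps = [] ∧ d = 1) :
      SimPos t k w u d (1 + x) β (ps.map (fun y => y.2) ++ (p, .inl x) :: lo)
        (ps.map (fun y => (y.1, liftColour y.2.2)) ++ [(wp, .inr (Fin.last i))])

/-- The simulation relation between configurations. -/
inductive SimRel (t : S.Tree) (k : ℕ) : Config (Fin n) (Fin v) (Fin i) →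
    Config (Fin (3 * n)) (Fin v) (Fin (i + 1)) → Prop where
  | main (q : Fin n) (w u : Address) (d c β : ℕ) (π : Stack (Fin v) (Fin i))
      (π' : Stack (Fin v) (Fin (i + 1))) (h : SimPos t k w u d c β π π') :
      SimRel t k ⟨q, u, π⟩ ⟨mainState q, w, π'⟩
  | enter (q : Fin n) (w p : Address) (x : Fin v) (lo : Stack (Fin v) (Fin i))
      (h : Pos t w p 1 ((p, .inl x) :: lo)) (hlo : ∀ p ∈ lo, ∀ y, p.2 ≠ .inl y) (hk : k ≠ 0) :
      SimRel t k ⟨q, p, (p, .inl x) :: lo⟩ ⟨enterState q, w, []⟩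
  | exit (q : Fin n) (w p : Address) (x : Fin v) (lo : Stack (Fin v) (Fin i))
      (h : Pos t w p 1 ((p, .inl x) :: lo)) (hlo : ∀ p ∈ lo, ∀ y, p.2 ≠ .inl y) (hk : k ≠ 0) :
      SimRel t k ⟨q, p, lo⟩ ⟨exitState q, w, []⟩

variable {t : S.Tree} {w u : Address} {d c β : ℕ} {π : Stack (Fin v) (Fin i)}
  {π' : Stack (Fin v) (Fin (i + 1))}

/-- The position of the simulating transducer encodes part of the stack. -/
theorem SimPos.pos (h : SimPos t k w u d c β π π') :
    ∃ π₀ : Stack (Fin v) (Fin i), Pos t w u d π₀ ∧ topColNo π₀ = c ∧ π₀.length ≤ π.length ∧ β ≤ 1 := by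
  cases h with
  | nested _ h hπ => exact ⟨_, h, rfl, le_rfl, zero_le_one⟩
  | real _ p wp x lo ps h hb hlo hps fresh few hk hβ hβ' =>
    exact ⟨_, h, rfl, by simp, hβ⟩

theorem SimPos.enter {p : Address} {x : Fin v} {lo : Stack (Fin v) (Fin i)}
    (h : Pos t w p 1 ((p, .inl x) :: lo)) (hlo : ∀ p ∈ lo, ∀ y, p.2 ≠ .inl y) (hk : k ≠ 0) :
    SimPos t k w p 1 (1 + x) 1 ((p, .inl x) :: lo) [(w, .inr (Fin.last i))] :=
  .real 1 p w x lo [] h h hlo (by simp) (by simp) (by simp) hk le_rfl (by simp)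

theorem isVisibleNo_topColNo (hπ : ∀ p ∈ π, ∀ y, p.2 ≠ .inl y) : ¬ IsVisibleNo v (topColNo π) := by
  rintro ⟨h1, h2⟩
  rcases π with _ | ⟨⟨p, y | y⟩, π⟩
  · simp [topColNo] at h1
  · exact hπ _ List.mem_cons_self y rfl
  · simp only [topColNo, colNo] at h2; omega

theorem isVisibleNo_add (x : Fin v) : IsVisibleNo v (1 + x) := ⟨by omega, by omega⟩

/-- Direction `1` says that the topmost pebble is here, and the colour number says which one it is.
-/
theorem Pos.head_eq_iff (h : Pos t w u d π) {y : Fin i} :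
    π.head? = some (u, .inr y) ↔ d = 1 ∧ topColNo π = 1 + v + y := by
  rw [h.eq_one_iff]
  rcases π with _ | ⟨⟨p, z⟩, π⟩
  · simp only [List.head?_nil, reduceCtorEq, topColNo, false_iff]; omega
  · simp only [List.head?_cons, Option.some.injEq, Prod.mk.injEq, topColNo, topPos,
      show 1 + v + (y : ℕ) = colNo (.inr y : Fin v ⊕ Fin i) from rfl]
    constructor
    · rintro ⟨rfl, rfl⟩; exact ⟨rfl, rfl⟩
    · rintro ⟨rfl, h'⟩; exact ⟨rfl, colNo_inj h'⟩

theorem card_toLeft_le {b : Finset (Fin v ⊕ Fin i)} {w : Address} {π : Stack (Fin v) (Fin i)}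
    (h : ∀ y, .inl y ∈ b → (w, .inl y) ∈ π) :
    b.toLeft.card ≤ π.countP (fun p => p.2.isLeft) := by
  have h1 : b.toLeft ⊆ (π.filterMap fun p => p.2.getLeft?).toFinset := by
    intro y hy
    rw [List.mem_toFinset, List.mem_filterMap]
    exact ⟨_, h y (Finset.mem_toLeft.1 hy), rfl⟩
  refine (Finset.card_le_card h1).trans ((List.toFinset_card_le _).trans (le_of_eq ?_))
  clear h h1
  induction π with
  | nil => rfl
  | cons p π ih =>
    obtain ⟨p, y | y⟩ := p <;> simp [List.filterMap_cons, List.countP_cons, ih]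

/-- This justifies the translation of left-hand sides. In the nested mode everything observable can
be read off direction and colour. In the real mode the first visible pebble is read off the
direction, the others lie on the encoded tree at corresponding nodes, and those beneath the first
visible pebble are invisible and not topmost. -/
theorem SimPos.observable_iff (h : SimPos t k w u d c β π π') {b : Finset (Fin v ⊕ Fin i)} :
    (∀ x, x ∈ b ↔ Observable u π x) ↔
      SimOK k b d c β ∧ ∀ x, x ∈ (if SimOK k b d c β then simColours b c β else ∅) ↔
        Observable w π' x := by
  cases h with
  | nested _ h hπ =>
    have hv := isVisibleNo_topColNo hπ
    have h1 : (∀ x, x ∈ b ↔ Observable u π x) ↔ SimOK k b d (topColNo π) 0 := by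
      rw [SimOK, if_neg hv]
      constructor
      · intro h'
        refine ⟨rfl, fun y hy => ?_, fun y => ?_⟩
        · exact hπ _ ((h' _).1 hy) y rfl
        · rw [h', Observable, h.head_eq_iff]
      · rintro ⟨-, h1, h2⟩ (y | y)
        · exact iff_of_false (h1 y) fun h' => hπ _ h' y rfl
        · rw [h2, Observable, h.head_eq_iff]
    rw [h1, iff_self_and]
    intro hok x
    rw [if_pos hok]
    refine iff_of_false ?_ observable_nil
    rcases x with y | y
    · simp [mem_simColours_inl, hv]
    · induction y using Fin.lastCases with
      | last => simp [mem_simColours_last, hv]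
      | cast y => simp [mem_simColours_inr, hv]
  | real _ p wp x lo ps h hb hlo hps fresh few hk hβ hβ' =>
    have hv := isVisibleNo_add x
    -- Within one copy, encoded nodes and nodes of `t` correspond bijectively, so a pebble is at the
    -- encoded head exactly if its counterpart is at the head.
    have hpos : ∀ y ∈ ps, y.1 = w ↔ y.2.1 = u := by
      intro y hy
      obtain ⟨d', hd'⟩ := hps y hy
      constructor
      · intro h'; exact ((h' ▸ hd').node_unique h).1
      · intro h'; exact (h' ▸ hd').unique h
    have hd : d = 1 ↔ u = p := h.eq_one_iff
    have hwp : wp = w ↔ u = p := by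
      constructor
      · intro h'; exact (h.node_unique (h' ▸ hb)).1
      · intro h'; exact hb.unique (h' ▸ h)
    have hps' : ∀ c, (w, liftColour c) ∈ ps.map (fun y => (y.1, liftColour y.2.2)) ↔
        (u, c) ∈ ps.map fun y => y.2 := by
      intro c
      simp only [List.mem_map, Prod.mk.injEq, liftColour_inj]
      constructor
      · rintro ⟨y, hy, h1, rfl⟩
        exact ⟨y, hy, Prod.ext ((hpos y hy).1 h1) rfl⟩
      · rintro ⟨y, hy, h1⟩
        exact ⟨y, hy, (hpos y hy).2 (by rw [h1]), by rw [h1]⟩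
    have ol : ∀ y : Fin v, y ≠ x → (Observable u (ps.map (fun y => y.2) ++ (p, .inl x) :: lo)
        (.inl y) ↔ Observable w (ps.map (fun y => (y.1, liftColour y.2.2)) ++
          [(wp, (.inr (Fin.last i) : Fin v ⊕ Fin (i + 1)))]) (.inl y)) := by
      intro y hy
      have := hps' (.inl y)
      rw [liftColour] at this
      simp only [Observable, List.mem_append, this]
      refine or_congr_right (iff_of_false ?_ (by simp))
      simp only [List.mem_cons, Prod.mk.injEq, Sum.inl.injEq, hy, and_false, false_or]
      exact fun h => hlo _ h y rfl
    have ox : Observable u (ps.map (fun y => y.2) ++ (p, .inl x) :: lo) (.inl x) ↔ d = 1 := by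
      rw [hd]
      simp only [Observable, List.mem_append, List.mem_cons, Prod.mk.injEq, and_true, List.mem_map]
      constructor
      · rintro (⟨y, hy, h'⟩ | h' | h')
        · exact absurd (congrArg Prod.snd h') (fresh y hy)
        · exact h'
        · exact absurd rfl (hlo _ h' x)
      · intro h'; exact .inr (.inl h')
    -- The first visible pebble is never dropped on the encoded tree, and by freshness no other
    -- pebble has its colour.
    have ox' : ¬ Observable w (ps.map (fun y => (y.1, liftColour y.2.2)) ++
          [(wp, (.inr (Fin.last i) : Fin v ⊕ Fin (i + 1)))]) (.inl x) := by
      simp only [Observable, List.mem_append, List.mem_map, List.mem_singleton, Prod.mk.injEq,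
        reduceCtorEq, and_false, or_false]
      rintro ⟨y, hy, -, h'⟩
      exact fresh y hy (liftColour_inj.1 h')
    have or' : ∀ y : Fin i, Observable u (ps.map (fun y => y.2) ++ (p, .inl x) :: lo) (.inr y) ↔
        Observable w (ps.map (fun y => (y.1, liftColour y.2.2)) ++
          [(wp, (.inr (Fin.last i) : Fin v ⊕ Fin (i + 1)))]) (.inr y.castSucc) := by
      intro y
      rcases ps with _ | ⟨z, ps⟩
      · simp [Observable, (Fin.castSucc_lt_last _).ne']
      · have h1 : (.inr y.castSucc : Fin v ⊕ Fin (i + 1)) = liftColour (.inr y) := rfl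
        simp only [Observable, List.map_cons, List.cons_append, List.head?_cons, Option.some.injEq,
          Prod.mk.injEq, h1, liftColour_inj, hpos z List.mem_cons_self]
        exact ⟨fun h => by simp [h], fun h => Prod.ext h.1 h.2⟩
    have olast : Observable w (ps.map (fun y => (y.1, liftColour y.2.2)) ++
          [(wp, (.inr (Fin.last i) : Fin v ⊕ Fin (i + 1)))]) (.inr (Fin.last i)) ↔ β = 1 := by
      rw [hβ', hd, ← hwp]
      rcases ps with _ | ⟨z, ps⟩
      · simp [Observable]
      · simp [Observable, liftColour_ne_last]
    constructor
    · intro h'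
      have hobs : ∀ z, z ∈ simColours b (1 + x) β ↔ Observable w (ps.map
          (fun y => (y.1, liftColour y.2.2)) ++ [(wp, (.inr (Fin.last i)))]) z := by
        rintro (y | y)
        · rw [mem_simColours_inl]
          by_cases hy : y = x
          · subst hy
            exact iff_of_false (by simp) ox'
          · rw [← ol y hy, h']
            have : (y : ℕ) ≠ x := fun h => hy (Fin.ext h)
            simp only [hv, true_and, and_iff_left_iff_imp]
            intro _; omega
        · induction y using Fin.lastCases with
          | last => rw [mem_simColours_last, olast]; simp [hv]
          | cast y => rw [mem_simColours_inr, ← or' y, h']; simp [hv]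
      have hok : SimOK k b d (1 + x) β := by
        rw [SimOK, if_pos hv]
        refine ⟨hk, fun y hy => ?_, fun hβ => ?_, ?_⟩
        · obtain rfl : y = x := Fin.ext (by omega)
          rw [h', ox]
        · obtain ⟨rfl, hd1⟩ := hβ'.1 hβ
          refine ⟨hd1, fun y => ?_⟩
          rw [h']
          simp [Observable]
        -- The visible colours that remain are observed on real pebbles, of which at most `k - 1`
        -- are visible.
        · refine le_trans (card_toLeft_le (fun y hy => (hobs _).1 hy)) ?_
          rw [List.countP_append, List.countP_map]
          simp only [List.countP_cons, List.countP_nil, Sum.isLeft_inr]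
          refine le_trans (le_of_eq ?_) few
          simp only [Bool.false_eq_true, if_false, add_zero]
          congr 1
          funext y
          rcases hy : y.2.2 with z | z <;> simp [hy, liftColour]
      exact ⟨hok, by rw [if_pos hok]; exact hobs⟩
    · rintro ⟨hok, hobs⟩
      rw [if_pos hok] at hobs
      rw [SimOK, if_pos hv] at hok
      rintro (y | y)
      · by_cases hy : y = x
        · subst hy
          rw [ox]; exact hok.2.1 y rfl
        · rw [ol y hy, ← hobs, mem_simColours_inl]
          have : (y : ℕ) ≠ x := fun h => hy (Fin.ext h)
          simp only [hv, true_and, iff_self_and]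
          intro _; omega
      · rw [or' y, ← hobs, mem_simColours_inr]; simp [hv]

/-- In a simulating rule, `β'` is a guess. In the nested mode it must be `0`, and in the real mode
the tested colours include the additional pebble exactly if the guess is `1`, so a relevant rule has
guessed correctly. -/
theorem SimPos.eq_of_observable (h : SimPos t k w u d c β π π') {b : Finset (Fin v ⊕ Fin i)}
    {β' : ℕ} (hβ : β' ≤ 1) (hok : SimOK k b d c β')
    (hb : ∀ x, x ∈ simColours b c β' ↔ Observable w π' x) : β' = β := by
  cases h with
  | nested _ h hπ =>
    rw [SimOK, if_neg (isVisibleNo_topColNo hπ)] at hok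
    exact hok.1
  | real _ p wp x lo ps h hb' hlo hps fresh few hk hβ₁ hβ' =>
    have hv := isVisibleNo_add x
    have hd : d = 1 ↔ u = p := h.eq_one_iff
    have hwp : wp = w ↔ u = p := by
      constructor
      · intro h'; exact (h.node_unique (h' ▸ hb')).1
      · intro h'; exact hb'.unique (h' ▸ h)
    have h1 := hb (.inr (Fin.last i))
    rw [mem_simColours_last] at h1
    have h2 : β' = 1 ↔ β = 1 := by
      rw [hβ', hd, ← hwp]
      simp only [hv, true_and] at h1
      rw [h1]
      rcases ps with _ | ⟨z, ps⟩
      · simp [Observable]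
      · simp [Observable, liftColour_ne_last]
    omega

end SimulationRelation

end PebbleTree

/-! ### Simulation of single instructions -/

namespace PebbleTree

section SimulationSteps

variable {S : RankedAlphabet} {n v i k : ℕ} {t : S.Tree} {w u : Address} {d c β : ℕ}
  {π : Stack (Fin v) (Fin i)} {π' : Stack (Fin v) (Fin (i + 1))}

/-- Moving within a copy changes neither stack nor colour; only the observability of the additional
pebble has to be determined anew. -/
theorem SimPos.move (h : SimPos t k w u d c β π π') :
    ∃ π₀ : Stack (Fin v) (Fin i), Pos t w u d π₀ ∧ ∀ w₂ u₂ d₂, Pos t w₂ u₂ d₂ π₀ →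
      ∃ β₂, SimPos t k w₂ u₂ d₂ c β₂ π π' := by
  cases h with
  | nested _ h hπ => exact ⟨π, h, fun w₂ u₂ d₂ h₂ => ⟨0, .nested _ h₂ hπ⟩⟩
  | real _ p wp x lo ps h hb hlo hps fresh few hk hβ hβ' =>
    refine ⟨_, h, fun w₂ u₂ d₂ h₂ => ⟨if ps = [] ∧ d₂ = 1 then 1 else 0,
      .real _ p wp x lo ps h₂ hb hlo hps fresh few hk ?_ ?_⟩⟩ <;> split_ifs <;> simp [*]

/-- The additional pebble is now covered, whence the `0`. The colour must differ from that of the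
first visible pebble, which is on the simulated stack but not on the real one. -/
theorem SimPos.push_real (h : SimPos t k w u d c β π π') (hc : IsVisibleNo v c)
    {cc : Fin v ⊕ Fin i} (hcc : colNo cc ≠ c)
    (hk : π'.countP (fun p => p.2.isLeft) + (if cc.isLeft then 1 else 0) ≤ k - 1) :
    SimPos t k w u d c 0 ((u, cc) :: π) ((w, liftColour cc) :: π') := by
  cases h with
  | nested _ h hπ => exact absurd hc (isVisibleNo_topColNo hπ)
  | real _ p wp x lo ps h hb hlo hps fresh few hk' hβ hβ' =>
    refine .real 0 p wp x lo ((w, u, cc) :: ps) h hb hlo ?_ ?_ ?_ hk' (by omega) (by simp)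
    · rintro y hy
      rcases List.mem_cons.1 hy with rfl | hy
      · exact ⟨d, h⟩
      · exact hps y hy
    · rintro y hy
      rcases List.mem_cons.1 hy with rfl | hy
      · rintro rfl; exact hcc rfl
      · exact fresh y hy
    · rw [List.countP_cons]
      refine le_trans (le_of_eq ?_) hk
      rw [List.countP_append, List.countP_map, List.countP_singleton]
      simp only [Sum.isLeft_inr, Bool.false_eq_true, if_false, add_zero]
      congr 2
      funext y
      rcases hy : y.2.2 with z | z <;> simp [hy, liftColour]

/-- The difference of one is the first visible pebble; it reconciles the bound `k` of the given
transducer with the bound `k - 1` of the simulating one. -/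
theorem SimPos.countP (h : SimPos t k w u d c β π π') (hc : IsVisibleNo v c) :
    k ≠ 0 ∧ π.countP (fun p => p.2.isLeft) = π'.countP (fun p => p.2.isLeft) + 1 ∧
      π'.countP (fun p => p.2.isLeft) ≤ k - 1 := by
  cases h with
  | nested _ h hπ => exact absurd hc (isVisibleNo_topColNo hπ)
  | real _ p wp x lo ps h hb hlo hps fresh few hk' hβ hβ' =>
    have h0 : lo.countP (fun p => p.2.isLeft) = 0 := by
      rw [List.countP_eq_zero]
      intro p hp
      rcases hy : p.2 with z | z
      · exact absurd hy (hlo p hp z)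
      · simp
    have h1 : (ps.map fun y => (y.1, liftColour y.2.2)).countP (fun p => p.2.isLeft) =
        ps.countP (fun y => y.2.2.isLeft) := by
      rw [List.countP_map]
      congr 1
      funext y
      rcases hy : y.2.2 with z | z <;> simp [hy, liftColour]
    have h2 : (ps.map fun y => y.2).countP (fun p => p.2.isLeft) =
        ps.countP (fun y => y.2.2.isLeft) := by
      rw [List.countP_map]; rfl
    simp only [List.countP_append, List.countP_cons, List.countP_nil, h0, h1, h2,
      Sum.isLeft_inl, Sum.isLeft_inr, Bool.false_eq_true, if_false, if_true, add_zero, zero_add]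
    exact ⟨hk', trivial, few⟩

theorem SimPos.fresh_iff (h : SimPos t k w u d c β π π') (hc : IsVisibleNo v c) {y : Fin v} :
    (∀ p ∈ π, p.2 ≠ .inl y) ↔ 1 + (y : ℕ) ≠ c ∧ ∀ p ∈ π', p.2 ≠ .inl y := by
  cases h with
  | nested _ h hπ => exact absurd hc (isVisibleNo_topColNo hπ)
  | real _ p wp x lo ps h hb hlo hps fresh few hk' hβ hβ' =>
    constructor
    · intro h'
      refine ⟨fun hy => ?_, fun z hz hzy => ?_⟩
      · obtain rfl : y = x := Fin.ext (by omega)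
        exact h' _ (List.mem_append_right _ List.mem_cons_self) rfl
      · rcases List.mem_append.1 hz with hz | hz
        · obtain ⟨z, hz', rfl⟩ := List.mem_map.1 hz
          refine h' z.2 (List.mem_append_left _ (List.mem_map_of_mem hz')) ?_
          exact liftColour_inj.1 (hzy.trans (rfl : (.inl y : Fin v ⊕ Fin (i + 1)) = liftColour (.inl y)))
        · rw [List.mem_singleton.1 hz] at hzy
          simp at hzy
    · rintro ⟨h1, h2⟩ z hz hzy
      rcases List.mem_append.1 hz with hz | hz
      · obtain ⟨z, hz', rfl⟩ := List.mem_map.1 hz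
        refine h2 (z.1, liftColour z.2.2) (List.mem_append_left _ (List.mem_map.2 ⟨z, hz', rfl⟩)) ?_
        rw [hzy]; rfl
      · rcases List.mem_cons.1 hz with rfl | hz
        · simp only [Sum.inl.injEq] at hzy
          subst hzy
          exact h1 rfl
        · exact hlo z hz y hzy

theorem SimPos.pop_real (h : SimPos t k w u d c β π π') (hc : IsVisibleNo v c)
    {cc : Fin v ⊕ Fin i} {π₂' : Stack (Fin v) (Fin (i + 1))} (hπ : π' = (w, liftColour cc) :: π₂') :
    ∃ π₂ β₂, π = (u, cc) :: π₂ ∧ SimPos t k w u d c β₂ π₂ π₂' := by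
  cases h with
  | nested _ h hπ' => exact absurd hc (isVisibleNo_topColNo hπ')
  | real _ p wp x lo ps h hb hlo hps fresh few hk' hβ hβ' =>
    rcases ps with _ | ⟨⟨zw, zu, zc⟩, ps⟩
    -- If nothing covers the additional pebble, it is the topmost one, but its colour is not a
    -- translated colour.
    · have := (Prod.mk.inj (List.cons.inj hπ).1).2
      exact absurd this.symm liftColour_ne_last
    · obtain ⟨h1, rfl⟩ := List.cons.inj hπ
      obtain ⟨rfl, h2⟩ := Prod.mk.inj h1
      obtain rfl := liftColour_inj.1 h2
      obtain ⟨d', hd'⟩ := hps _ List.mem_cons_self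
      obtain ⟨rfl, -⟩ := hd'.node_unique h
      refine ⟨_, if ps = [] ∧ d = 1 then 1 else 0, rfl, .real _ p wp x lo ps h hb hlo
        (fun y hy => hps y (List.mem_cons_of_mem _ hy))
        (fun y hy => fresh y (List.mem_cons_of_mem _ hy))
        (le_trans (by rw [List.countP_cons]; exact Nat.le_add_right _ _) few) hk' ?_ ?_⟩ <;>
        split_ifs <;> simp [*]

theorem SimPos.pop_real' (h : SimPos t k w u d c β π π') (hc : IsVisibleNo v c)
    {cc : Fin v ⊕ Fin i} {π₂ : Stack (Fin v) (Fin i)} (hπ : π = (u, cc) :: π₂)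
    (hcc : colNo cc ≠ c) : ∃ π₂', π' = (w, liftColour cc) :: π₂' := by
  cases h with
  | nested _ h hπ' => exact absurd hc (isVisibleNo_topColNo hπ')
  | real _ p wp x lo ps h hb hlo hps fresh few hk' hβ hβ' =>
    rcases ps with _ | ⟨⟨zw, zu, zc⟩, ps⟩
    · have := (Prod.mk.inj (List.cons.inj hπ).1).2
      subst this
      exact absurd rfl hcc
    · obtain ⟨h1, rfl⟩ := List.cons.inj hπ
      obtain ⟨rfl, rfl⟩ := Prod.mk.inj h1
      obtain ⟨d', hd'⟩ := hps _ List.mem_cons_self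
      obtain rfl := hd'.unique h
      exact ⟨_, rfl⟩

/-- The rule sees `β = 1`, the given transducer sees its first visible pebble on top at the head;
both mean that no pebble lies above it and that the head is at the root of its copy. -/
theorem SimPos.bottom (h : SimPos t k w u d c β π π') {x : Fin v} (hc : 1 + (x : ℕ) = c)
    {q : Fin n} (h' : β = 1 ∨ ∃ π₂, π = (u, .inl x) :: π₂) :
    β = 1 ∧ π' = [(w, .inr (Fin.last i))] ∧ ∃ π₂, π = (u, .inl x) :: π₂ ∧
      SimRel t k ⟨q, u, π₂⟩ ⟨exitState q, w, []⟩ := by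
  have hv : IsVisibleNo v c := hc ▸ isVisibleNo_add x
  cases h with
  | nested _ h hπ => exact absurd hv (isVisibleNo_topColNo hπ)
  | real _ p wp x' lo ps h hb hlo hps fresh few hk' hβ hβ' =>
    obtain rfl : x = x' := Fin.ext (by omega)
    have hps' : ps = [] ∧ u = p := by
      rcases h' with h' | ⟨π₂, h'⟩
      · obtain ⟨rfl, hd⟩ := hβ'.1 h'
        exact ⟨rfl, h.eq_one_iff.1 hd⟩
      · rcases ps with _ | ⟨z, ps⟩
        · exact ⟨rfl, ((Prod.mk.inj (List.cons.inj h').1).1).symm⟩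
        · exact absurd (congrArg Prod.snd (List.cons.inj h').1) (fresh z List.mem_cons_self)
    obtain ⟨rfl, rfl⟩ := hps'
    have hd : d = 1 := h.eq_one_iff.2 rfl
    subst hd
    obtain rfl := hb.unique h
    exact ⟨hβ'.2 ⟨rfl, rfl⟩, rfl, lo, rfl, .exit q _ _ x lo h hlo hk'⟩

theorem SimPos.nested_of_not (h : SimPos t k w u d c β π π') (hc : ¬ IsVisibleNo v c) :
    c = topColNo π ∧ β = 0 ∧ π' = [] ∧ Pos t w u d π ∧ ∀ p ∈ π, ∀ y, p.2 ≠ .inl y := by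
  cases h with
  | nested _ h hπ => exact ⟨rfl, rfl, rfl, h, hπ⟩
  | real _ p wp x lo ps h hb hlo hps fresh few hk' hβ hβ' => exact absurd (isVisibleNo_add x) hc

/-- The syntactic restrictions on rules are used here: an encoded node always has a child for the
parent, and a move up need not be a lift, so the real effect alone does not show that the given
instruction applies. -/
theorem SimPos.simAct_sound {D : RankedAlphabet} (h : SimPos t k w u d c β π π') {a : S.Sym}
    (ha : t.label? u = some a) {b : Finset (Fin v ⊕ Fin i)} (hb : ∀ x, x ∈ b ↔ Observable u π x)
    {q : Fin n} {α : Instr (Fin v) (Fin i)}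
    (hα : (.act q α : Rhs D (Fin n) (Fin v) (Fin i)).Allowed S a u.childNo b) {q' : Fin (3 * n)}
    {α' : Instr (Fin v) (Fin (i + 1))} (hs : simAct k (S.rank a) d c β q α = some (q', α'))
    {w₂ : Address} {π₂' : Stack (Fin v) (Fin (i + 1))} (heff : α'.Effect (k - 1) w π' w₂ π₂') :
    ∃ u₂ π₂, α.Effect k u π u₂ π₂ ∧ SimRel t k ⟨q, u₂, π₂⟩ ⟨q', w₂, π₂'⟩ := by
  obtain ⟨π₀, hpos, hmove⟩ := h.move
  rcases α with _ | _ | j | (y | y) | (y | y)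
  · simp only [simAct, Option.some.injEq, Prod.mk.injEq] at hs
    obtain ⟨rfl, rfl⟩ := hs
    cases heff
    exact ⟨_, _, .stay _ _, .main _ _ _ _ _ _ _ _ h⟩
  · simp only [simAct, Option.some.injEq, Prod.mk.injEq] at hs
    obtain ⟨rfl, rfl⟩ := hs
    split_ifs at heff with hd
    · subst hd
      obtain ⟨j, w', u', d', rfl, rfl, h'⟩ := hpos.parent
      cases heff
      obtain ⟨β₂, h₂⟩ := hmove _ _ _ h'
      exact ⟨_, _, .up _ _ _, .main _ _ _ _ _ _ _ _ h₂⟩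
    · simp only [Rhs.Allowed] at hα
      -- The rule cannot be relevant at the root of `t`, where the branch for the parent is a cut.
      rcases u with _ | ⟨j, u⟩
      · exact absurd rfl hα
      · cases heff
        obtain ⟨β₂, h₂⟩ := hmove _ _ _ (.up _ _ _ _ _ hpos hd)
        exact ⟨_, _, .up _ _ _, .main _ _ _ _ _ _ _ _ h₂⟩
  · simp only [simAct, Option.some.injEq, Prod.mk.injEq] at hs
    simp only [Rhs.Allowed] at hα
    obtain ⟨rfl, rfl⟩ := hs
    split_ifs at heff with hd
    · subst hd
      obtain ⟨w', d', rfl, h'⟩ := hpos.child hα.1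
      cases heff
      obtain ⟨β₂, h₂⟩ := hmove _ _ _ h'
      exact ⟨_, _, .down _ _ _, .main _ _ _ _ _ _ _ _ h₂⟩
    · cases heff
      obtain ⟨β₂, h₂⟩ := hmove _ _ _ (.down _ _ _ _ _ _ hpos ha hα.1 hα.2 hd)
      exact ⟨_, _, .down _ _ _, .main _ _ _ _ _ _ _ _ h₂⟩
  · rw [simAct] at hs
    split_ifs at hs with hv hy hk
    · simp only [Option.some.injEq, Prod.mk.injEq] at hs
      obtain ⟨rfl, rfl⟩ := hs
      cases heff with
      | dropVisible _ _ _ fresh few =>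
        have hc := h.countP hv
        exact ⟨_, _, .dropVisible _ _ _ ((h.fresh_iff hv).2 ⟨hy, fresh⟩) (by omega),
          .main _ _ _ _ _ _ _ _ (h.push_real hv (cc := .inl y) hy (by simp; omega))⟩
    · simp only [Option.some.injEq, Prod.mk.injEq] at hs
      obtain ⟨rfl, rfl⟩ := hs
      obtain ⟨-, -, rfl, hpos, hπ⟩ := h.nested_of_not hv
      cases heff
      refine ⟨_, _, .dropVisible y _ _ (fun p hp => hπ p hp y) ?_, ?_⟩
      · rw [List.countP_eq_zero.2]
        · omega
        · intro p hp
          rcases hy : p.2 with z | z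
          · exact absurd hy (hπ p hp z)
          · simp
      · exact .enter _ _ _ _ _ (.copy _ _ _ _ (.inl y) _ hpos ha) hπ hk
  · rw [simAct] at hs
    split_ifs at hs with hv
    · simp only [Option.some.injEq, Prod.mk.injEq] at hs
      obtain ⟨rfl, rfl⟩ := hs
      cases heff
      have hc := h.countP hv
      have hv' := hv.2
      refine ⟨_, _, .dropInvisible _ _ _, .main _ _ _ _ _ _ _ _
        (h.push_real hv (cc := .inr y) ?_ ?_)⟩
      · simp only [colNo]; omega
      · simpa using hc.2.2
    · simp only [Option.some.injEq, Prod.mk.injEq] at hs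
      obtain ⟨rfl, rfl⟩ := hs
      obtain ⟨-, -, rfl, hpos, hπ⟩ := h.nested_of_not hv
      cases heff
      refine ⟨_, _, .dropInvisible _ _ _, .main _ _ _ _ _ _ _ _
        (.nested _ (.copy _ _ _ _ (.inr y) _ hpos ha) ?_)⟩
      intro p hp z
      rcases List.mem_cons.1 hp with rfl | hp
      · simp
      · exact hπ p hp z
  · rw [simAct] at hs
    split_ifs at hs with hv hy hβ
    · simp only [Option.some.injEq, Prod.mk.injEq] at hs
      obtain ⟨rfl, rfl⟩ := hs
      obtain ⟨-, rfl, π₂, rfl, hrel⟩ := h.bottom hy (q := q) (.inl hβ)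
      cases heff
      exact ⟨_, _, .lift _ _ _, hrel⟩
    · simp only [Option.some.injEq, Prod.mk.injEq] at hs
      obtain ⟨rfl, rfl⟩ := hs
      generalize hπ' : π' = π₁ at heff
      cases heff
      obtain ⟨π₂, β₂, rfl, h₂⟩ := h.pop_real hv (cc := .inl y) hπ'
      exact ⟨_, _, .lift _ _ _, .main _ _ _ _ _ _ _ _ h₂⟩
  · rw [simAct] at hs
    split_ifs at hs with hv
    · simp only [Option.some.injEq, Prod.mk.injEq] at hs
      obtain ⟨rfl, rfl⟩ := hs
      generalize hπ' : π' = π₁ at heff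
      cases heff
      obtain ⟨π₂, β₂, rfl, h₂⟩ := h.pop_real hv (cc := .inr y) hπ'
      exact ⟨_, _, .lift _ _ _, .main _ _ _ _ _ _ _ _ h₂⟩
    · simp only [Option.some.injEq, Prod.mk.injEq] at hs
      obtain ⟨rfl, rfl⟩ := hs
      obtain ⟨-, -, rfl, hpos, hπ⟩ := h.nested_of_not hv
      -- Since the colour is in `b`, the pebble to be lifted is on top and at the head. So the
      -- encoded node is the root of a copy, and ascending from it is the lift.
      have hobs := (hb _).1 hα
      rcases π with _ | ⟨p, π⟩
      · simp [Observable] at hobs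
      · simp only [Observable, List.head?_cons, Option.some.injEq] at hobs
        subst hobs
        obtain rfl := hpos.eq_one_iff.2 rfl
        obtain ⟨-, j, w', d', rfl, h'⟩ := hpos.beneath
        cases heff
        exact ⟨_, _, .lift _ _ _, .main _ _ _ _ _ _ _ _
          (.nested _ h' fun p hp => hπ p (List.mem_cons_of_mem _ hp))⟩

/-- Here the effect of the given instruction excludes all cases in which `simAct` is `none`. For a
move down, the rank bound must be supplied separately, since `Instr.Effect` does not look at the
tree. -/
theorem SimPos.simAct_complete (h : SimPos t k w u d c β π π') {a : S.Sym}
    (ha : t.label? u = some a) {q : Fin n} {α : Instr (Fin v) (Fin i)}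
    (hα : ∀ j, α = .down j → 1 ≤ j ∧ j ≤ S.rank a)
    {u₂ : Address} {π₂ : Stack (Fin v) (Fin i)} (heff : α.Effect k u π u₂ π₂) :
    ∃ q' α' w₂ π₂', simAct k (S.rank a) d c β q α = some (q', α') ∧
      α'.Effect (k - 1) w π' w₂ π₂' ∧ SimRel t k ⟨q, u₂, π₂⟩ ⟨q', w₂, π₂'⟩ := by
  obtain ⟨π₀, hpos, hmove⟩ := h.move
  cases heff with
  | stay => exact ⟨_, _, _, _, rfl, .stay _ _, .main _ _ _ _ _ _ _ _ h⟩
  | up j u =>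
    by_cases hd : d = 0
    · subst hd
      obtain ⟨j, w', u', d', hu, rfl, h'⟩ := hpos.parent
      obtain ⟨rfl, rfl⟩ := List.cons.inj hu
      obtain ⟨β₂, h₂⟩ := hmove _ _ _ h'
      exact ⟨_, _, _, _, rfl, .up _ _ _, .main _ _ _ _ _ _ _ _ h₂⟩
    · obtain ⟨β₂, h₂⟩ := hmove _ _ _ (.up _ _ _ _ _ hpos hd)
      exact ⟨_, _, _, _, by rw [simAct, if_neg hd], .down _ _ _, .main _ _ _ _ _ _ _ _ h₂⟩
  | down j u =>
    obtain ⟨h1, h2⟩ := hα j rfl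
    by_cases hd : d = j + 1
    · subst hd
      obtain ⟨w', d', rfl, h'⟩ := hpos.child h1
      obtain ⟨β₂, h₂⟩ := hmove _ _ _ h'
      exact ⟨_, _, _, _, by rw [simAct, if_pos rfl], .up _ _ _, .main _ _ _ _ _ _ _ _ h₂⟩
    · obtain ⟨β₂, h₂⟩ := hmove _ _ _ (.down _ _ _ _ _ _ hpos ha h1 h2 hd)
      exact ⟨_, _, _, _, by rw [simAct, if_neg hd], .down _ _ _, .main _ _ _ _ _ _ _ _ h₂⟩
  | dropVisible y u π fresh few =>
    by_cases hv : IsVisibleNo v c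
    · obtain ⟨hy, fresh'⟩ := (h.fresh_iff hv).1 fresh
      have hc := h.countP hv
      exact ⟨_, _, _, _, by rw [simAct, if_pos hv, if_neg hy],
        .dropVisible _ _ _ fresh' (by omega),
        .main _ _ _ _ _ _ _ _ (h.push_real hv (cc := .inl y) hy (by simp; omega))⟩
    · obtain ⟨-, -, rfl, hpos, hπ⟩ := h.nested_of_not hv
      have hk : k ≠ 0 := by omega
      exact ⟨_, _, _, _, by rw [simAct, if_neg hv, if_neg hk]; rfl, .down _ _ _,
        .enter _ _ _ _ _ (.copy _ _ _ _ (.inl y) _ hpos ha) hπ hk⟩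
  | dropInvisible y u π =>
    by_cases hv : IsVisibleNo v c
    · have hc := h.countP hv
      have hv' := hv.2
      refine ⟨_, _, _, _, by rw [simAct, if_pos hv], .dropInvisible _ _ _,
        .main _ _ _ _ _ _ _ _ (h.push_real hv (cc := .inr y) ?_ ?_)⟩
      · simp only [colNo]; omega
      · simpa using hc.2.2
    · obtain ⟨-, -, rfl, hpos, hπ⟩ := h.nested_of_not hv
      refine ⟨_, _, _, _, by rw [simAct, if_neg hv]; rfl, .down _ _ _, .main _ _ _ _ _ _ _ _
        (.nested _ (.copy _ _ _ _ (.inr y) _ hpos ha) ?_)⟩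
      intro p hp z
      rcases List.mem_cons.1 hp with rfl | hp
      · simp
      · exact hπ p hp z
  | lift cc u π =>
    by_cases hv : IsVisibleNo v c
    · by_cases hcc : colNo cc = c
      · rcases cc with y | y
        · obtain ⟨rfl, rfl, π₂', hπ₂, hrel⟩ := h.bottom hcc (q := q) (.inr ⟨_, rfl⟩)
          obtain ⟨-, rfl⟩ := List.cons.inj hπ₂
          exact ⟨_, _, _, _, by
            rw [simAct, if_pos hv, if_pos (show 1 + (y : ℕ) = c from hcc), if_pos rfl], .lift _ _ _, hrel⟩
        · have hv' := hv.2
          simp only [colNo] at hcc; omega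
      · obtain ⟨π₂', rfl⟩ := h.pop_real' hv rfl hcc
        obtain ⟨π₂, β₂, hπ₂, h₂⟩ := h.pop_real hv rfl
        obtain ⟨-, rfl⟩ := List.cons.inj hπ₂
        rcases cc with y | y
        · exact ⟨_, _, _, _, by
            rw [simAct, if_pos hv, if_neg (show 1 + (y : ℕ) ≠ c from hcc)]; rfl, .lift _ _ _,
            .main _ _ _ _ _ _ _ _ h₂⟩
        · exact ⟨_, _, _, _, by rw [simAct, if_pos hv]; rfl, .lift _ _ _,
            .main _ _ _ _ _ _ _ _ h₂⟩
    · obtain ⟨-, -, rfl, hpos, hπ⟩ := h.nested_of_not hv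
      rcases cc with y | y
      · exact absurd rfl (hπ _ List.mem_cons_self y)
      · obtain rfl := hpos.eq_one_iff.2 rfl
        obtain ⟨-, j, w', d', rfl, h'⟩ := hpos.beneath
        exact ⟨_, _, _, _, by rw [simAct, if_neg hv], .up _ _ _, .main _ _ _ _ _ _ _ _
          (.nested _ h' fun p hp => hπ p (List.mem_cons_of_mem _ hp))⟩

end SimulationSteps

end PebbleTree

/-! ### Correctness of the simulation -/

namespace PebbleTree

section SimulationTheorem

variable {S D : RankedAlphabet} {ns n v i k N : ℕ} {e : S.Sym ≃ Fin ns} {t : S.Tree}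
  {t' : (encAlphabet e (v + i)).Tree} {M : PTT S D (Fin n) (Fin v) (Fin i) k}

/-- The relevance of a simulating rule. -/
theorem SimPos.relevant_of_simRule (henc : Enc e (v + i) t N 1 0 [] t') {q : Fin n} {w u : Address}
    {d c β : ℕ} {π : Stack (Fin v) (Fin i)} {π' : Stack (Fin v) (Fin (i + 1))}
    (h : SimPos t k w u d c β π π') {r : Rule S D (Fin n) (Fin v) (Fin i)} {d' c' β' : ℕ}
    (hj : r.j ≤ S.maxRank) (hd' : d' ≤ S.maxRank + 1) (hc' : c' ≤ v + i) (hβ' : β' ≤ 1)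
    (hr : (simRule e k r d' c' β').Relevant t' ⟨mainState q, w, π'⟩) :
    r.q = q ∧ t.label? u = some r.a ∧ u.childNo = r.j ∧ d = d' ∧ c = c' ∧
      (SimOK k r.b d' c' β' → β = β' ∧ r.Relevant t ⟨q, u, π⟩) := by
  obtain ⟨h1, h2, -, h4⟩ := hr
  obtain ⟨π₀, hpos, hc, -, -⟩ := h.pos
  obtain ⟨ha, hju, rfl, rfl⟩ := henc.label_eq hpos hj hd' hc' h2
  subst hc
  refine ⟨mainState_inj.1 h1, ha, hju, rfl, rfl, fun hok => ?_⟩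
  simp only [simRule, if_pos hok] at h4
  obtain rfl := h.eq_of_observable hβ' hok h4
  exact ⟨rfl, mainState_inj.1 h1, ha, hju, h.observable_iff.2 ⟨hok, by rwa [if_pos hok]⟩⟩

/-- A rule of the simulating transducer stands for one rule of the given one or, for self-loops and
the second halves of entering and leaving the copy of the first visible pebble, for none. In the
latter cases the related configuration stays the same. -/
theorem simPTT_sound (henc : Enc e (v + i) t N 1 0 [] t')
    {c' : Config (Fin (3 * n)) (Fin v) (Fin (i + 1))} {s : D.Tree}
    (h : (simPTT e M).Gen t' (fun _ => True) c' s) {c : Config (Fin n) (Fin v) (Fin i)}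
    (hc : SimRel t k c c') : M.Gen t (fun _ => True) c s := by
  induction h generalizing c with
  | act r' c' q' α' w₂ π₂' s mem rel rhs eff _ _ ih =>
    obtain ⟨r, hr, d', cc', β', hd', hcc', hβ', rfl⟩ | ⟨hk, a, j, q₁, y, hj, rfl | rfl⟩ :=
      mem_simPTT.1 mem
    · have hwf := M.wellFormed r hr
      cases hc with
      | main q w u d cc β π π' h =>
        obtain ⟨rfl, ha, hju, rfl, rfl, hrel⟩ :=
          h.relevant_of_simRule henc hwf.1 hd' hcc' hβ' rel
        have hstay : (.act (mainState r.q) .stay : Rhs D (Fin (3 * n)) (Fin v) (Fin (i + 1))) =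
            .act q' α' → M.Gen t (fun _ => True) ⟨r.q, u, π⟩ s := by
          intro h'
          injection h' with h1 h2
          subst h1 h2
          cases eff
          exact ih (.main _ _ _ _ _ _ _ _ h)
        simp only [simRule] at rhs
        split_ifs at rhs with hok
        · obtain ⟨rfl, hrel'⟩ := hrel hok
          rcases hrhs : r.rhs with ⟨q₁, α₁⟩ | ⟨x, qs⟩
          · rw [hrhs, simRhs] at rhs
            rcases hs : simAct k (S.rank r.a) d cc β q₁ α₁ with _ | ⟨q₂, α₂⟩
            · rw [hs] at rhs
              exact hstay rhs
            · rw [hs] at rhs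
              injection rhs with h1 h2
              subst h1 h2
              have hall := hwf.2.2.2
              rw [hrhs, ← hju] at hall
              obtain ⟨u₂, π₂, heff, hrel₂⟩ := h.simAct_sound ha hrel'.2.2.2 hall hs eff
              exact .act r _ _ _ _ _ _ hr hrel' hrhs heff trivial (ih hrel₂)
          · rw [hrhs, simRhs] at rhs
            simp at rhs
        · exact hstay rhs
      | enter q => exact absurd rel.1 mainState_ne_enterState
      | exit q => exact absurd rel.1 mainState_ne_exitState
    · simp only [enterRule] at rhs
      injection rhs with h1 h2
      subst h1 h2
      cases hc with
      | main q => exact absurd rel.1.symm mainState_ne_enterState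
      | enter q w p x lo h hlo hk =>
        obtain rfl : q₁ = q := enterState_inj.1 rel.1
        cases eff
        exact ih (.main _ _ _ _ _ _ _ _ (.enter h hlo hk))
      | exit q => exact absurd rel.1 enterState_ne_exitState
    · simp only [exitRule] at rhs
      injection rhs with h1 h2
      subst h1 h2
      cases hc with
      | main q => exact absurd rel.1.symm mainState_ne_exitState
      | enter q => exact absurd rel.1.symm enterState_ne_exitState
      | exit q w p x lo h hlo hk =>
        obtain rfl : q₁ = q := exitState_inj.1 rel.1
        obtain ⟨-, j, w', d', rfl, h'⟩ := h.beneath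
        cases eff
        exact ih (.main _ _ _ _ _ _ _ _ (.nested _ h' hlo))
  | out r' c' x' qs' ch mem rel rhs _ _ ih =>
    obtain ⟨r, hr, d', cc', β', hd', hcc', hβ', rfl⟩ | ⟨hk, a, j, q₁, y, hj, rfl | rfl⟩ :=
      mem_simPTT.1 mem
    · have hwf := M.wellFormed r hr
      cases hc with
      | main q w u d cc β π π' h =>
        obtain ⟨rfl, ha, hju, rfl, rfl, hrel⟩ :=
          h.relevant_of_simRule henc hwf.1 hd' hcc' hβ' rel
        simp only [simRule] at rhs
        split_ifs at rhs with hok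
        obtain ⟨rfl, hrel'⟩ := hrel hok
        rcases hrhs : r.rhs with ⟨q₁, α₁⟩ | ⟨x, qs⟩
        · rw [hrhs, simRhs] at rhs
          split at rhs <;> simp at rhs
        · rw [hrhs, simRhs] at rhs
          injection rhs with h1 h2
          subst h1
          cases h2
          exact .out r _ _ _ _ hr hrel' hrhs trivial fun y => ih y (.main _ _ _ _ _ _ _ _ h)
      | enter q => exact absurd rel.1 mainState_ne_enterState
      | exit q => exact absurd rel.1 mainState_ne_exitState
    · simp [enterRule] at rhs
    · simp [exitRule] at rhs

theorem Pos.observable_nil_iff {b : Finset (Fin v ⊕ Fin (i + 1))} (hb : b = ∅) {w : Address} :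
    ∀ x, x ∈ b ↔ Observable w [] x := by
  intro x
  simp [hb, observable_nil]

/-- A configuration that is entering or leaving a copy first completes this with its single rule, so
only main configurations need to be treated. -/
theorem simPTT_gen_of_main (henc : Enc e (v + i) t (N + 1) 1 0 [] t')
    {c : Config (Fin n) (Fin v) (Fin i)} (hN : c.stack.length ≤ N) {s : D.Tree}
    (h : ∀ w d cc β π', SimPos t k w c.pos d cc β c.stack π' →
      (simPTT e M).Gen t' (fun _ => True) ⟨mainState c.state, w, π'⟩ s)
    {c' : Config (Fin (3 * n)) (Fin v) (Fin (i + 1))} (hc : SimRel t k c c') :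
    (simPTT e M).Gen t' (fun _ => True) c' s := by
  cases hc with
  | main q w u d cc β π π' h' => exact h _ _ _ _ _ h'
  | enter q w p x lo h' hlo hk =>
    obtain ⟨a, ha⟩ := h'.exists_label
    refine .act (enterRule e a p.childNo q x) _ (mainState q) (.drop (.inr (Fin.last i))) w _ _
      (mem_simPTT.2 (.inr ⟨hk, a, p.childNo, q, x, RankedAlphabet.Tree.childNo_le ha, .inl rfl⟩))
      ⟨rfl, henc.label h' (by simpa using hN.trans (Nat.le_succ _)) ha, h'.childNo ha,
        Pos.observable_nil_iff rfl⟩ rfl (.dropInvisible _ _ _) trivial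
      (h _ _ _ _ _ (.enter h' hlo hk))
  | exit q w p x lo h' hlo hk =>
    obtain ⟨a, ha⟩ := h'.exists_label
    obtain ⟨-, j, w', d', rfl, h''⟩ := h'.beneath
    -- The head is still in the copy of the pebble that has been lifted, one level deeper than the
    -- stack is high. This is why the depth must be `N + 1`.
    refine .act (exitRule e a p.childNo q x) _ (mainState q) .up w' [] _
      (mem_simPTT.2 (.inr ⟨hk, a, p.childNo, q, x, RankedAlphabet.Tree.childNo_le ha, .inr rfl⟩))
      ⟨rfl, henc.label h' (by simpa using hN) ha, h'.childNo ha,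
        Pos.observable_nil_iff rfl⟩ rfl (.up _ _ _) trivial (h _ _ _ _ _ (.nested _ h'' hlo))

theorem SimPos.simRule_relevant (henc : Enc e (v + i) t N 1 0 [] t') {q : Fin n} {w u : Address}
    {d c β : ℕ} {π : Stack (Fin v) (Fin i)} {π' : Stack (Fin v) (Fin (i + 1))}
    (h : SimPos t k w u d c β π π') (hN : π.length ≤ N)
    {r : Rule S D (Fin n) (Fin v) (Fin i)} (hr : r ∈ M.rules) (hrel : r.Relevant t ⟨q, u, π⟩) :
    simRule e k r d c β ∈ (simPTT e M).rules ∧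
      (simRule e k r d c β).Relevant t' ⟨mainState q, w, π'⟩ ∧ SimOK k r.b d c β := by
  obtain ⟨rfl, ha, hju, hb⟩ := hrel
  simp only at ha hju hb
  obtain ⟨π₀, hpos, rfl, hN', hβ⟩ := h.pos
  obtain ⟨hok, hb'⟩ := h.observable_iff.1 hb
  refine ⟨mem_simPTT.2 (.inl ⟨r, hr, _, _, _, hpos.direction_le, topColNo_le π₀, hβ, rfl⟩),
    ⟨rfl, ?_, ?_, hb'⟩, hok⟩
  · simp only [simRule, ← hju]
    exact henc.label hpos (hN'.trans hN) ha
  · simp only [simRule, ← hju]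
    exact hpos.childNo ha

/-- The bound on the stacks along the computation keeps every encoded position that is needed within
the guaranteed depth. -/
theorem simPTT_complete (henc : Enc e (v + i) t (N + 1) 1 0 [] t')
    {c : Config (Fin n) (Fin v) (Fin i)} {s : D.Tree}
    (h : M.Gen t (fun c => c.stack.length ≤ N) c s)
    {c' : Config (Fin (3 * n)) (Fin v) (Fin (i + 1))} (hc : SimRel t k c c') :
    (simPTT e M).Gen t' (fun _ => True) c' s := by
  induction h generalizing c' with
  | act r c q α u π s mem rel rhs eff hP _ ih =>
    refine simPTT_gen_of_main henc hP (fun w d cc β π' h => ?_) hc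
    obtain ⟨mem', rel', hok⟩ := h.simRule_relevant henc (by omega) mem rel
    have hwf := (M.wellFormed r mem).2.2.2
    rw [rhs] at hwf
    obtain ⟨q', α', w₂, π₂', hs, heff, hrel⟩ := h.simAct_complete (q := q) rel.2.1
      (fun j hj => by subst hj; exact hwf) eff
    refine .act _ _ q' α' w₂ π₂' _ mem' rel' ?_ heff trivial (ih hrel)
    simp only [simRule, if_pos hok, rhs, simRhs, hs]
  | out r c x qs ch mem rel rhs hP _ ih =>
    refine simPTT_gen_of_main henc hP (fun w d cc β π' h => ?_) hc
    obtain ⟨mem', rel', hok⟩ := h.simRule_relevant henc (by omega) mem rel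
    refine .out _ _ x (fun y => mainState (qs y)) ch mem' rel' ?_ trivial
      fun y => ih y (.main _ _ _ _ _ _ _ _ h)
    simp only [simRule, if_pos hok, rhs, simRhs]

/-- Every transducer with at most `k` visible pebbles is a composition of a transducer without
pebbles and a transducer with at most `k - 1` visible pebbles. -/
theorem encTT_comp_simPTT (M : PTT S D (Fin n) (Fin v) (Fin i) k) :
    (encTT e (v + i)).transduction.comp (simPTT e M).transduction = M.transduction := by
  ext ⟨t, s⟩
  have hrel : ∀ q : Fin n, SimRel (t := t) (k := k) (⟨q, [], []⟩ : Config (Fin n) (Fin v) (Fin i))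
      ⟨mainState q, [], []⟩ := fun q => .main _ _ _ _ _ _ _ _ (.nested [] .root (by simp))
  constructor
  · rintro ⟨t', h1, h2⟩
    have henc := encTT_transduction.1 h1
    obtain ⟨q', hq', h⟩ := PTT.mem_transduction.1 h2
    obtain ⟨q, hq, rfl⟩ := Finset.mem_map.1 hq'
    exact PTT.mem_transduction.2 ⟨q, hq, simPTT_sound henc h (hrel q)⟩
  · intro h
    obtain ⟨q, hq, h⟩ := PTT.mem_transduction.1 h
    obtain ⟨N, h⟩ := PTT.Gen.exists_bound (PTT.Gen.mono (fun _ _ => trivial) h)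
    -- The encoded tree is chosen after the computation, so that its copies are nested deeply
    -- enough.
    obtain ⟨t', ht'⟩ := Enc.exists (e := e) (nc := v + i) (t := t) (N + 1)
      (RankedAlphabet.Tree.label?_nil t) (d := 1) (by omega) 0
    exact ⟨t', encTT_transduction.2 ht'.zero, PTT.mem_transduction.2
      ⟨mainState q, Finset.mem_map_of_mem _ hq, simPTT_complete ht' h (hrel q)⟩⟩

/-- The case of transducers without visible pebbles. -/
theorem encTT_comp_erase (M : PTT S D (Fin n) (Fin v) (Fin i) k) (hk : k = 0) :
    (encTT e (v + i)).transduction.comp (simPTT e M).erase.transduction = M.transduction := by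
  rw [PTT.transduction_erase _ (simPTT_rhs_ne_drop M hk), encTT_comp_simPTT]

end SimulationTheorem

end PebbleTree

namespace StackProgram

/-! ### Computable functions with local variables -/

/-- Contexts consist of the input and the values of some variables. -/
class Ctx (Γ : Type) where
  level : ℕ
  dec : List ℕ → (ℕ → ℕ) → Γ
  dec_update : ∀ x ρ m a, level ≤ m → dec x (Function.update ρ m a) = dec x ρ

instance : Ctx (List ℕ) where
  level := 0
  dec x _ := x
  dec_update _ _ _ _ _ := rfl

instance {Γ : Type} [Ctx Γ] : Ctx (Γ × ℕ) where
  level := Ctx.level Γ + 1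
  dec x ρ := (Ctx.dec x ρ, ρ (Ctx.level Γ))
  dec_update x ρ m a h := by
    rw [Ctx.dec_update x ρ m a (by omega), Function.update_of_ne (by omega)]

/-- Numbers that are computable in polynomial time in a context. -/
def NumComp {Γ : Type} [Ctx Γ] (f : Γ → ℕ) : Prop := Comp fun x ρ => f (Ctx.dec x ρ)

/-- Conditions that are decidable in polynomial time in a context. -/
def PropComp {Γ : Type} [Ctx Γ] (P : Γ → Prop) : Prop := ∃ f, NumComp f ∧ ∀ γ : Γ, P γ ↔ f γ ≠ 0

/-- Lists that can be produced in polynomial time in a context. -/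
def ListEmits {Γ : Type} [Ctx Γ] (f : Γ → List ℕ) : Prop := Emits fun x ρ => f (Ctx.dec x ρ)

/-- The input. -/
def IsInput {Γ : Type} [Ctx Γ] (X : Γ → List ℕ) : Prop := ∀ x ρ, X (Ctx.dec x ρ) = x

variable {Γ : Type} [Ctx Γ] {X : Γ → List ℕ}

theorem isInput_id : IsInput fun x : List ℕ => x := fun _ _ => rfl

theorem IsInput.fst (h : IsInput X) : IsInput fun p : Γ × ℕ => X p.1 := fun _ _ => h _ _

theorem NumComp.fst {f : Γ → ℕ} (h : NumComp f) : NumComp fun p : Γ × ℕ => f p.1 := h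

theorem NumComp.snd : NumComp fun p : Γ × ℕ => p.2 := Comp.var _

theorem NumComp.const (k : ℕ) : NumComp fun _ : Γ => k := Comp.const k

theorem NumComp.add {f g : Γ → ℕ} (hf : NumComp f) (hg : NumComp g) :
    NumComp fun γ => f γ + g γ := Comp.add hf hg

theorem NumComp.sub {f g : Γ → ℕ} (hf : NumComp f) (hg : NumComp g) :
    NumComp fun γ => f γ - g γ := Comp.sub hf hg

theorem NumComp.mul {f g : Γ → ℕ} (hf : NumComp f) (hg : NumComp g) :
    NumComp fun γ => f γ * g γ := Comp.mul hf hg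

theorem NumComp.getD (hX : IsInput X) {f : Γ → ℕ} (hf : NumComp f) :
    NumComp fun γ => (X γ).getD (f γ) 0 := by
  have := Comp.get hf
  unfold NumComp
  simpa only [hX _ _] using this

theorem NumComp.length (hX : IsInput X) : NumComp fun γ => (X γ).length := by
  have := Comp.length
  unfold NumComp
  simpa only [hX _ _] using this

/-- The bound variable is the first one beyond the level of `Γ`, so assigning it does not disturb
the context. -/
theorem NumComp.sum {f : Γ → ℕ} {g : Γ → ℕ → ℕ} (hf : NumComp f)
    (hg : NumComp fun p : Γ × ℕ => g p.1 p.2) :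
    NumComp fun γ => ∑ y ∈ Finset.range (f γ), g γ y := by
  have := Comp.sum (Ctx.level Γ) hf hg
  unfold NumComp
  simpa only [Ctx.dec, Ctx.dec_update _ _ _ _ le_rfl, Function.update_self] using this

theorem NumComp.iterate (hX : IsInput X) {f g : Γ → ℕ} {h : Γ → ℕ → ℕ} (hf : NumComp f)
    (hg : NumComp g) (hh : NumComp fun p : Γ × ℕ => h p.1 p.2)
    (hle : ∀ γ a, h γ a ≤ (X γ).length) : NumComp fun γ => (h γ)^[f γ] (g γ) := by
  have := Comp.iter (Ctx.level Γ) hf hg hh (fun x ρ => (hle _ _).trans (le_of_eq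
    (congrArg List.length (hX x ρ))))
  unfold NumComp
  simpa only [Ctx.dec, Ctx.dec_update _ _ _ _ le_rfl, Function.update_self] using this

theorem PropComp.not {P : Γ → Prop} (hP : PropComp P) : PropComp fun γ => ¬ P γ := by
  obtain ⟨f, hf, h⟩ := hP
  exact ⟨fun γ => 1 - f γ, .sub (.const 1) hf, fun γ => by beta_reduce; rw [h]; omega⟩

theorem PropComp.and {P Q : Γ → Prop} (hP : PropComp P) (hQ : PropComp Q) :
    PropComp fun γ => P γ ∧ Q γ := by
  obtain ⟨f, hf, h⟩ := hP
  obtain ⟨g, hg, h'⟩ := hQ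
  exact ⟨fun γ => f γ * g γ, .mul hf hg, fun γ => by beta_reduce; rw [h, h', Nat.mul_ne_zero_iff]⟩

theorem PropComp.or {P Q : Γ → Prop} (hP : PropComp P) (hQ : PropComp Q) :
    PropComp fun γ => P γ ∨ Q γ := by
  obtain ⟨f, hf, h⟩ := hP
  obtain ⟨g, hg, h'⟩ := hQ
  exact ⟨fun γ => f γ + g γ, .add hf hg, fun γ => by beta_reduce; rw [h, h']; omega⟩

theorem PropComp.imp {P Q : Γ → Prop} (hP : PropComp P) (hQ : PropComp Q) :
    PropComp fun γ => P γ → Q γ := by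
  simpa only [imp_iff_not_or] using hP.not.or hQ

theorem PropComp.iff {P Q : Γ → Prop} (hP : PropComp P) (hQ : PropComp Q) :
    PropComp fun γ => (P γ ↔ Q γ) := by
  simpa only [iff_iff_implies_and_implies] using (hP.imp hQ).and (hQ.imp hP)

theorem PropComp.le {f g : Γ → ℕ} (hf : NumComp f) (hg : NumComp g) :
    PropComp fun γ => f γ ≤ g γ :=
  ⟨fun γ => g γ + 1 - f γ, .sub (.add hg (.const 1)) hf, fun γ => by beta_reduce; omega⟩

theorem PropComp.lt {f g : Γ → ℕ} (hf : NumComp f) (hg : NumComp g) :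
    PropComp fun γ => f γ < g γ :=
  ⟨fun γ => g γ - f γ, .sub hg hf, fun γ => by beta_reduce; omega⟩

theorem PropComp.eq {f g : Γ → ℕ} (hf : NumComp f) (hg : NumComp g) :
    PropComp fun γ => f γ = g γ := by
  simpa only [← le_antisymm_iff] using (PropComp.le hf hg).and (PropComp.le hg hf)

theorem PropComp.ne {f g : Γ → ℕ} (hf : NumComp f) (hg : NumComp g) :
    PropComp fun γ => f γ ≠ g γ := (PropComp.eq hf hg).not

theorem PropComp.const (p : Prop) : PropComp fun _ : Γ => p := by
  by_cases hp : p
  · exact ⟨fun _ => 1, .const 1, fun _ => by simp [hp]⟩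
  · exact ⟨fun _ => 0, .const 0, fun _ => by simp [hp]⟩

theorem NumComp.ite {P : Γ → Prop} [∀ γ, Decidable (P γ)] {f g : Γ → ℕ} (hP : PropComp P)
    (hf : NumComp f) (hg : NumComp g) : NumComp fun γ => if P γ then f γ else g γ := by
  obtain ⟨p, hp, h⟩ := hP
  have := Comp.ite hp hf hg
  unfold NumComp
  convert this using 3
  rw [← ite_not]
  simp only [h, ne_eq, ite_not]

theorem NumComp.min {f g : Γ → ℕ} (hf : NumComp f) (hg : NumComp g) :
    NumComp fun γ => min (f γ) (g γ) := NumComp.ite (.le hf hg) hf hg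

theorem PropComp.ite {P Q R : Γ → Prop} [∀ γ, Decidable (P γ)] (hP : PropComp P)
    (hQ : PropComp Q) (hR : PropComp R) : PropComp fun γ => if P γ then Q γ else R γ := by
  obtain ⟨g, hg, h'⟩ := hQ
  obtain ⟨r, hr, h''⟩ := hR
  refine ⟨fun γ => if P γ then g γ else r γ, .ite hP hg hr, fun γ => ?_⟩
  beta_reduce
  split_ifs
  · exact h' γ
  · exact h'' γ

/-- The sum adds a positive number for each violation, so it vanishes exactly if there are none. -/
theorem PropComp.forall_lt {f : Γ → ℕ} {P : Γ → ℕ → Prop} (hf : NumComp f)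
    (hP : PropComp fun p : Γ × ℕ => P p.1 p.2) : PropComp fun γ => ∀ y < f γ, P γ y := by
  obtain ⟨g, hg, h⟩ := hP.not
  refine ⟨fun γ => 1 - ∑ y ∈ Finset.range (f γ), g (γ, y), .sub (.const 1) (.sum hf hg),
    fun γ => ?_⟩
  have h' : ∑ y ∈ Finset.range (f γ), g (γ, y) = 0 ↔ ∀ y < f γ, P γ y := by
    rw [Finset.sum_eq_zero_iff]
    refine forall_congr' fun y => ?_
    rw [Finset.mem_range]
    refine imp_congr_right fun _ => ?_
    have := h (γ, y)
    simp only at this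
    tauto
  beta_reduce
  rw [← h']; omega

theorem ListEmits.nil : ListEmits fun _ : Γ => [] := Emits.nil

theorem ListEmits.append {f g : Γ → List ℕ} (hf : ListEmits f) (hg : ListEmits g) :
    ListEmits fun γ => f γ ++ g γ := Emits.append hf hg

theorem ListEmits.cons {f : Γ → ℕ} {g : Γ → List ℕ} (hf : NumComp f) (hg : ListEmits g) :
    ListEmits fun γ => f γ :: g γ := Emits.append (Emits.val hf) hg

theorem ListEmits.ite {P : Γ → Prop} [∀ γ, Decidable (P γ)] {f g : Γ → List ℕ} (hP : PropComp P)
    (hf : ListEmits f) (hg : ListEmits g) : ListEmits fun γ => if P γ then f γ else g γ := by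
  obtain ⟨p, hp, h⟩ := hP
  have := Emits.ite hp hf hg
  unfold ListEmits
  convert this using 3
  rw [← ite_not]
  simp only [h, ne_eq, ite_not]

theorem ListEmits.flatMap {f : Γ → ℕ} {g : Γ → ℕ → List ℕ} (hf : NumComp f)
    (hg : ListEmits fun p : Γ × ℕ => g p.1 p.2) :
    ListEmits fun γ => (List.range (f γ)).flatMap fun y => g γ y := by
  have := Emits.forRange (Ctx.level Γ) hf hg
  unfold ListEmits
  simpa only [Ctx.dec, Ctx.dec_update _ _ _ _ le_rfl, Function.update_self] using this

theorem ListEmits.map {f : Γ → ℕ} {g : Γ → ℕ → ℕ} (hf : NumComp f)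
    (hg : NumComp fun p : Γ × ℕ => g p.1 p.2) :
    ListEmits fun γ => (List.range (f γ)).map fun y => g γ y := by
  simpa only [List.map_eq_flatMap] using ListEmits.flatMap hf (ListEmits.cons hg .nil)

theorem ListEmits.replicate {f g : Γ → ℕ} (hf : NumComp f) (hg : NumComp g) :
    ListEmits fun γ => List.replicate (f γ) (g γ) := by
  have h := ListEmits.map (g := fun γ _ => g γ) hf hg.fst
  simpa only [List.map_const', List.length_range] using h

theorem ListEmits.listComp {f : List ℕ → List ℕ} (hf : ListEmits f) : ListComp f :=
  Emits.listComp hf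

theorem ListEmits.listComp_append {f g F : List ℕ → List ℕ} (hf : ListEmits f) (hg : ListEmits g)
    (hF : ListComp F) : ListComp fun x => f x ++ F (g x) := ListComp.stage hf hg hF

end StackProgram

namespace PebbleTree

/-! ### Access to presentations of transducers -/

open StackProgram

/-- The number of input symbols. -/
def numIn (x : List ℕ) : ℕ := x.getD 0 0

/-- The rank of an input symbol. -/
def inRank (x : List ℕ) (a : ℕ) : ℕ := x.getD (1 + a) 0

/-- The number of output symbols. -/
def numOut (x : List ℕ) : ℕ := x.getD (1 + numIn x) 0

/-- The rank of an output symbol. -/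
def outRank (x : List ℕ) (a : ℕ) : ℕ := x.getD (2 + numIn x + a) 0

/-- The number of states. -/
def numStates (x : List ℕ) : ℕ := x.getD (2 + numIn x + numOut x) 0

/-- The number of visible colours. -/
def numVis (x : List ℕ) : ℕ := x.getD (3 + numIn x + numOut x) 0

/-- The number of invisible colours. -/
def numInv (x : List ℕ) : ℕ := x.getD (4 + numIn x + numOut x) 0

/-- The characteristic sequence of the set of initial states. -/
def initBit (x : List ℕ) (q : ℕ) : ℕ := x.getD (5 + numIn x + numOut x + q) 0

/-- The number of rules. -/
def numRules (x : List ℕ) : ℕ := x.getD (5 + numIn x + numOut x + numStates x) 0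

/-- The maximal rank of the input symbols. -/
def maxInRank (x : List ℕ) : ℕ :=
  ∑ y ∈ Finset.range (∑ a ∈ Finset.range (numIn x), inRank x a),
    if ∀ a < numIn x, inRank x a ≤ y then 0 else 1

/-- The number of colours. -/
def numCol (x : List ℕ) : ℕ := numVis x + numInv x

/-- The length of the rule at `o`. -/
def ruleLength (x : List ℕ) (o : ℕ) : ℕ :=
  3 + numVis x + numInv x + if x.getD (o + (3 + numVis x + numInv x)) 0 = 0 then 4
    else 2 + outRank x (x.getD (o + (4 + numVis x + numInv x)) 0)

/-- The offset of a rule. -/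
def ruleOffset (x : List ℕ) (r : ℕ) : ℕ :=
  (fun o => min (o + ruleLength x o) x.length)^[r] (6 + numIn x + numOut x + numStates x)

variable {Γ : Type} [Ctx Γ] {X : Γ → List ℕ}

theorem numComp_numIn (hX : IsInput X) : NumComp fun γ => numIn (X γ) := .getD hX (.const 0)

theorem numComp_inRank (hX : IsInput X) {f : Γ → ℕ} (hf : NumComp f) :
    NumComp fun γ => inRank (X γ) (f γ) := .getD hX (.add (.const 1) hf)

theorem numComp_numOut (hX : IsInput X) : NumComp fun γ => numOut (X γ) :=
  .getD hX (.add (.const 1) (numComp_numIn hX))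

theorem numComp_outRank (hX : IsInput X) {f : Γ → ℕ} (hf : NumComp f) :
    NumComp fun γ => outRank (X γ) (f γ) :=
  .getD hX (.add (.add (.const 2) (numComp_numIn hX)) hf)

theorem numComp_numStates (hX : IsInput X) : NumComp fun γ => numStates (X γ) :=
  .getD hX (.add (.add (.const 2) (numComp_numIn hX)) (numComp_numOut hX))

theorem numComp_numVis (hX : IsInput X) : NumComp fun γ => numVis (X γ) :=
  .getD hX (.add (.add (.const 3) (numComp_numIn hX)) (numComp_numOut hX))

theorem numComp_numInv (hX : IsInput X) : NumComp fun γ => numInv (X γ) :=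
  .getD hX (.add (.add (.const 4) (numComp_numIn hX)) (numComp_numOut hX))

theorem numComp_initBit (hX : IsInput X) {f : Γ → ℕ} (hf : NumComp f) :
    NumComp fun γ => initBit (X γ) (f γ) :=
  .getD hX (.add (.add (.add (.const 5) (numComp_numIn hX)) (numComp_numOut hX)) hf)

theorem numComp_numRules (hX : IsInput X) : NumComp fun γ => numRules (X γ) :=
  .getD hX (.add (.add (.add (.const 5) (numComp_numIn hX)) (numComp_numOut hX))
    (numComp_numStates hX))

theorem numComp_numCol (hX : IsInput X) : NumComp fun γ => numCol (X γ) :=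
  .add (numComp_numVis hX) (numComp_numInv hX)

theorem numComp_maxInRank (hX : IsInput X) : NumComp fun γ => maxInRank (X γ) :=
  .sum (.sum (numComp_numIn hX) (numComp_inRank hX.fst .snd))
    (.ite (.forall_lt (numComp_numIn hX.fst) (.le (numComp_inRank hX.fst.fst .snd) (.fst .snd)))
      (.const 0) (.const 1))

theorem numComp_ruleLength (hX : IsInput X) {f : Γ → ℕ} (hf : NumComp f) :
    NumComp fun γ => ruleLength (X γ) (f γ) := by
  have hv := numComp_numVis hX
  have hi := numComp_numInv hX
  exact .add (.add (.add (.const 3) hv) hi) (.ite (.eq (.getD hX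
    (.add hf (.add (.add (.const 3) hv) hi))) (.const 0)) (.const 4)
    (.add (.const 2) (numComp_outRank hX (.getD hX (.add hf (.add (.add (.const 4) hv) hi))))))

/-- Rules vary in length, so their offsets are found by iteration. The `min` in `ruleOffset`
provides the uniform bound that `NumComp.iterate` demands. -/
theorem numComp_ruleOffset (hX : IsInput X) {f : Γ → ℕ} (hf : NumComp f) :
    NumComp fun γ => ruleOffset (X γ) (f γ) := by
  refine .iterate hX (h := fun γ o => min (o + ruleLength (X γ) o) (X γ).length) hf
    (.add (.add (.add (.const 6) (numComp_numIn hX)) (numComp_numOut hX)) (numComp_numStates hX))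
    ?_ fun γ a => min_le_right _ _
  have h1 := (NumComp.snd (Γ := Γ)).add (numComp_ruleLength hX.fst .snd)
  have h2 := NumComp.length hX.fst
  exact .ite (.le h1 h2) h1 h2

end PebbleTree

namespace PebbleTree

open StackProgram

/-! ### Programs for the encoding transducer -/

/-- The ranks of the symbols of encoded trees. -/
def encRankList (x : List ℕ) : List ℕ :=
  0 :: (List.range (numIn x)).flatMap fun a =>
    List.replicate (encBlock (maxInRank x) (numCol x)) (1 + inRank x a + numCol x)

/-- The ranks of the input symbols, preceded by their number. -/
def inputList (x : List ℕ) : List ℕ :=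
  numIn x :: (List.range (numIn x)).map fun a => inRank x a

/-- The ranks of the output symbols, preceded by their number. -/
def outputList (x : List ℕ) : List ℕ :=
  numOut x :: (List.range (numOut x)).map fun a => outRank x a

/-- The ranks of the symbols of encoded trees, preceded by their number. -/
def encAlphabetList (x : List ℕ) : List ℕ :=
  (numIn x * encBlock (maxInRank x) (numCol x) + 1) :: encRankList x

/-- The states that produce the children of encoded nodes. -/
def encChildState (m nc r j d c y : ℕ) : ℕ :=
  if y = 0 then if j = 0 ∨ d = 0 then (2 * m + 3) * (nc + 1) + 0 else (m + 2) * (nc + 1) + c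
  else if y ≤ r then
    if d = y + 1 then (2 * m + 3) * (nc + 1) + 0 else (m + 2 + y) * (nc + 1) + c
  else (2 * m + 3) * (nc + 1) + (y - r)

/-- The right-hand sides of the rules of the encoding transducer. -/
def encRhsList (x : List ℕ) (a j d c : ℕ) : List ℕ :=
  if d ≤ maxInRank x + 1 then
    1 :: encIndex (maxInRank x) (numCol x) a j d c ::
      (List.range (1 + inRank x a + numCol x)).map fun y =>
        encChildState (maxInRank x) (numCol x) (inRank x a) j d c y
  else if d = maxInRank x + 2 ∧ j ≠ 0 then [0, (j + 1) * (numCol x + 1) + c, 1, 0]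
  else if maxInRank x + 2 < d ∧ d ≤ maxInRank x + 2 + inRank x a then
    [0, 0 * (numCol x + 1) + c, 2, d - (maxInRank x + 2)]
  else if d = 2 * maxInRank x + 3 then [1, 0]
  else if d = 2 * maxInRank x + 4 ∧ c ≠ 0 then [0, 1 * (numCol x + 1) + c, 0, 0]
  else [0, min d (2 * maxInRank x + 3) * (numCol x + 1) + c, 0, 0]

/-- The rules of the encoding transducer. -/
def encRuleList (x : List ℕ) (a j d c : ℕ) : List ℕ :=
  (min d (2 * maxInRank x + 3) * (numCol x + 1) + c) :: a :: j :: encRhsList x a j d c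

/-- The encoding transducer. -/
def encTTList (x : List ℕ) : List ℕ :=
  inputList x ++ encAlphabetList x ++ [encStates (maxInRank x) (numCol x), 0, 0] ++
    ((List.range (encStates (maxInRank x) (numCol x))).map fun q =>
      if q = 1 * (numCol x + 1) + 0 then 1 else 0) ++
    (numIn x * ((maxInRank x + 1) * ((2 * maxInRank x + 5) * (numCol x + 1)))) ::
      (List.range (numIn x)).flatMap fun a => (List.range (maxInRank x + 1)).flatMap fun j =>
        (List.range (2 * maxInRank x + 5)).flatMap fun d =>
          (List.range (numCol x + 1)).flatMap fun c => encRuleList x a j d c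

variable {Γ : Type} [Ctx Γ] {X : Γ → List ℕ}

theorem numComp_encBlock {f g : Γ → ℕ} (hf : NumComp f) (hg : NumComp g) :
    NumComp fun γ => encBlock (f γ) (g γ) :=
  .mul (.mul (.add hf (.const 1)) (.add hf (.const 2))) (.add hg (.const 1))

theorem numComp_encStates {f g : Γ → ℕ} (hf : NumComp f) (hg : NumComp g) :
    NumComp fun γ => encStates (f γ) (g γ) :=
  .mul (.add (.mul (.const 2) hf) (.const 4)) (.add hg (.const 1))

theorem numComp_encIndex {m nc a j d c : Γ → ℕ} (hm : NumComp m) (hnc : NumComp nc)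
    (ha : NumComp a) (hj : NumComp j) (hd : NumComp d) (hc : NumComp c) :
    NumComp fun γ => encIndex (m γ) (nc γ) (a γ) (j γ) (d γ) (c γ) :=
  .add (.add (.mul ha (numComp_encBlock hm hnc)) (.add (.mul (.add (.mul hj (.add hm (.const 2)))
    hd) (.add hnc (.const 1))) hc)) (.const 1)

theorem numComp_encChildState {m nc r j d c y : Γ → ℕ} (hm : NumComp m) (hnc : NumComp nc)
    (hr : NumComp r) (hj : NumComp j) (hd : NumComp d) (hc : NumComp c) (hy : NumComp y) :
    NumComp fun γ => encChildState (m γ) (nc γ) (r γ) (j γ) (d γ) (c γ) (y γ) := by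
  unfold encChildState
  repeat' first
    | assumption
    | exact NumComp.const _
    | refine NumComp.ite ?_ ?_ ?_
    | refine NumComp.add ?_ ?_
    | refine NumComp.mul ?_ ?_
    | refine NumComp.sub ?_ ?_
    | refine PropComp.or ?_ ?_
    | refine PropComp.eq ?_ ?_
    | refine PropComp.le ?_ ?_

theorem listEmits_inputList (hX : IsInput X) : ListEmits fun γ => inputList (X γ) :=
  .cons (numComp_numIn hX) (.map (numComp_numIn hX) (numComp_inRank hX.fst .snd))

theorem listEmits_outputList (hX : IsInput X) : ListEmits fun γ => outputList (X γ) :=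
  .cons (numComp_numOut hX) (.map (numComp_numOut hX) (numComp_outRank hX.fst .snd))

theorem listEmits_encAlphabetList (hX : IsInput X) : ListEmits fun γ => encAlphabetList (X γ) := by
  have h := numComp_encBlock (numComp_maxInRank hX) (numComp_numCol hX)
  exact .cons (.add (.mul (numComp_numIn hX) h) (.const 1)) (.cons (.const 0)
    (.flatMap (numComp_numIn hX) (.replicate h.fst (.add (.add (.const 1)
      (numComp_inRank hX.fst .snd)) (numComp_numCol hX.fst)))))

theorem listEmits_encRhsList (hX : IsInput X) {a j d c : Γ → ℕ} (ha : NumComp a) (hj : NumComp j)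
    (hd : NumComp d) (hc : NumComp c) :
    ListEmits fun γ => encRhsList (X γ) (a γ) (j γ) (d γ) (c γ) := by
  have hm := numComp_maxInRank hX
  have hnc := numComp_numCol hX
  have hr := numComp_inRank hX ha
  have h1 := numComp_encIndex hm hnc ha hj hd hc
  have h2 := numComp_encChildState hm.fst hnc.fst hr.fst hj.fst hd.fst hc.fst
    (NumComp.snd (Γ := Γ))
  unfold encRhsList
  repeat' first
    | assumption
    | exact NumComp.const _
    | exact ListEmits.nil
    | refine ListEmits.ite ?_ ?_ ?_
    | refine ListEmits.cons ?_ ?_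
    | refine ListEmits.map ?_ ?_
    | refine NumComp.add ?_ ?_
    | refine NumComp.mul ?_ ?_
    | refine NumComp.sub ?_ ?_
    | refine NumComp.min ?_ ?_
    | refine PropComp.and ?_ ?_
    | refine PropComp.eq ?_ ?_
    | refine PropComp.ne ?_ ?_
    | refine PropComp.lt ?_ ?_
    | refine PropComp.le ?_ ?_

theorem listEmits_encTTList : ListEmits encTTList := by
  have hn := numComp_numIn isInput_id
  have hm := numComp_maxInRank isInput_id
  have hnc := numComp_numCol isInput_id
  have hst := numComp_encStates hm hnc
  have h1 : ∀ k, NumComp fun _ : List ℕ => k := NumComp.const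
  have h2 : NumComp fun x => numIn x * ((maxInRank x + 1) *
      ((2 * maxInRank x + 5) * (numCol x + 1))) :=
    .mul hn (.mul (.add hm (h1 1)) (.mul (.add (.mul (h1 2) hm) (h1 5)) (.add hnc (h1 1))))
  refine .append (.append (.append (.append (listEmits_inputList isInput_id)
    (listEmits_encAlphabetList isInput_id)) (.cons hst (.cons (h1 0) (.cons (h1 0) .nil))))
    (.map hst (.ite (.eq .snd (.add (.mul (.const 1) (.add hnc.fst (.const 1))) (.const 0)))
      (.const 1) (.const 0)))) (.cons h2 (.flatMap hn (.flatMap (.add hm.fst (.const 1))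
    (.flatMap (.add (.mul (.const 2) hm.fst.fst) (.const 5)) (.flatMap
      (.add hnc.fst.fst.fst (.const 1)) ?_)))))
  have ha := (NumComp.snd (Γ := List ℕ)).fst.fst.fst
  have hj := (NumComp.snd (Γ := List ℕ × ℕ)).fst.fst
  have hd := (NumComp.snd (Γ := (List ℕ × ℕ) × ℕ)).fst
  have hc := (NumComp.snd (Γ := ((List ℕ × ℕ) × ℕ) × ℕ))
  exact .cons (.add (.mul (.min hd (.add (.mul (.const 2) hm.fst.fst.fst.fst) (.const 3)))
    (.add hnc.fst.fst.fst.fst (.const 1))) hc) (.cons ha (.cons hj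
      (listEmits_encRhsList isInput_id.fst.fst.fst.fst ha hj hd hc)))

/-! ### Programs for the simulating transducer -/

/-- The condition `SimOK` for the rule at `o`. -/
def SimOKList (k : ℕ) (x : List ℕ) (o d c β : ℕ) : Prop :=
  if 1 ≤ c ∧ c ≤ numVis x then
    k ≠ 0 ∧ (∀ y < numVis x, 1 + y = c → (x.getD (o + (3 + y)) 0 = 1 ↔ d = 1)) ∧
      (β = 1 → d = 1 ∧ ∀ y < numInv x, x.getD (o + (3 + numVis x + y)) 0 ≠ 1) ∧
      (∑ y ∈ Finset.range (numVis x),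
        if x.getD (o + (3 + y)) 0 = 1 ∧ 1 + y ≠ c then 1 else 0) ≤ k - 1
  else β = 0 ∧ (∀ y < numVis x, x.getD (o + (3 + y)) 0 ≠ 1) ∧
    ∀ y < numInv x, (x.getD (o + (3 + numVis x + y)) 0 = 1 ↔ d = 1 ∧ c = 1 + numVis x + y)

instance {k : ℕ} {x : List ℕ} {o d c β : ℕ} : Decidable (SimOKList k x o d c β) := by
  unfold SimOKList; infer_instance

/-- The set of observable pebbles in the rules of the simulating transducer. -/
def simColoursList (k : ℕ) (x : List ℕ) (o d c β : ℕ) : List ℕ :=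
  ((List.range (numVis x)).map fun y => if SimOKList k x o d c β ∧ (1 ≤ c ∧ c ≤ numVis x) ∧
    x.getD (o + (3 + y)) 0 = 1 ∧ 1 + y ≠ c then 1 else 0) ++
  (List.range (numInv x + 1)).map fun y => if SimOKList k x o d c β ∧ (1 ≤ c ∧ c ≤ numVis x) ∧
    if y < numInv x then x.getD (o + (3 + numVis x + y)) 0 = 1 else β = 1 then 1 else 0

/-- The simulation of the instruction with kind `s` and argument `z`, with new state `q`. -/
def simActList (k n v i r d c β q₀ q s z : ℕ) : List ℕ :=
  if s = 0 then [0, q, 0, 0]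
  else if s = 1 then if d = 0 then [0, q, 1, 0] else [0, q, 2, 1]
  else if s = 2 then if d = z + 1 then [0, q, 1, 0] else [0, q, 2, 1 + z]
  else if s = 3 then
    if 1 ≤ c ∧ c ≤ v then if 1 + z = c then [0, q₀, 0, 0] else [0, q, 3, z]
    else if k = 0 then [0, q₀, 0, 0] else [0, n + q, 2, 1 + r + (1 + z)]
  else if s = 4 then
    if 1 ≤ c ∧ c ≤ v then [0, q, 4, z] else [0, q, 2, 1 + r + (1 + v + z)]
  else if s = 5 then
    if 1 ≤ c ∧ c ≤ v then
      if 1 + z = c then if β = 1 then [0, 2 * n + q, 6, i] else [0, q₀, 0, 0]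
      else [0, q, 5, z]
    else [0, q₀, 0, 0]
  else if 1 ≤ c ∧ c ≤ v then [0, q, 6, z] else [0, q, 1, 0]

/-- The simulation of the right-hand side of a rule, where the rule is at `o` and the right-hand
side is at `h`. -/
def simRhsList (k : ℕ) (x : List ℕ) (o h d c β : ℕ) : List ℕ :=
  if x.getD (o + h) 0 = 0 then
    simActList k (numStates x) (numVis x) (numInv x) (inRank x (x.getD (o + 1) 0)) d c β
      (x.getD o 0) (x.getD (o + (h + 1)) 0) (x.getD (o + (h + 2)) 0) (x.getD (o + (h + 3)) 0)
  else 1 :: x.getD (o + (h + 1)) 0 :: (List.range (outRank x (x.getD (o + (h + 1)) 0))).map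
    fun y => x.getD (o + (h + 2 + y)) 0

/-- The simulation of the rule at `o`. -/
def simRuleList (k : ℕ) (x : List ℕ) (o d c β : ℕ) : List ℕ :=
  [x.getD o 0, encIndex (maxInRank x) (numCol x) (x.getD (o + 1) 0) (x.getD (o + 2) 0) d c,
    encChildNo (inRank x (x.getD (o + 1) 0)) (x.getD (o + 2) 0) d c] ++
  (if k = 0 then [] else simColoursList k x o d c β) ++
  if SimOKList k x o d c β then simRhsList k x o (3 + numVis x + numInv x) d c β
    else [0, x.getD o 0, 0, 0]

/-- The rules `enterRule` and `exitRule`. -/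
def enterExitList (x : List ℕ) (a j q y : ℕ) : List ℕ :=
  [numStates x + q, encIndex (maxInRank x) (numCol x) a j 1 (1 + y),
    encChildNo (inRank x a) j 1 (1 + y)] ++ List.replicate (numVis x + (numInv x + 1)) 0 ++
    [0, q, 4, numInv x] ++
  ([2 * numStates x + q, encIndex (maxInRank x) (numCol x) a j 1 (1 + y),
    encChildNo (inRank x a) j 1 (1 + y)] ++ List.replicate (numVis x + (numInv x + 1)) 0 ++
    [0, q, 1, 0])

/-- The simulating transducer. -/
def simList (k : ℕ) (x : List ℕ) : List ℕ :=
  encAlphabetList x ++ outputList x ++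
    (3 * numStates x :: if k = 0 then [0, 0] else [numVis x, numInv x + 1]) ++
    (((List.range (numStates x)).map fun q => initBit x q) ++
      List.replicate (2 * numStates x) 0) ++
    (numRules x * ((maxInRank x + 2) * ((numCol x + 1) * 2)) +
      if k = 0 then 0 else numIn x * ((maxInRank x + 1) * (numStates x * (numVis x * 2)))) ::
    (((List.range (numRules x)).flatMap fun r => (List.range (maxInRank x + 2)).flatMap fun d =>
      (List.range (numCol x + 1)).flatMap fun c => (List.range 2).flatMap fun β =>
        simRuleList k x (ruleOffset x r) d c β) ++
    if k = 0 then [] else (List.range (numIn x)).flatMap fun a =>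
      (List.range (maxInRank x + 1)).flatMap fun j => (List.range (numStates x)).flatMap fun q =>
        (List.range (numVis x)).flatMap fun y => enterExitList x a j q y)

theorem numComp_encChildNo {r j d c : Γ → ℕ} (hr : NumComp r) (hj : NumComp j) (hd : NumComp d)
    (hc : NumComp c) : NumComp fun γ => encChildNo (r γ) (j γ) (d γ) (c γ) :=
  .ite (.eq hd (.const 0)) (.add (.const 1) hj) (.ite (.eq hd (.const 1))
    (.ite (.eq hc (.const 0)) (.const 0) (.add (.add (.const 1) hr) hc)) (.const 1))

theorem propComp_simOKList (k : ℕ) (hX : IsInput X) {o d c β : Γ → ℕ} (ho : NumComp o)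
    (hd : NumComp d) (hc : NumComp c) (hβ : NumComp β) :
    PropComp fun γ => SimOKList k (X γ) (o γ) (d γ) (c γ) (β γ) := by
  have hv := numComp_numVis hX
  have hi := numComp_numInv hX
  have h1 := NumComp.getD hX.fst (.add ho.fst (.add (.const 3) .snd))
  have h2 := NumComp.getD hX.fst (.add ho.fst (.add (.add (.const 3) hv.fst) .snd))
  have h3 := NumComp.snd (Γ := Γ)
  have hc' := hc.fst
  have hd' := hd.fst
  have hv' := hv.fst
  unfold SimOKList
  repeat' first
    | assumption
    | exact NumComp.const _
    | exact PropComp.const _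
    | refine PropComp.ite ?_ ?_ ?_
    | refine PropComp.iff ?_ ?_
    | refine PropComp.and ?_ ?_
    | refine PropComp.forall_lt ?_ ?_
    | refine PropComp.eq ?_ ?_
    | refine PropComp.ne ?_ ?_
    | refine PropComp.lt ?_ ?_
    | refine PropComp.le ?_ ?_
    | refine PropComp.imp ?_ ?_
    | refine NumComp.sum ?_ ?_
    | refine NumComp.ite ?_ ?_ ?_
    | refine NumComp.add ?_ ?_

theorem listEmits_simColoursList (k : ℕ) (hX : IsInput X) {o d c β : Γ → ℕ} (ho : NumComp o)
    (hd : NumComp d) (hc : NumComp c) (hβ : NumComp β) :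
    ListEmits fun γ => simColoursList k (X γ) (o γ) (d γ) (c γ) (β γ) := by
  have hv := numComp_numVis hX
  have hi := numComp_numInv hX
  have h1 := NumComp.getD hX.fst (.add ho.fst (.add (.const 3) .snd))
  have h2 := NumComp.getD hX.fst (.add ho.fst (.add (.add (.const 3) hv.fst) .snd))
  have h3 := NumComp.snd (Γ := Γ)
  have hc' := hc.fst
  have hβ' := hβ.fst
  have hv' := hv.fst
  have hi' := hi.fst
  have hok := propComp_simOKList k hX.fst ho.fst hd.fst hc.fst hβ.fst
  unfold simColoursList
  repeat' first
    | assumption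
    | exact NumComp.const _
    | refine ListEmits.append ?_ ?_
    | refine ListEmits.map ?_ ?_
    | refine NumComp.ite ?_ ?_ ?_
    | refine PropComp.ite ?_ ?_ ?_
    | refine PropComp.and ?_ ?_
    | refine PropComp.eq ?_ ?_
    | refine PropComp.ne ?_ ?_
    | refine PropComp.lt ?_ ?_
    | refine PropComp.le ?_ ?_
    | refine NumComp.add ?_ ?_

theorem listEmits_simActList (k : ℕ) {n v i r d c β q₀ q s z : Γ → ℕ} (hn : NumComp n)
    (hv : NumComp v) (hi : NumComp i) (hr : NumComp r) (hd : NumComp d) (hc : NumComp c)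
    (hβ : NumComp β) (hq₀ : NumComp q₀) (hq : NumComp q) (hs : NumComp s) (hz : NumComp z) :
    ListEmits fun γ => simActList k (n γ) (v γ) (i γ) (r γ) (d γ) (c γ) (β γ) (q₀ γ) (q γ) (s γ)
      (z γ) := by
  unfold simActList
  repeat' first
    | assumption
    | exact NumComp.const _
    | exact PropComp.const _
    | exact ListEmits.nil
    | refine ListEmits.ite ?_ ?_ ?_
    | refine ListEmits.cons ?_ ?_
    | refine PropComp.and ?_ ?_
    | refine PropComp.eq ?_ ?_
    | refine PropComp.le ?_ ?_
    | refine NumComp.add ?_ ?_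
    | refine NumComp.mul ?_ ?_

theorem listEmits_simRhsList (k : ℕ) (hX : IsInput X) {o h d c β : Γ → ℕ} (ho : NumComp o)
    (hh : NumComp h) (hd : NumComp d) (hc : NumComp c) (hβ : NumComp β) :
    ListEmits fun γ => simRhsList k (X γ) (o γ) (h γ) (d γ) (c γ) (β γ) := by
  have h1 : ∀ k, NumComp fun _ : Γ => k := NumComp.const
  have h2 : ∀ l, NumComp fun γ => (X γ).getD (o γ + (h γ + l)) 0 := fun l =>
    .getD hX (.add ho (.add hh (h1 l)))
  exact .ite (.eq (.getD hX (.add ho hh)) (h1 0))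
    (listEmits_simActList k (numComp_numStates hX) (numComp_numVis hX) (numComp_numInv hX)
      (numComp_inRank hX (.getD hX (.add ho (h1 1)))) hd hc hβ (.getD hX ho) (h2 1) (h2 2) (h2 3))
    (.cons (h1 1) (.cons (h2 1) (.map (numComp_outRank hX (h2 1))
      (.getD hX.fst (.add ho.fst (.add (.add hh.fst (.const 2)) .snd))))))

theorem listEmits_simRuleList (k : ℕ) (hX : IsInput X) {o d c β : Γ → ℕ} (ho : NumComp o)
    (hd : NumComp d) (hc : NumComp c) (hβ : NumComp β) :
    ListEmits fun γ => simRuleList k (X γ) (o γ) (d γ) (c γ) (β γ) := by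
  have h1 : ∀ k, NumComp fun _ : Γ => k := NumComp.const
  have h2 : ∀ l, NumComp fun γ => (X γ).getD (o γ + l) 0 := fun l =>
    .getD hX (.add ho (h1 l))
  refine .append (.append (.cons (.getD hX ho) (.cons (numComp_encIndex (numComp_maxInRank hX)
    (numComp_numCol hX) (h2 1) (h2 2) hd hc) (.cons (numComp_encChildNo (numComp_inRank hX (h2 1))
    (h2 2) hd hc) .nil))) (.ite (.const _) .nil (listEmits_simColoursList k hX ho hd hc hβ)))
    (.ite (propComp_simOKList k hX ho hd hc hβ) (listEmits_simRhsList k hX ho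
      (.add (.add (h1 3) (numComp_numVis hX)) (numComp_numInv hX)) hd hc hβ)
      (.cons (h1 0) (.cons (.getD hX ho) (.cons (h1 0) (.cons (h1 0) .nil)))))

theorem listEmits_enterExitList (hX : IsInput X) {a j q y : Γ → ℕ} (ha : NumComp a)
    (hj : NumComp j) (hq : NumComp q) (hy : NumComp y) :
    ListEmits fun γ => enterExitList (X γ) (a γ) (j γ) (q γ) (y γ) := by
  have h1 : ∀ k, NumComp fun _ : Γ => k := NumComp.const
  have h2 := numComp_encIndex (numComp_maxInRank hX) (numComp_numCol hX) ha hj (h1 1)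
    (.add (h1 1) hy)
  have h3 := numComp_encChildNo (numComp_inRank hX ha) hj (h1 1) (.add (h1 1) hy)
  have h4 := ListEmits.replicate (.add (numComp_numVis hX) (.add (numComp_numInv hX) (h1 1))) (h1 0)
  have hn := numComp_numStates hX
  exact .append (.append (.append (.cons (.add hn hq) (.cons h2 (.cons h3 .nil))) h4)
    (.cons (h1 0) (.cons hq (.cons (h1 4) (.cons (numComp_numInv hX) .nil)))))
    (.append (.append (.cons (.add (.mul (h1 2) hn) hq) (.cons h2 (.cons h3 .nil))) h4)
    (.cons (h1 0) (.cons hq (.cons (h1 1) (.cons (h1 0) .nil)))))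

theorem listEmits_simList (k : ℕ) : ListEmits (simList k) := by
  have h1 : ∀ k, NumComp fun _ : List ℕ => k := NumComp.const
  have hn := numComp_numIn isInput_id
  have hm := numComp_maxInRank isInput_id
  have hnc := numComp_numCol isInput_id
  have hv := numComp_numVis isInput_id
  have hi := numComp_numInv isInput_id
  have hst := numComp_numStates isInput_id
  have hr := numComp_numRules isInput_id
  have h2 : NumComp fun x => numRules x * ((maxInRank x + 2) * ((numCol x + 1) * 2)) +
      if k = 0 then 0 else numIn x * ((maxInRank x + 1) * (numStates x * (numVis x * 2))) :=
    .add (.mul hr (.mul (.add hm (h1 2)) (.mul (.add hnc (h1 1)) (h1 2)))) (.ite (.const _) (h1 0)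
      (.mul hn (.mul (.add hm (h1 1)) (.mul hst (.mul hv (h1 2))))))
  have h3 : ListEmits fun x => (List.range (numRules x)).flatMap fun r =>
      (List.range (maxInRank x + 2)).flatMap fun d => (List.range (numCol x + 1)).flatMap fun c =>
        (List.range 2).flatMap fun β => simRuleList k x (ruleOffset x r) d c β :=
    .flatMap hr (.flatMap (.add hm.fst (.const 2)) (.flatMap (.add hnc.fst.fst (.const 1))
      (.flatMap (.const 2) (listEmits_simRuleList k isInput_id.fst.fst.fst.fst
        (numComp_ruleOffset isInput_id.fst.fst.fst.fst NumComp.snd.fst.fst.fst) NumComp.snd.fst.fst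
          NumComp.snd.fst .snd))))
  have h4 : ListEmits fun x => (List.range (numIn x)).flatMap fun a =>
      (List.range (maxInRank x + 1)).flatMap fun j => (List.range (numStates x)).flatMap fun q =>
        (List.range (numVis x)).flatMap fun y => enterExitList x a j q y :=
    .flatMap hn (.flatMap (.add hm.fst (.const 1)) (.flatMap hst.fst.fst (.flatMap hv.fst.fst.fst
      (listEmits_enterExitList isInput_id.fst.fst.fst.fst NumComp.snd.fst.fst.fst
        NumComp.snd.fst.fst NumComp.snd.fst .snd))))
  exact .append (.append (.append (.append (listEmits_encAlphabetList isInput_id)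
    (listEmits_outputList isInput_id)) (.cons (.mul (h1 3) hst) (.ite (.const _)
      (.cons (h1 0) (.cons (h1 0) .nil)) (.cons hv (.cons (.add hi (h1 1)) .nil)))))
    (.append (.map hst (numComp_initBit isInput_id.fst .snd)) (.replicate (.mul (h1 2) hst) (h1 0))))
    (.cons h2 (.append h3 (.ite (.const _) .nil h4)))

/-- The chain of transducers. -/
def chainList : ℕ → List ℕ → List ℕ
  | 0, x => encTTList x ++ simList 0 x
  | k + 1, x => encTTList x ++ chainList k (simList (k + 1) x)

/-- Each stage may enlarge the transducer polynomially; as `k` is fixed, only a constant number of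
polynomials is composed. -/
theorem listComp_chainList (k : ℕ) : ListComp (chainList k) := by
  induction k with
  | zero => exact (ListEmits.append listEmits_encTTList (listEmits_simList 0)).listComp
  | succ k ih => exact ListEmits.listComp_append listEmits_encTTList (listEmits_simList (k + 1)) ih

end PebbleTree

namespace PebbleTree

/-! ### Lists -/

theorem flatMap_finRange {α : Type} {n : ℕ} {f : Fin n → List α} {g : ℕ → List α}
    (h : ∀ a : Fin n, f a = g a) : (List.finRange n).flatMap f = (List.range n).flatMap g := by
  rw [← List.map_coe_finRange_eq_range, List.flatMap_map]
  exact List.flatMap_congr fun a _ => h a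

theorem map_finRange {α : Type} {n : ℕ} {f : Fin n → α} {g : ℕ → α} (h : ∀ a : Fin n, f a = g a) :
    (List.finRange n).map f = (List.range n).map g := by
  rw [← List.map_coe_finRange_eq_range, List.map_map]
  exact List.map_congr_left fun a _ => h a

theorem ofFn_eq_map_range {α : Type} {n n' : ℕ} {f : Fin n → α} {g : ℕ → α} (hn : n = n')
    (h : ∀ a : Fin n, f a = g a) : List.ofFn f = (List.range n').map g := by
  subst hn
  rw [List.ofFn_eq_map, map_finRange h]

theorem flatMap_eq_flatMap_range {α β : Type} {l : List α} {f : α → List β} {g : ℕ → List β}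
    (h : ∀ (y : ℕ) (hy : y < l.length), f l[y] = g y) :
    l.flatMap f = (List.range l.length).flatMap g := by
  rw [← flatMap_finRange (f := fun y => f (l.get y)) fun y => h y y.isLt]
  conv_lhs => rw [← List.map_get_finRange l]
  rw [List.flatMap_map]

theorem length_flatMap_const {α β : Type} {l : List α} {f : α → List β} {m : ℕ}
    (h : ∀ a ∈ l, (f a).length = m) : (l.flatMap f).length = l.length * m := by
  rw [List.length_flatMap, List.map_congr_left (g := fun _ => m) h]
  simp

/-- `encRanks` finds the input symbol of a number by division, while the program, having no
division, writes the ranks block by block. -/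
theorem map_div_range (n B : ℕ) (f : ℕ → ℕ) :
    ((List.range (n * B)).map fun y => f (y / B)) =
      (List.range n).flatMap fun a => List.replicate B (f a) := by
  induction n with
  | zero => simp
  | succ n ih =>
    rw [Nat.succ_mul, List.range_add, List.map_append, ih, List.range_succ, List.flatMap_append]
    congr 1
    rw [List.map_map]
    simp only [List.flatMap_cons, List.flatMap_nil, List.append_nil]
    rw [List.eq_replicate_iff]
    refine ⟨by simp, fun b hb => ?_⟩
    obtain ⟨y, hy, rfl⟩ := List.mem_map.1 hb
    have hy := List.mem_range.1 hy
    simp only [Function.comp_apply]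
    rw [mul_comm, Nat.mul_add_div (by omega), Nat.div_eq_of_lt hy, add_zero]

theorem getD_drop (l : List ℕ) (o m : ℕ) : (l.drop o).getD m 0 = l.getD (o + m) 0 := by
  simp [List.getD_eq_getElem?_getD, List.getElem?_drop]

theorem getD_append_add (A B : List ℕ) (m : ℕ) : (A ++ B).getD (A.length + m) 0 = B.getD m 0 := by
  rw [List.getD_append_right _ _ _ _ (by omega), Nat.add_sub_cancel_left]

theorem getD_append_of_length {A B : List ℕ} {n m : ℕ} (h : A.length = n) :
    (A ++ B).getD (n + m) 0 = B.getD m 0 := by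
  subst h
  exact getD_append_add A B m

theorem drop_append_of_length {A B : List ℕ} {n m : ℕ} (h : A.length = n) :
    (A ++ B).drop (n + m) = B.drop m := by
  subst h
  exact List.drop_length_add_append _

theorem getD_append_lt {A B : List ℕ} {m : ℕ} (h : m < A.length) :
    (A ++ B).getD m 0 = A.getD m 0 := List.getD_append _ _ _ _ h

/-- The sum counts the numbers that fail to bound all values, and these are the numbers below the
maximum. Counting up to the sum of the values is enough, since the maximum does not exceed it. -/
theorem sup_eq_sum {n : ℕ} {f : Fin n → ℕ} {g : ℕ → ℕ} (h : ∀ a : Fin n, g a = f a) :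
    (∑ y ∈ Finset.range (∑ a ∈ Finset.range n, g a), if ∀ a < n, g a ≤ y then 0 else 1) =
      Finset.univ.sup f := by
  have h1 : ∀ y, (∀ a < n, g a ≤ y) ↔ Finset.univ.sup f ≤ y := by
    intro y
    rw [Finset.sup_le_iff]
    constructor
    · intro h' a _; rw [← h]; exact h' a a.isLt
    · intro h' a ha; exact (h ⟨a, ha⟩).le.trans (h' ⟨a, ha⟩ (Finset.mem_univ _))
  have h2 : Finset.univ.sup f ≤ ∑ a ∈ Finset.range n, g a := by
    refine Finset.sup_le fun a _ => ?_
    rw [← h]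
    exact Finset.single_le_sum (f := g) (fun _ _ => Nat.zero_le _) (Finset.mem_range.2 a.isLt)
  simp only [h1]
  generalize Finset.univ.sup f = m at *
  generalize ∑ a ∈ Finset.range n, g a = T at *
  have h3 : ∀ y, (if m ≤ y then 0 else 1) = if y < m then 1 else 0 := by
    intro y; split_ifs <;> omega
  simp only [h3]
  rw [← Finset.card_filter, show (Finset.range T).filter (· < m) = Finset.range m by
    ext y; simp only [Finset.mem_filter, Finset.mem_range]; omega, Finset.card_range]

theorem map_range_getD (l : List ℕ) : ((List.range l.length).map fun a => l.getD a 0) = l := by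
  conv_rhs => rw [← List.map_get_finRange l]
  rw [← map_finRange (f := l.get)]
  intro a
  rw [List.getD_eq_getElem _ _ a.isLt, List.get_eq_getElem]

/-! ### Access to presentations -/

section Access

variable {input output : List ℕ} {n v i k : ℕ}
  (M : PTT (.ofRanks input) (.ofRanks output) (Fin n) (Fin v) (Fin i) k)

theorem length_bits {n : ℕ} (s : Finset (Fin n)) : (bits s).length = n := by simp [bits]

theorem getD_bits {n : ℕ} (s : Finset (Fin n)) (q : Fin n) :
    (bits s).getD q 0 = if q ∈ s then 1 else 0 := by
  rw [List.getD_eq_getElem _ _ (by rw [length_bits]; exact q.isLt)]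
  simp [bits]

theorem PTT.serialize_eq : M.serialize = input.length :: (input ++ output.length :: (output ++
    n :: v :: i :: (bits M.init ++ M.rules.length :: M.rules.flatMap Rule.serialize))) := by
  simp [PTT.serialize, lengthPrefixed]

theorem numIn_serialize : numIn M.serialize = input.length := by
  rw [numIn, PTT.serialize_eq, List.getD_cons_zero]

theorem inRank_serialize {a : ℕ} (ha : a < input.length) :
    inRank M.serialize a = input.getD a 0 := by
  rw [inRank, PTT.serialize_eq, add_comm, List.getD_cons_succ, getD_append_lt ha]

theorem serialize_getD₁ (m : ℕ) : M.serialize.getD (1 + numIn M.serialize + m) 0 =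
    (output.length :: (output ++
      n :: v :: i :: (bits M.init ++ M.rules.length :: M.rules.flatMap Rule.serialize))).getD m 0 := by
  rw [numIn_serialize, PTT.serialize_eq, show 1 + input.length + m = (input.length + m) + 1 by omega,
    List.getD_cons_succ, getD_append_add]

theorem numOut_serialize : numOut M.serialize = output.length := by
  rw [numOut, ← add_zero (1 + numIn M.serialize), serialize_getD₁, List.getD_cons_zero]

theorem outRank_serialize {a : ℕ} (ha : a < output.length) :
    outRank M.serialize a = output.getD a 0 := by
  rw [outRank, show 2 + numIn M.serialize + a = 1 + numIn M.serialize + (a + 1) by omega,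
    serialize_getD₁, List.getD_cons_succ, getD_append_lt ha]

theorem serialize_getD₂ (m : ℕ) :
    M.serialize.getD (2 + numIn M.serialize + numOut M.serialize + m) 0 =
      (n :: v :: i :: (bits M.init ++ M.rules.length :: M.rules.flatMap Rule.serialize)).getD m 0 := by
  rw [numOut_serialize, show 2 + numIn M.serialize + output.length + m =
    1 + numIn M.serialize + ((output.length + m) + 1) by omega, serialize_getD₁,
    List.getD_cons_succ, getD_append_add]

theorem numStates_serialize : numStates M.serialize = n := by
  rw [numStates, ← add_zero (2 + numIn M.serialize + numOut M.serialize), serialize_getD₂,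
    List.getD_cons_zero]

theorem numVis_serialize : numVis M.serialize = v := by
  rw [numVis, show 3 + numIn M.serialize + numOut M.serialize =
    2 + numIn M.serialize + numOut M.serialize + 1 by omega, serialize_getD₂]; rfl

theorem numInv_serialize : numInv M.serialize = i := by
  rw [numInv, show 4 + numIn M.serialize + numOut M.serialize =
    2 + numIn M.serialize + numOut M.serialize + 2 by omega, serialize_getD₂]; rfl

theorem initBit_serialize (q : Fin n) : initBit M.serialize q = if q ∈ M.init then 1 else 0 := by
  rw [initBit, show 5 + numIn M.serialize + numOut M.serialize + q =
    2 + numIn M.serialize + numOut M.serialize + (q + 1 + 1 + 1) by omega, serialize_getD₂,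
    List.getD_cons_succ, List.getD_cons_succ, List.getD_cons_succ,
    getD_append_lt (by rw [length_bits]; exact q.isLt), getD_bits]

theorem numRules_serialize : numRules M.serialize = M.rules.length := by
  rw [numRules, numStates_serialize, show 5 + numIn M.serialize + numOut M.serialize + n =
    2 + numIn M.serialize + numOut M.serialize + ((n + 0) + 1 + 1 + 1) by omega, serialize_getD₂,
    List.getD_cons_succ, List.getD_cons_succ, List.getD_cons_succ]
  exact getD_append_of_length (m := 0) (length_bits _)

theorem drop_serialize : M.serialize.drop (6 + numIn M.serialize + numOut M.serialize +
    numStates M.serialize) = M.rules.flatMap Rule.serialize := by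
  rw [numIn_serialize, numOut_serialize, numStates_serialize, PTT.serialize_eq,
    show 6 + input.length + output.length + n = input.length + (output.length + (n + 1 + 1 + 1 + 1)
      + 1) + 1 by omega, List.drop_succ_cons, List.drop_length_add_append, List.drop_succ_cons,
    List.drop_length_add_append, List.drop_succ_cons, List.drop_succ_cons, List.drop_succ_cons,
    drop_append_of_length (length_bits _), List.drop_succ_cons, List.drop_zero]

theorem numCol_serialize : numCol M.serialize = v + i := by
  rw [numCol, numVis_serialize, numInv_serialize]

theorem inRank_serialize_fin (a : Fin input.length) :
    inRank M.serialize a = (RankedAlphabet.ofRanks input).rank a := by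
  rw [inRank_serialize _ a.isLt, List.getD_eq_getElem _ _ a.isLt]; rfl

theorem outRank_serialize_fin (a : Fin output.length) :
    outRank M.serialize a = (RankedAlphabet.ofRanks output).rank a := by
  rw [outRank_serialize _ a.isLt, List.getD_eq_getElem _ _ a.isLt]; rfl

theorem maxInRank_serialize :
    maxInRank M.serialize = (RankedAlphabet.ofRanks input).maxRank := by
  rw [maxInRank, numIn_serialize]
  exact sup_eq_sum (inRank_serialize_fin M)

theorem inputList_serialize : inputList M.serialize = lengthPrefixed input := by
  rw [inputList, lengthPrefixed, numIn_serialize]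
  congr 1
  conv_rhs => rw [← map_range_getD input]
  exact List.map_congr_left fun a ha => inRank_serialize M (List.mem_range.1 ha)

theorem outputList_serialize : outputList M.serialize = lengthPrefixed output := by
  rw [outputList, lengthPrefixed, numOut_serialize]
  congr 1
  conv_rhs => rw [← map_range_getD output]
  exact List.map_congr_left fun a ha => outRank_serialize M (List.mem_range.1 ha)

theorem encRankList_serialize : encRankList M.serialize =
    encRanks (S := .ofRanks input) (Equiv.refl (Fin input.length)) (v + i) := by
  rw [encRankList, encRanks, numIn_serialize, maxInRank_serialize, numCol_serialize]
  refine congrArg (0 :: ·) (Eq.trans ?_ (map_div_range input.length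
    (encBlock (RankedAlphabet.ofRanks input).maxRank (v + i)) fun a =>
      1 + (((List.finRange input.length).map fun a => (RankedAlphabet.ofRanks input).rank
        ((Equiv.refl (Fin input.length)).symm a)).getD a 0) + (v + i)).symm)
  refine List.flatMap_congr fun a ha => ?_
  rw [inRank_serialize M (List.mem_range.1 ha)]
  have h : ((List.finRange input.length).map fun a => (RankedAlphabet.ofRanks input).rank
    ((Equiv.refl (Fin input.length)).symm a)) = input := List.map_get_finRange input
  rw [h]

theorem encAlphabetList_serialize : encAlphabetList M.serialize = lengthPrefixed
    (encRanks (S := .ofRanks input) (Equiv.refl (Fin input.length)) (v + i)) := by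
  rw [encAlphabetList, lengthPrefixed, encRankList_serialize, length_encRanks, numIn_serialize,
    maxInRank_serialize, numCol_serialize]

end Access

/-! ### The encoding transducer -/

section EncodingProgram

variable {input output : List ℕ} {n v i k : ℕ}
  (M : PTT (.ofRanks input) (.ofRanks output) (Fin n) (Fin v) (Fin i) k)

theorem bits_fin_zero (s : Finset (Fin 0)) : bits s = [] := rfl

theorem encChildState_eq {m nc r j d c y : ℕ} (hr : r ≤ m) (hc : c ≤ nc) (hy : y < 1 + r + nc) :
    (encState m nc (encChild m r j d c y).1 (encChild m r j d c y).2 : ℕ) =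
      encChildState m nc r j d c y := by
  obtain ⟨h1, h2⟩ := encChild_le (nc := nc) (j := j) (d := d) (c := c) (x := y) hr hc hy
  rw [val_encState h1 h2]
  unfold encChild encChildState
  split_ifs <;> rfl

theorem serialize_encRule {a : Fin input.length} {j x c : ℕ}
    (hj : j ≤ (RankedAlphabet.ofRanks input).maxRank)
    (hc : c ≤ v + i) :
    (encRule (S := .ofRanks input) (Equiv.refl (Fin input.length)) (v + i) a j x c).serialize =
      encRuleList M.serialize a j x c := by
  have hm := maxInRank_serialize M
  have hnc := numCol_serialize M
  have hr := inRank_serialize_fin M a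
  have hra := (RankedAlphabet.ofRanks input).rank_le_maxRank a
  simp only [Rule.serialize, encRule, bits_fin_zero, encRuleList, hm, hnc, List.append_nil,
    val_encState (nc := v + i) (min_le_right x (2 * (RankedAlphabet.ofRanks input).maxRank + 3)) hc,
    List.cons_append, List.nil_append]
  congr 3
  unfold encRhs encRhsList
  simp only [hm, hnc, hr]
  split_ifs with h1 h2 h3 h4 h5
  · rw [Rhs.serialize, val_encSym hj h1 hc]
    congr 2
    refine ofFn_eq_map_range (rank_encSym hj h1 hc) fun y => ?_
    refine encChildState_eq hra hc ?_
    rw [← rank_encSym (e := Equiv.refl (Fin input.length)) hj h1 hc]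
    exact y.isLt
  · simp only [Rhs.serialize, Instr.serialize]
    rw [val_encState (by omega) hc]
  · simp only [Rhs.serialize, Instr.serialize]
    rw [val_encState (by omega) hc]
  · rfl
  · simp only [Rhs.serialize, Instr.serialize]
    rw [val_encState (by omega) hc]
  · simp only [Rhs.serialize, Instr.serialize]
    rw [val_encState (by omega) hc]

theorem encTTList_serialize : encTTList M.serialize =
    (encTT (S := .ofRanks input) (Equiv.refl (Fin input.length)) (v + i)).serialize := by
  have hm := maxInRank_serialize M
  have hnc := numCol_serialize M
  have hn := numIn_serialize M
  rw [encTTList, inputList_serialize, encAlphabetList_serialize, hm, hnc, hn]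
  have h1 : bits (encTT (S := .ofRanks input) (Equiv.refl (Fin input.length)) (v + i)).init =
      (List.range (encStates (RankedAlphabet.ofRanks input).maxRank (v + i))).map fun q =>
        if q = 1 * (v + i + 1) + 0 then 1 else 0 := by
    refine map_finRange fun q => ?_
    simp only [encTT, Finset.mem_singleton, Fin.ext_iff]
    rw [val_encState (by omega) (by omega)]
  have h2 : (encTT (S := .ofRanks input) (Equiv.refl (Fin input.length)) (v + i)).rules.length =
      input.length * (((RankedAlphabet.ofRanks input).maxRank + 1) *
        ((2 * (RankedAlphabet.ofRanks input).maxRank + 5) * (v + i + 1))) := by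
    rw [encTT, length_flatMap_const, List.length_finRange]
    intro a _
    rw [length_flatMap_const, List.length_range]
    intro j _
    rw [length_flatMap_const, List.length_range]
    intro x _
    simp
  have h3 : (encTT (S := .ofRanks input) (Equiv.refl (Fin input.length))
      (v + i)).rules.flatMap Rule.serialize = (List.range input.length).flatMap fun a =>
        (List.range ((RankedAlphabet.ofRanks input).maxRank + 1)).flatMap fun j =>
          (List.range (2 * (RankedAlphabet.ofRanks input).maxRank + 5)).flatMap fun x =>
            (List.range (v + i + 1)).flatMap fun c => encRuleList M.serialize a j x c := by
    rw [encTT, List.flatMap_assoc]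
    refine flatMap_finRange fun a => ?_
    rw [List.flatMap_assoc]
    refine List.flatMap_congr fun j hj => ?_
    rw [List.flatMap_assoc]
    refine List.flatMap_congr fun x hx => ?_
    rw [List.flatMap_map]
    refine List.flatMap_congr fun c hc => ?_
    simp only [List.mem_range] at hj hx hc
    exact serialize_encRule M (by omega) (by omega)
  conv_rhs => rw [PTT.serialize]
  rw [h1, h2, h3]

end EncodingProgram

end PebbleTree

namespace PebbleTree

/-! ### Access to rules -/

section RuleAccess

variable {input output : List ℕ} {n v i k : ℕ}

theorem Instr.length_serialize (α : Instr (Fin v) (Fin i)) : α.serialize.length = 2 := by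
  rcases α with _ | _ | t | (y | y) | (y | y) <;> rfl

variable {r : Rule (.ofRanks input) (.ofRanks output) (Fin n) (Fin v) (Fin i)} {x rest : List ℕ}
  {o : ℕ}

theorem Rule.serialize_append : r.serialize ++ rest = (r.q : ℕ) :: Fin.val (n := input.length) r.a ::
    r.j :: (bits r.b.toLeft ++ (bits r.b.toRight ++ (r.rhs.serialize ++ rest))) := by
  simp [Rule.serialize]

theorem getD_rule (h : x.drop o = r.serialize ++ rest) (m : ℕ) :
    x.getD (o + m) 0 = ((r.q : ℕ) :: Fin.val (n := input.length) r.a ::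
      r.j :: (bits r.b.toLeft ++ (bits r.b.toRight ++ (r.rhs.serialize ++ rest)))).getD m 0 := by
  rw [← getD_drop, h, Rule.serialize_append]

theorem getD_rule_q (h : x.drop o = r.serialize ++ rest) : x.getD o 0 = r.q :=
  getD_rule h 0

theorem getD_rule_a (h : x.drop o = r.serialize ++ rest) :
    x.getD (o + 1) 0 = Fin.val (n := input.length) r.a :=
  getD_rule h 1

theorem getD_rule_j (h : x.drop o = r.serialize ++ rest) : x.getD (o + 2) 0 = r.j :=
  getD_rule h 2

theorem getD_rule_inl (h : x.drop o = r.serialize ++ rest) (y : Fin v) :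
    x.getD (o + (3 + y)) 0 = if .inl y ∈ r.b then 1 else 0 := by
  rw [getD_rule h, show 3 + (y : ℕ) = y + 1 + 1 + 1 by omega, List.getD_cons_succ,
    List.getD_cons_succ, List.getD_cons_succ, getD_append_lt (by rw [length_bits]; exact y.isLt),
    getD_bits]
  simp only [Finset.mem_toLeft]

theorem getD_rule_inr (h : x.drop o = r.serialize ++ rest) (y : Fin i) :
    x.getD (o + (3 + v + y)) 0 = if .inr y ∈ r.b then 1 else 0 := by
  rw [getD_rule h, show 3 + v + (y : ℕ) = (v + y) + 1 + 1 + 1 by omega, List.getD_cons_succ,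
    List.getD_cons_succ, List.getD_cons_succ, getD_append_of_length (length_bits _),
    getD_append_lt (by rw [length_bits]; exact y.isLt), getD_bits]
  simp only [Finset.mem_toRight]

theorem getD_rule_rhs (h : x.drop o = r.serialize ++ rest) (m : ℕ) :
    x.getD (o + (3 + v + i + m)) 0 = (r.rhs.serialize ++ rest).getD m 0 := by
  rw [getD_rule h, show 3 + v + i + m = (v + (i + m)) + 1 + 1 + 1 by omega, List.getD_cons_succ,
    List.getD_cons_succ, List.getD_cons_succ, getD_append_of_length (length_bits _),
    getD_append_of_length (length_bits _)]

variable (M : PTT (.ofRanks input) (.ofRanks output) (Fin n) (Fin v) (Fin i) k)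

/-- The part before the right-hand side has fixed length, an instruction takes two numbers, and for
an output rule the rank of its symbol gives the number of states. -/
theorem ruleLength_serialize (h : M.serialize.drop o = r.serialize ++ rest) :
    ruleLength M.serialize o = r.serialize.length := by
  have h0 := getD_rule_rhs h 0
  have h1 := getD_rule_rhs h 1
  rw [ruleLength, numVis_serialize, numInv_serialize, show 4 + v + i = 3 + v + i + 1 by omega,
    ← add_zero (3 + v + i), h0, add_zero, h1]
  simp only [Rule.serialize, List.length_append, length_bits, List.length_cons, List.length_nil]
  rcases hr : r.rhs with ⟨q, α⟩ | ⟨y, qs⟩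
  · simp [Rhs.serialize, Instr.length_serialize]
  · have := outRank_serialize_fin M y
    simp only [Rhs.serialize, List.cons_append, List.getD_cons_zero, List.getD_cons_succ,
      List.length_cons, List.length_ofFn, this]
    simp only [one_ne_zero, if_false]
    omega

theorem drop_ruleOffset {ρ : ℕ} (hρ : ρ ≤ M.rules.length) :
    M.serialize.drop (ruleOffset M.serialize ρ) = (M.rules.drop ρ).flatMap Rule.serialize := by
  induction ρ with
  | zero => exact drop_serialize M
  | succ ρ ih =>
    have ih := ih (by omega)
    rw [List.drop_eq_getElem_cons (show ρ < M.rules.length by omega), List.flatMap_cons] at ih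
    have hl := ruleLength_serialize M ih
    rw [ruleOffset, Function.iterate_succ_apply', ← ruleOffset, hl]
    have h2 := congrArg (List.drop M.rules[ρ].serialize.length) ih
    rw [List.drop_drop, List.drop_left] at h2
    rw [← h2]
    -- The truncation in `ruleOffset` is harmless: past the end, nothing is left in either case.
    rcases le_total (ruleOffset M.serialize ρ + M.rules[ρ].serialize.length) M.serialize.length
      with h3 | h3
    · rw [min_eq_left h3]
    · rw [min_eq_right h3, List.drop_eq_nil_of_le h3, List.drop_eq_nil_of_le le_rfl]

theorem exists_drop_ruleOffset {ρ : ℕ} (hρ : ρ < M.rules.length) :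
    ∃ rest, M.serialize.drop (ruleOffset M.serialize ρ) = M.rules[ρ].serialize ++ rest := by
  rw [drop_ruleOffset M hρ.le, List.drop_eq_getElem_cons hρ, List.flatMap_cons]
  exact ⟨_, rfl⟩

end RuleAccess

/-! ### The simulating transducer -/

section SimulationProgram

variable {input output : List ℕ} {n v i k : ℕ}
  (M : PTT (.ofRanks input) (.ofRanks output) (Fin n) (Fin v) (Fin i) k)
  {r : Rule (.ofRanks input) (.ofRanks output) (Fin n) (Fin v) (Fin i)} {rest : List ℕ}
  {o d c β : ℕ}

theorem ite_one_zero_eq_one {p : Prop} [Decidable p] : (if p then 1 else 0) = 1 ↔ p := by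
  split_ifs with h <;> simp [h]

theorem simOKList_iff (h : M.serialize.drop o = r.serialize ++ rest) :
    SimOKList k M.serialize o d c β ↔ SimOK k r.b d c β := by
  have h1 : (∑ y ∈ Finset.range v,
      if M.serialize.getD (o + (3 + y)) 0 = 1 ∧ 1 + y ≠ c then 1 else 0) =
      (Finset.univ.filter fun y : Fin v => .inl y ∈ r.b ∧ 1 + (y : ℕ) ≠ c).card := by
    rw [Finset.sum_range, Finset.card_filter]
    refine Finset.sum_congr rfl fun y _ => ?_
    simp only [getD_rule_inl h, ite_one_zero_eq_one]
  have h2 : ∀ p : ℕ → Prop, (∀ y < v, p y) ↔ ∀ y : Fin v, p y := fun p =>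
    (Fin.forall_iff (p := fun y : Fin v => p y)).symm
  have h3 : ∀ p : ℕ → Prop, (∀ y < i, p y) ↔ ∀ y : Fin i, p y := fun p =>
    (Fin.forall_iff (p := fun y : Fin i => p y)).symm
  simp only [SimOKList, SimOK, numVis_serialize, numInv_serialize, h1, h2, h3,
    getD_rule_inl h, getD_rule_inr h, ite_one_zero_eq_one, ne_eq]
  by_cases hc : 1 ≤ c ∧ c ≤ v
  · simp only [simColours, IsVisibleNo, Finset.toLeft_disjSum,
      hc, true_and, ne_eq]
  · simp only [if_neg (show ¬ IsVisibleNo v c from hc), if_neg hc]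

theorem simColoursList_eq (h : M.serialize.drop o = r.serialize ++ rest) :
    simColoursList k M.serialize o d c β =
      bits (if SimOK k r.b d c β then simColours r.b c β else ∅).toLeft ++
      bits (if SimOK k r.b d c β then simColours r.b c β else ∅).toRight := by
  rw [simColoursList, numVis_serialize, numInv_serialize]
  simp only [simOKList_iff M h]
  refine congrArg₂ (· ++ ·) (map_finRange fun y => ?_).symm (map_finRange fun y => ?_).symm
  · simp only [getD_rule_inl h, ite_one_zero_eq_one, Finset.mem_toLeft]
    refine if_congr ?_ rfl rfl
    split_ifs with hok
    · rw [mem_simColours_inl]; simp [hok, IsVisibleNo]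
    · simp [hok]
  · simp only [Finset.mem_toRight]
    refine if_congr ?_ rfl rfl
    by_cases hok : SimOK k r.b d c β
    · rw [if_pos hok]
      induction y using Fin.lastCases with
      | last =>
        rw [mem_simColours_last, Fin.val_last, if_neg (lt_irrefl _)]
        simp [hok, IsVisibleNo]
      | cast y =>
        rw [mem_simColours_inr, Fin.val_castSucc, if_pos y.isLt, getD_rule_inr h,
          ite_one_zero_eq_one]
        simp [hok, IsVisibleNo]
    · simp [hok]

theorem serialize_simRhs_act_of_isVisibleNo {ρ : ℕ} {q₀ q : Fin n} (hc : IsVisibleNo v c)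
    (α : Instr (Fin v) (Fin i)) :
    (simRhs (D := .ofRanks output) k ρ d c β q₀ (.act q α)).serialize = simActList k n v i ρ d c β q₀ q
      (α.serialize.getD 0 0) (α.serialize.getD 1 0) := by
  have hc' : 1 ≤ c ∧ c ≤ v := hc
  rcases α with _ | _ | t | (y | y) | (y | y) <;>
    simp only [simRhs, simAct, simActList, Instr.serialize, List.getD_cons_zero,
      List.getD_cons_succ, if_pos hc, if_pos hc'] <;> split_ifs <;>
    first | contradiction | rfl

theorem serialize_simRhs_act_of_not_isVisibleNo {ρ : ℕ} {q₀ q : Fin n} (hc : ¬ IsVisibleNo v c)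
    (α : Instr (Fin v) (Fin i)) :
    (simRhs (D := .ofRanks output) k ρ d c β q₀ (.act q α)).serialize = simActList k n v i ρ d c β q₀ q
      (α.serialize.getD 0 0) (α.serialize.getD 1 0) := by
  have hc' : ¬ (1 ≤ c ∧ c ≤ v) := hc
  rcases α with _ | _ | t | (y | y) | (y | y) <;>
    simp only [simRhs, simAct, simActList, Instr.serialize, List.getD_cons_zero,
      List.getD_cons_succ, if_neg hc, if_neg hc'] <;> split_ifs <;>
    first | contradiction | rfl

theorem serialize_simRhs_act {ρ : ℕ} {q₀ q : Fin n} (α : Instr (Fin v) (Fin i)) :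
    (simRhs (D := .ofRanks output) k ρ d c β q₀ (.act q α)).serialize = simActList k n v i ρ d c β q₀ q
      (α.serialize.getD 0 0) (α.serialize.getD 1 0) := by
  by_cases hc : IsVisibleNo v c
  · exact serialize_simRhs_act_of_isVisibleNo hc α
  · exact serialize_simRhs_act_of_not_isVisibleNo hc α

/-- For `k = 0`, the nested mode uses neither drops nor lifts, so there is nothing to erase. -/
theorem serialize_erase_simRhs_act {ρ : ℕ} {q₀ q : Fin n} (hc : ¬ IsVisibleNo v c)
    (α : Instr (Fin v) (Fin i)) :
    ((simRhs (D := .ofRanks output) 0 ρ d c β q₀ (.act q α)).erase.getD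
      (.act (mainState q₀) .stay)).serialize =
    (simRhs (D := .ofRanks output) 0 ρ d c β q₀ (.act q α)).serialize := by
  rcases α with _ | _ | t | (y | y) | (y | y) <;>
    simp only [simRhs, simAct, if_neg hc] <;> (try split_ifs) <;>
    first | contradiction | rfl

theorem simRhsList_eq (h : M.serialize.drop o = r.serialize ++ rest) :
    simRhsList k M.serialize o (3 + v + i) d c β =
      (simRhs k ((RankedAlphabet.ofRanks input).rank r.a) d c β r.q r.rhs).serialize := by
  have h1 := getD_rule_rhs h
  have h0 := h1 0
  rw [add_zero] at h0
  rw [simRhsList, h0, h1, h1, h1, getD_rule_q h, getD_rule_a h, inRank_serialize_fin,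
    numStates_serialize, numVis_serialize, numInv_serialize]
  rcases hr : r.rhs with ⟨q, α⟩ | ⟨y, qs⟩
  · rw [serialize_simRhs_act, Rhs.serialize]
    simp only [List.cons_append, List.getD_cons_zero, List.getD_cons_succ, if_true]
    rcases α with _ | _ | t | (y | y) | (y | y) <;> rfl
  · have h2 := outRank_serialize_fin M y
    rw [hr] at h1
    simp only [Rhs.serialize, List.cons_append, List.getD_cons_zero, List.getD_cons_succ,
      one_ne_zero, if_false, simRhs, h2]
    congr 2
    refine (ofFn_eq_map_range rfl fun m => ?_).symm
    rw [add_assoc (3 + v + i), h1, add_comm 2, Rhs.serialize, List.cons_append, List.getD_cons_succ,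
      List.cons_append, List.getD_cons_succ, getD_append_lt (by simp),
      List.getD_eq_getElem _ _ (by simp), List.getElem_ofFn]
    rfl

theorem bits_empty (n : ℕ) : bits (∅ : Finset (Fin n)) = List.replicate n 0 := by
  simp [bits]

theorem simRuleList_eq (h : M.serialize.drop o = r.serialize ++ rest) (hr : r ∈ M.rules)
    (hd : d ≤ (RankedAlphabet.ofRanks input).maxRank + 1) (hc : c ≤ v + i) (hk : k ≠ 0) :
    simRuleList k M.serialize o d c β =
      (simRule (S := .ofRanks input) (Equiv.refl (Fin input.length)) k r d c β).serialize := by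
  obtain ⟨hj, -⟩ := M.wellFormed r hr
  rw [simRuleList, if_neg hk, simColoursList_eq M h, Rule.serialize, getD_rule_q h, getD_rule_a h,
    getD_rule_j h, inRank_serialize_fin, maxInRank_serialize, numCol_serialize, numVis_serialize,
    numInv_serialize, simRhsList_eq M h]
  simp only [simRule, simOKList_iff M h, List.append_assoc]
  rw [val_encSym hj hd hc]
  refine congrArg₂ (· ++ ·) rfl (congrArg₂ (· ++ ·) rfl (congrArg₂ (· ++ ·) rfl ?_))
  split_ifs <;> rfl

theorem enterExitList_eq (a : Fin input.length) {j : ℕ}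
    (hj : j ≤ (RankedAlphabet.ofRanks input).maxRank) (q : Fin n) (y : Fin v) :
    enterExitList M.serialize a j q y =
      (enterRule (S := .ofRanks input) (D := .ofRanks output) (i := i)
        (Equiv.refl (Fin input.length)) a j q y).serialize ++
      (exitRule (S := .ofRanks input) (D := .ofRanks output) (i := i)
        (Equiv.refl (Fin input.length)) a j q y).serialize := by
  have hs := val_encSym (S := .ofRanks input) (e := Equiv.refl (Fin input.length)) (nc := v + i)
    (a := a) (d := 1) (c := 1 + y) hj (by omega) (by omega)
  have hl : (∅ : Finset (Fin v ⊕ Fin (i + 1))).toLeft = ∅ := by ext x; simp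
  have hr : (∅ : Finset (Fin v ⊕ Fin (i + 1))).toRight = ∅ := by ext x; simp
  rw [enterExitList, Rule.serialize, Rule.serialize]
  simp only [enterRule, exitRule, hs, numStates_serialize, maxInRank_serialize, numCol_serialize,
    inRank_serialize_fin, numVis_serialize, numInv_serialize, hl, hr, bits_empty, List.append_assoc, List.replicate_add v]
  rfl

/-- The main states are the first third of the states, and only they can be initial. -/
theorem bits_simPTT_init (M : PTT (.ofRanks input) (.ofRanks output) (Fin n) (Fin v) (Fin i) k) :
    bits (M.init.map ⟨mainState, fun _ _ h => mainState_inj.1 h⟩) =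
      ((List.range n).map fun q => initBit M.serialize q) ++ List.replicate (2 * n) 0 := by
  refine List.ext_getElem (by simp [length_bits]; omega) fun q h1 h2 => ?_
  rw [length_bits] at h1
  have h3 := getD_bits (M.init.map ⟨mainState, fun _ _ h => mainState_inj.1 h⟩) ⟨q, h1⟩
  rw [List.getD_eq_getElem _ _ (by rw [length_bits]; exact h1)] at h3
  rw [h3, List.getElem_append]
  simp only [List.length_map, List.length_range, List.getElem_map, List.getElem_range,
    List.getElem_replicate, Finset.mem_map]
  split_ifs with h4 h5 h5
  · obtain ⟨q', hq', h6⟩ := h4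
    have h7 : (q' : ℕ) = q := congrArg Fin.val h6
    rw [← h7, initBit_serialize, if_pos hq']
  · obtain ⟨q', hq', h6⟩ := h4
    have h7 : (q' : ℕ) = q := congrArg Fin.val h6
    exact absurd q'.isLt (by omega)
  · rw [show q = ((⟨q, h5⟩ : Fin n) : ℕ) from rfl, initBit_serialize, if_neg]
    exact fun h6 => h4 ⟨_, h6, rfl⟩
  · rfl

theorem simList_eq (hk : k ≠ 0) : simList k M.serialize =
    (simPTT (S := .ofRanks input) (Equiv.refl (Fin input.length)) M).serialize := by
  have h1 : (simPTT (S := .ofRanks input) (Equiv.refl (Fin input.length)) M).rules.length =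
      M.rules.length * (((RankedAlphabet.ofRanks input).maxRank + 2) * ((v + i + 1) * 2)) +
        input.length * (((RankedAlphabet.ofRanks input).maxRank + 1) * (n * (v * 2))) := by
    dsimp only [simPTT]
    rw [if_neg hk, List.length_append]
    refine congrArg₂ (· + ·) ?_ ?_
    · refine length_flatMap_const fun r _ => ?_
      rw [length_flatMap_const, List.length_range]
      intro d _
      rw [length_flatMap_const, List.length_range]
      intro c _
      simp
    · rw [length_flatMap_const, List.length_finRange]
      intro a _
      rw [length_flatMap_const, List.length_range]
      intro j _
      rw [length_flatMap_const, List.length_finRange]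
      intro q _
      rw [length_flatMap_const, List.length_finRange]
      intro y _
      rfl
  have h2 : (simPTT (S := .ofRanks input) (Equiv.refl (Fin input.length)) M).rules.flatMap
      Rule.serialize = ((List.range M.rules.length).flatMap fun ρ =>
        (List.range ((RankedAlphabet.ofRanks input).maxRank + 2)).flatMap fun d =>
          (List.range (v + i + 1)).flatMap fun c => (List.range 2).flatMap fun β =>
            simRuleList k M.serialize (ruleOffset M.serialize ρ) d c β) ++
      (List.range input.length).flatMap fun a =>
        (List.range ((RankedAlphabet.ofRanks input).maxRank + 1)).flatMap fun j =>
          (List.range n).flatMap fun q => (List.range v).flatMap fun y =>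
            enterExitList M.serialize a j q y := by
    dsimp only [simPTT]
    rw [if_neg hk, List.flatMap_append]
    refine congrArg₂ (· ++ ·) ?_ ?_
    · rw [List.flatMap_assoc]
      refine flatMap_eq_flatMap_range fun ρ hρ => ?_
      obtain ⟨rest, h⟩ := exists_drop_ruleOffset M hρ
      rw [List.flatMap_assoc]
      refine List.flatMap_congr fun d hd => ?_
      rw [List.flatMap_assoc]
      refine List.flatMap_congr fun c hc => ?_
      rw [List.flatMap_map]
      refine List.flatMap_congr fun β _ => ?_
      simp only [List.mem_range] at hd hc
      exact (simRuleList_eq M h (List.getElem_mem hρ) (by omega) (by omega) hk).symm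
    · rw [List.flatMap_assoc]
      refine flatMap_finRange fun a => ?_
      rw [List.flatMap_assoc]
      refine List.flatMap_congr fun j hj => ?_
      rw [List.flatMap_assoc]
      refine flatMap_finRange fun q => ?_
      rw [List.flatMap_assoc]
      refine flatMap_finRange fun y => ?_
      simp only [List.mem_range] at hj
      rw [enterExitList_eq M a (by omega) q y]
      simp
  conv_rhs => rw [PTT.serialize]
  rw [h1, h2, simList, encAlphabetList_serialize, outputList_serialize, numStates_serialize,
    numVis_serialize, numInv_serialize, numRules_serialize, maxInRank_serialize, numCol_serialize,
    numIn_serialize, if_neg hk, if_neg hk, if_neg hk]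
  refine congrArg₂ (· ++ ·) (congrArg₂ (· ++ ·) rfl ?_) rfl
  exact (bits_simPTT_init M).symm

end SimulationProgram

/-! ### The simulating transducer without pebbles -/

section SimulationProgramZero

variable {input output : List ℕ} {n v i : ℕ}
  (M : PTT (.ofRanks input) (.ofRanks output) (Fin n) (Fin v) (Fin i) 0)
  {r : Rule (.ofRanks input) (.ofRanks output) (Fin n) (Fin v) (Fin i)} {rest : List ℕ}
  {o d c β : ℕ}

theorem simRhsList_eq_erase (h : M.serialize.drop o = r.serialize ++ rest)
    (hc : ¬ IsVisibleNo v c) :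
    simRhsList 0 M.serialize o (3 + v + i) d c β =
      ((simRhs 0 ((RankedAlphabet.ofRanks input).rank r.a) d c β r.q r.rhs).erase.getD
        (.act (mainState r.q) .stay)).serialize := by
  have h1 := simRhsList_eq (d := d) (c := c) (β := β) M h
  rw [h1]
  rcases hr : r.rhs with ⟨q, α⟩ | ⟨y, qs⟩
  · rw [serialize_erase_simRhs_act hc]
  · rfl

/-- For `k = 0`, compatibility forces the nested mode, where the set of tested colours is empty. So
erasing affects only the format, in which the colours disappear. -/
theorem simRuleList_eq_erase (h : M.serialize.drop o = r.serialize ++ rest) (hr : r ∈ M.rules)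
    (hd : d ≤ (RankedAlphabet.ofRanks input).maxRank + 1) (hc : c ≤ v + i) :
    simRuleList 0 M.serialize o d c β =
      (simRule (S := .ofRanks input) (Equiv.refl (Fin input.length)) 0 r d c β).erase.serialize := by
  obtain ⟨hj, -⟩ := M.wellFormed r hr
  rw [simRuleList, if_pos rfl, Rule.serialize, getD_rule_q h, getD_rule_a h,
    getD_rule_j h, inRank_serialize_fin, maxInRank_serialize, numCol_serialize, numVis_serialize,
    numInv_serialize]
  simp only [Rule.erase, simRule, simOKList_iff M h]
  rw [val_encSym hj hd hc]
  refine congrArg₂ (· ++ ·) rfl ?_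
  split_ifs with hok h2 h2
  · refine simRhsList_eq_erase M h fun hv => ?_
    rw [SimOK, if_pos hv] at hok
    exact hok.1 rfl
  · refine absurd ?_ h2
    have hv : ¬ IsVisibleNo v c := by
      intro hv
      rw [SimOK, if_pos hv] at hok
      exact hok.1 rfl
    simp [simColours, hv]
  · rfl
  · exact absurd rfl h2

theorem simList_eq_erase : simList 0 M.serialize =
    (simPTT (S := .ofRanks input) (Equiv.refl (Fin input.length)) M).erase.serialize := by
  have h1 : (simPTT (S := .ofRanks input) (Equiv.refl (Fin input.length)) M).erase.rules.length =
      M.rules.length * (((RankedAlphabet.ofRanks input).maxRank + 2) * ((v + i + 1) * 2)) := by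
    dsimp only [PTT.erase, simPTT]
    rw [List.length_map, if_pos rfl, List.append_nil]
    refine length_flatMap_const fun r _ => ?_
    rw [length_flatMap_const, List.length_range]
    intro d _
    rw [length_flatMap_const, List.length_range]
    intro c _
    simp
  have h2 : (simPTT (S := .ofRanks input) (Equiv.refl (Fin input.length)) M).erase.rules.flatMap
      Rule.serialize = (List.range M.rules.length).flatMap fun ρ =>
        (List.range ((RankedAlphabet.ofRanks input).maxRank + 2)).flatMap fun d =>
          (List.range (v + i + 1)).flatMap fun c => (List.range 2).flatMap fun β =>
            simRuleList 0 M.serialize (ruleOffset M.serialize ρ) d c β := by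
    dsimp only [PTT.erase, simPTT]
    rw [List.flatMap_map, if_pos rfl, List.append_nil, List.flatMap_assoc]
    refine flatMap_eq_flatMap_range fun ρ hρ => ?_
    obtain ⟨rest, h⟩ := exists_drop_ruleOffset M hρ
    rw [List.flatMap_assoc]
    refine List.flatMap_congr fun d hd => ?_
    rw [List.flatMap_assoc]
    refine List.flatMap_congr fun c hc => ?_
    rw [List.flatMap_map]
    refine List.flatMap_congr fun β _ => ?_
    simp only [List.mem_range] at hd hc
    exact (simRuleList_eq_erase M h (List.getElem_mem hρ) (by omega) (by omega)).symm
  conv_rhs => rw [PTT.serialize]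
  rw [h1, h2, simList, encAlphabetList_serialize, outputList_serialize, numStates_serialize,
    numRules_serialize, maxInRank_serialize, numCol_serialize, if_pos rfl, if_pos rfl, if_pos rfl,
    List.append_nil, add_zero]
  refine congrArg₂ (· ++ ·) (congrArg₂ (· ++ ·) rfl ?_) rfl
  exact (bits_simPTT_init M).symm

end SimulationProgramZero

end PebbleTree

namespace PebbleTree

/-! ### The decomposition -/

/-- The first transducer of the decomposition: it produces encoded trees. -/
abbrev PTTCode.enc {k : ℕ} (p : PTTCode k) : TT (.ofRanks p.input)
    (encAlphabet (S := .ofRanks p.input) (Equiv.refl (Fin p.input.length))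
      (p.visible + p.invisible))
    (Fin (encStates (RankedAlphabet.ofRanks p.input).maxRank (p.visible + p.invisible))) :=
  encTT (S := .ofRanks p.input) (Equiv.refl (Fin p.input.length)) (p.visible + p.invisible)

/-- The transducer that simulates a given one on encoded trees. -/
abbrev PTTCode.sim {k : ℕ} (p : PTTCode k) : PTT (encAlphabet (S := .ofRanks p.input)
    (Equiv.refl (Fin p.input.length)) (p.visible + p.invisible)) (.ofRanks p.output)
    (Fin (3 * p.states)) (Fin p.visible) (Fin (p.invisible + 1)) (k - 1) :=
  simPTT (S := .ofRanks p.input) (Equiv.refl (Fin p.input.length)) p.ptt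

/-- The presentation of the transducer that simulates a given one on encoded trees. -/
abbrev PTTCode.simCode {k : ℕ} (p : PTTCode (k + 1)) : PTTCode k where
  input := encRanks (S := .ofRanks p.input) (Equiv.refl (Fin p.input.length))
    (p.visible + p.invisible)
  output := p.output
  states := 3 * p.states
  visible := p.visible
  invisible := p.invisible + 1
  ptt := p.sim

/-- The decomposition of a pebble tree transducer. -/
def PTTCode.decompose : {k : ℕ} → (p : PTTCode k) → TTChain (k + 2) p.input p.output
  | 0, p => .cons _ p.enc (.single _ p.sim.erase)
  | _ + 1, p => .cons _ p.enc p.simCode.decompose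

theorem PTTCode.transduction_decompose {k : ℕ} (p : PTTCode k) :
    p.decompose.transduction = p.ptt.transduction := by
  induction k with
  | zero => exact encTT_comp_erase p.ptt rfl
  | succ k ih =>
    rw [PTTCode.decompose, TTChain.transduction, ih p.simCode]
    exact encTT_comp_simPTT p.ptt

theorem PTTCode.serialize_decompose {k : ℕ} (p : PTTCode k) :
    p.decompose.serialize = chainList k p.ptt.serialize := by
  induction k with
  | zero =>
    rw [chainList, encTTList_serialize, simList_eq_erase]
    rfl
  | succ k ih =>
    rw [chainList, encTTList_serialize, simList_eq _ (Nat.succ_ne_zero k), PTTCode.decompose,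
      TTChain.serialize, ih p.simCode]

/-- The induction must allow the input alphabet, the states and the colours to vary, since the
simulating transducer works on encoded trees with more states and one more invisible colour. -/
theorem PTT.transduction_mem_pow {n v i k : ℕ} {S D : RankedAlphabet}
    (M : PTT S D (Fin n) (Fin v) (Fin i) k) : M.transduction ∈ TTClass.pow (k + 2) S D := by
  induction k generalizing S n v i with
  | zero => exact ⟨encAlphabet (Fintype.equivFin S.Sym) (v + i), _, _, ⟨_, inferInstance, _, rfl⟩,
      ⟨_, inferInstance, _, rfl⟩, (encTT_comp_erase M rfl).symm⟩
  | succ k ih => exact ⟨encAlphabet (Fintype.equivFin S.Sym) (v + i), _, _,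
      ⟨_, inferInstance, _, rfl⟩, ih (simPTT (Fintype.equivFin S.Sym) M),
      (encTT_comp_simPTT M).symm⟩

theorem VIPTT_subset_pow (k : ℕ) (S D : RankedAlphabet) :
    VIPTT k S D ⊆ TTClass.pow (k + 2) S D := by
  rintro _ ⟨Q, V, I, hQ, hV, hI, M, rfl⟩
  rw [← PTT.transduction_rename M (Finite.equivFin Q) (Finite.equivFin V) (Finite.equivFin I)]
  exact PTT.transduction_mem_pow _

end PebbleTree

theorem mainTheorem2 (k : ℕ) :
    (∀ S D : PebbleTree.RankedAlphabet,
      PebbleTree.VIPTT k S D ⊆ PebbleTree.TTClass.pow (k + 2) S D) ∧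
    ∃ construct : (p : PebbleTree.PTTCode k) → PebbleTree.TTChain (k + 2) p.input p.output,
      (∀ p : PebbleTree.PTTCode k, (construct p).transduction = p.ptt.transduction) ∧
      Nonempty (Turing.TM2ComputableInPolyTime
        (PebbleTree.PTTCode.encode (k := k)) (id : List Bool → List Bool)
        (fun p => (construct p).encode)) :=
  ⟨PebbleTree.VIPTT_subset_pow k, PebbleTree.PTTCode.decompose,
    PebbleTree.PTTCode.transduction_decompose,
    (PebbleTree.listComp_chainList k).computableInPolyTime
      (fun p : PebbleTree.PTTCode k => p.ptt.serialize) (fun p => p.decompose.serialize)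
      PebbleTree.PTTCode.serialize_decompose⟩
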